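/- \textbf{Model.} A database $D$ of size $n$ consists of $n$ records (identified by their indices), each having a type in $\{1,\dots,k\}$; $n_i$ is the number of records of type $i$. Two databases of size $n$ are neighboring if they differ in exactly one record. A (randomized) algorithm works with a small private memory and an external memory $a[1..M]$, both consisting of words of $w$ bits; initially $a[1..n]$ holds the types of the $n$ records and the remaining cells hold $0$. In each step it performs an arbitrary (randomized, free) computation on the private memory, which is all that it remembers between steps, and then either halts or makes one access: $\mathsf{read}(a[j])$ copies $a[j]$ to a word of the private memory, $\mathsf{write}(a[j])$ copies a word of the private memory to $a[j]$. Its output $(\hat n_1,\dots,\hat n_k)$ is read from $k$ fixed external cells after it halts, each interpreted as a signed fixed-point number. Its access pattern is the sequence of its operations $\mathsf{read}(a[j])$, $\mathsf{write}(a[j])$ (kinds and addresses, not contents). Its running time is the number of steps, in the worst case over the database and the random choices. The algorithm is $(\epsilon,\delta)$-obliviously differentially private (ODP) if for all neighboring databases $D_1,D_2$, every set $O$ of outputs and every set $S$ of access patterns, $$\Pr[\mathrm{output}(D_1)\in O,\ \mathrm{pattern}(D_1)\in S]\le e^{\epsilon}\,\Pr[\mathrm{output}(D_2)\in O,\ \mathrm{pattern}(D_2)\in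 S]+\delta .$$ \textbf{Theorem.} There are absolute constants $C>0$ and $c\in\mathbb N$ such that for every real $\epsilon>0$ and all integers $1\le k\le n$, with $\tilde n=\max(n,\,k\log n/\epsilon)$, there is an algorithm on databases of $n$ records of $k$ types with the following properties. 1. Its private memory consists of at most $C(1+\log n)^c$ words, and its words have at most $C(1+\log\tilde n)$ bits. 2. It always halts, and if $\tilde n\ge 3$, its running time is at most $C\,\tilde n\log\tilde n/\log\log\tilde n$. 3. It is $(\epsilon,1/n^2)$-obliviously differentially private. 4. For every $\theta\in(0,1)$ and every database $D$, with probability at least $1-\theta$, $$\max_{1\le i\le k}|\hat n_i-n_i|\le \log(k/\theta)\cdot\frac{2}{\epsilon}.$$ -/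

import Mathlib

noncomputable section

namespace ODP

/-- A database with `n` records.  The index of a record is its unique identifier, and the value
is its type, one of the `k` types. -/
abbrev Database (n k : ℕ) : Type := Fin n → Fin k

/-- Two databases (of the same size) are neighboring if they differ in exactly one record. -/
def Neighboring {n k : ℕ} (D₁ D₂ : Database n k) : Prop :=
  ∃ i, D₁ i ≠ D₂ i ∧ ∀ j, j ≠ i → D₁ j = D₂ j

/-- The histogram: the number of records of type `i`. -/
def histogram {n k : ℕ} (D : Database n k) (i : Fin k) : ℕ :=
  (Finset.univ.filter fun j => D j = i).card

/-- One access to an external memory of `M` cells, as the adversary sees it: the address and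
whether the cell is read or written, but not the (encrypted) content. -/
inductive Access (M : ℕ) : Type
  | read (a : Fin M)
  | write (a : Fin M)

/-- What a program with `m` private registers and `M` external cells does after a private
computation: it stops, copies an external cell to a register, or copies a register to an
external cell. -/
inductive Instr (m M : ℕ) : Type
  | halt
  | read (a : Fin M) (r : Fin m)
  | write (a : Fin M) (r : Fin m)

/-- A randomized external-memory algorithm on databases with `n` records of `k` types.

The private memory consists of `privWords` words of `wordBits` bits; it is everything that the
algorithm remembers between two accesses (there is no further control state).  The external memory
consists of `extCells` words.  Computation on private memory is free and arbitrary: from the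
content of the private memory, `prog` produces at random the new content and the next
instruction.  The input occupies the first `n` external cells, one record per cell, and the output
is read, after the algorithm has stopped, from `k` fixed external cells, which hold signed
fixed-point numbers with `fracBits` fractional bits. -/
structure Algorithm (n k : ℕ) where
  wordBits : ℕ
  privWords : ℕ
  extCells : ℕ
  fracBits : ℕ
  types_fit : k ≤ 2 ^ wordBits
  input_fits : n ≤ extCells
  outCell : Fin k → Fin extCells
  init : Fin privWords → BitVec wordBits
  prog : (Fin privWords → BitVec wordBits) →
    PMF ((Fin privWords → BitVec wordBits) × Instr privWords extCells)

namespace Algorithm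

variable {n k : ℕ} (A : Algorithm n k)

/-- A configuration of a run, together with the access pattern `trace` so far. -/
structure Config where
  priv : Fin A.privWords → BitVec A.wordBits
  ext : Fin A.extCells → BitVec A.wordBits
  trace : List (Access A.extCells)
  halted : Bool

/-- The initial configuration: the records are in the first `n` external cells, and the other
external cells hold `0`. -/
def start (D : Database n k) : A.Config where
  priv := A.init
  ext := fun a => if h : a.val < n then BitVec.ofNat A.wordBits (D ⟨a.val, h⟩).val else 0
  trace := []
  halted := false

/-- Carrying out an instruction when the private memory holds `p`. -/
def perform (c : A.Config) (p : Fin A.privWords → BitVec A.wordBits) :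
    Instr A.privWords A.extCells → A.Config
  | .halt => { c with priv := p, halted := true }
  | .read a r =>
      { c with priv := Function.update p r (c.ext a), trace := c.trace ++ [Access.read a] }
  | .write a r =>
      { c with
        priv := p
        ext := Function.update c.ext a (p r)
        trace := c.trace ++ [Access.write a] }

/-- One step: a private computation and then one instruction, hence at most one access to the
external memory.  A halted configuration does not change any more. -/
def step (c : A.Config) : PMF A.Config :=
  if c.halted then PMF.pure c
  else (A.prog c.priv).map fun q => A.perform c q.1 q.2

/-- The law of the configuration after `t` steps on the database `D`. -/
def run (D : Database n k) : ℕ → PMF A.Config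
  | 0 => PMF.pure (A.start D)
  | t + 1 => (run D t).bind A.step

/-- `A` runs in time `t`: on every database and for all outcomes of the random choices, it halts
within `t` steps.  In particular it makes at most `t` accesses to the external memory. -/
def RunsInTime (t : ℕ) : Prop :=
  ∀ D : Database n k, ∀ c ∈ (A.run D t).support, c.halted = true

/-- The numbers in the output cells. -/
def output (c : A.Config) (i : Fin k) : ℝ :=
  ((c.ext (A.outCell i)).toInt : ℝ) / 2 ^ A.fracBits

/-- The joint law of the output and the access pattern after `t` steps; if `A` runs in time `t`,
this is their law for the complete run. -/
def view (D : Database n k) (t : ℕ) : PMF ((Fin k → ℝ) × List (Access A.extCells)) :=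
  (A.run D t).map fun c => (A.output c, c.trace)

/-- The inequalities of `(ε, δ)`-oblivious differential privacy, for runs of length `t`: for
neighboring databases, every set `O` of outputs and every set `S` of access patterns. -/
def IsObliviouslyDP (t : ℕ) (ε δ : ℝ) : Prop :=
  ∀ D₁ D₂ : Database n k, Neighboring D₁ D₂ →
    ∀ (O : Set (Fin k → ℝ)) (S : Set (List (Access A.extCells))),
      (A.view D₁ t).toOuterMeasure (O ×ˢ S) ≤
        ENNReal.ofReal (Real.exp ε) * (A.view D₂ t).toOuterMeasure (O ×ˢ S) + ENNReal.ofReal δ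

end Algorithm

/-- `ñ = max(n, k log n / ε)`. -/
def nTilde (n k : ℕ) (ε : ℝ) : ℝ := max (n : ℝ) (k * Real.log n / ε)

end ODP

end

set_option linter.unusedSectionVars false

noncomputable section

/-! There are three regimes of `ε`, apart from `k = 1`, where the constant output `n` is exact. If
`ε * n ≤ 1`, the error allowed is at least `n`, and the constant output `0` suffices. If `ε ≥ 4 log
n`, randomized response works: every record reports its type shifted by a random element of `Fin k`
that is rarely nonzero. Output and access pattern are functions of the reports alone, and the error
is at most the number of falsified reports.

The remaining range `1 / n < ε < 4 log n` needs a network. Each type receives two-sided geometric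
noise in multiples of `1 / m`. Its integral part is realized by activating some of `2 * R` dummy
elements of that type, its remainder by the initial value of a counter. All elements, including
inactive dummies, get uniform labels in `Fin L → Fin B` and are routed to the bucket named by their
label. At level `l`, the `B` buckets that differ only in digit `l` are loaded into private memory
and rearranged by that digit. These addresses are fixed. Only the final scan, which adds every cell
to the counter of its type, makes accesses that depend on the data.

Privacy: as long as no bucket overflows, the array after the last level is a function of the
multiset of pairs (type, label), since lines are put into a canonical order (`levels_eq_of_perm`).
So the view is determined by noisy counts and anonymous labels. For databases that differ in one
record, moving one unit of noise between the two types and permuting the labels accordingly makes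
the views equal (`exists_matching`). This is an injection of the seeds that changes weights by at
most `exp ε`. It fails only for zero noise (which has two signs), for noise near its truncation, and
for overflow (`mass_overflow_le`), with total probability at most `1 / n ^ 2`.

Accuracy: an overflow destroys no word, so the error is exactly the noise, whose tail is `q ^ u`
with `q = exp (-ε / (2 * m))`.

Cost: each level touches `B ^ L * Z = O(ñ)` cells. `exists_dimensions` gives `L = O(log ñ / log log
ñ)` with `B` polynomial in `L`, so that a line of `B * Z` words fits into private memory. Since a
machine has no state besides its private memory, algorithms are written as program trees, and
`exists_algorithm` turns a tree into a machine once its continuations can be numbered by private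
words. -/

namespace ODP

/-! ### Program trees, their law and the number of their continuations -/

/-- Randomized external-memory programs with addresses `α`, words `W` and random seeds `Ω`. -/
inductive Prog (α W Ω : Type) : Type
  | halt
  | read (a : α) (k : W → Prog α W Ω)
  | write (a : α) (x : W) (k : Prog α W Ω)
  | sample (k : Ω → Prog α W Ω)

/-- The external memory together with the access pattern so far (`true` marks a write). -/
abbrev Store (α W : Type) : Type := (α → W) × List (α × Bool)

namespace Prog

variable {α W Ω : Type}

instance : Inhabited (Prog α W Ω) := ⟨halt⟩

/-- Sequential composition. -/
def seq : Prog α W Ω → Prog α W Ω → Prog α W Ω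
  | halt, q => q
  | read a k, q => read a fun v => (k v).seq q
  | write a x k, q => write a x (k.seq q)
  | sample k, q => sample fun s => (k s).seq q

/-- Sequential composition of a list of programs. -/
def seqList : List (Prog α W Ω) → Prog α W Ω
  | [] => halt
  | p :: l => p.seq (seqList l)

/-- The program makes at most `T` accesses. -/
def Bounded : Prog α W Ω → ℕ → Prop
  | halt, _ => True
  | read _ k, T => 1 ≤ T ∧ ∀ v, (k v).Bounded (T - 1)
  | write _ _ k, T => 1 ≤ T ∧ k.Bounded (T - 1)
  | sample k, T => ∀ s, (k s).Bounded T

/-- The continuations that occur during an execution: what remains to be done after an access, as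
a function of the word in the data register. -/
def reach : Prog α W Ω → Set (W → Prog α W Ω)
  | halt => ∅
  | read _ k => insert k (⋃ v, (k v).reach)
  | write _ _ k => insert (fun _ => k) k.reach
  | sample k => ⋃ s, (k s).reach

/-- An upper bound for the number of continuations. -/
def cost [Fintype W] [Fintype Ω] : Prog α W Ω → ℕ
  | halt => 0
  | read _ k => 1 + ∑ v, (k v).cost
  | write _ _ k => 1 + k.cost
  | sample k => ∑ s, (k s).cost

/-- Performs the sampling that precedes the next access. -/
def resolve (μ : PMF Ω) : Prog α W Ω → PMF (Prog α W Ω)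
  | halt => PMF.pure halt
  | read a k => PMF.pure (read a k)
  | write a x k => PMF.pure (write a x k)
  | sample k => μ.bind fun s => (k s).resolve μ

/-- The law of the final store. -/
def den [DecidableEq α] (μ : PMF Ω) : Prog α W Ω → Store α W → PMF (Store α W)
  | halt, s => PMF.pure s
  | read a k, s => (k (s.1 a)).den μ (s.1, s.2 ++ [(a, false)])
  | write a x k, s => k.den μ (Function.update s.1 a x, s.2 ++ [(a, true)])
  | sample k, s => μ.bind fun r => (k r).den μ s

theorem Bounded.mono {p : Prog α W Ω} {S T : ℕ} (h : p.Bounded S) (hST : S ≤ T) :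
    p.Bounded T := by
  induction p generalizing S T with
  | halt => trivial
  | read a k ih =>
    exact ⟨h.1.trans hST, fun v => ih v (h.2 v) (Nat.sub_le_sub_right hST 1)⟩
  | write a x k ih => exact ⟨h.1.trans hST, ih h.2 (Nat.sub_le_sub_right hST 1)⟩
  | sample k ih => exact fun s => ih s (h s) hST

theorem Bounded.seq {p q : Prog α W Ω} {S T : ℕ} (hp : p.Bounded S) (hq : q.Bounded T) :
    (p.seq q).Bounded (S + T) := by
  induction p generalizing S with
  | halt => exact hq.mono (Nat.le_add_left _ _)
  | read a k ih =>
    refine ⟨hp.1.trans (Nat.le_add_right _ _), fun v => ?_⟩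
    have := ih v (hp.2 v)
    rwa [show S - 1 + T = S + T - 1 by have := hp.1; omega] at this
  | write a x k ih =>
    refine ⟨hp.1.trans (Nat.le_add_right _ _), ?_⟩
    have := ih hp.2
    rwa [show S - 1 + T = S + T - 1 by have := hp.1; omega] at this
  | sample k ih => exact fun s => ih s (hp s)

theorem bounded_seqList {ι : Type} (l : List ι) (p : ι → Prog α W Ω) {T : ℕ}
    (h : ∀ i, (p i).Bounded T) : (seqList (l.map p)).Bounded (l.length * T) := by
  induction l with
  | nil => trivial
  | cons i l ih =>
    rw [List.length_cons, Nat.succ_mul, Nat.add_comm]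
    exact (h i).seq ih

theorem reach_finite [Finite W] [Finite Ω] (p : Prog α W Ω) : p.reach.Finite := by
  induction p with
  | halt => exact Set.finite_empty
  | read a k ih => exact (Set.finite_iUnion ih).insert _
  | write a x k ih => exact ih.insert _
  | sample k ih => exact Set.finite_iUnion ih

theorem ncard_iUnion_le {ι β : Type} [Fintype ι] (s : ι → Set β) :
    (⋃ i, s i).ncard ≤ ∑ i, (s i).ncard := by
  classical
  have := Set.ncard_iUnion_le_of_fintype s
  exact this

theorem ncard_reach_le_cost [Fintype W] [Fintype Ω] (p : Prog α W Ω) :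
    p.reach.ncard ≤ p.cost := by
  induction p with
  | halt => simp [reach]
  | read a k ih =>
    refine (Set.ncard_insert_le _ _).trans ?_
    rw [cost, Nat.add_comm]
    exact Nat.add_le_add_left ((ncard_iUnion_le _).trans (Finset.sum_le_sum fun v _ => ih v)) 1
  | write a x k ih =>
    refine (Set.ncard_insert_le _ _).trans ?_
    rw [cost, Nat.add_comm]
    exact Nat.add_le_add_left ih 1
  | sample k ih => exact (ncard_iUnion_le _).trans (Finset.sum_le_sum fun v _ => ih v)

theorem reach_seq_subset (p q : Prog α W Ω) :
    (p.seq q).reach ⊆ (fun K v => (K v).seq q) '' p.reach ∪ q.reach := by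
  induction p with
  | halt => exact Set.subset_union_right
  | read a k ih =>
    rintro K (rfl | hK)
    · exact Or.inl ⟨k, Or.inl rfl, rfl⟩
    · obtain ⟨v, hv⟩ := Set.mem_iUnion.1 hK
      rcases ih v hv with ⟨K', h, rfl⟩ | h
      · exact Or.inl ⟨K', Or.inr (Set.mem_iUnion.2 ⟨v, h⟩), rfl⟩
      · exact Or.inr h
  | write a x k ih =>
    rintro K (rfl | hK)
    · exact Or.inl ⟨fun _ => k, Or.inl rfl, rfl⟩
    · rcases ih hK with ⟨K', h, rfl⟩ | h
      · exact Or.inl ⟨K', Or.inr h, rfl⟩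
      · exact Or.inr h
  | sample k ih =>
    intro K hK
    obtain ⟨v, hv⟩ := Set.mem_iUnion.1 hK
    rcases ih v hv with ⟨K', h, rfl⟩ | h
    · exact Or.inl ⟨K', Set.mem_iUnion.2 ⟨v, h⟩, rfl⟩
    · exact Or.inr h

/-- Composition adds the numbers of continuations instead of multiplying them, because `q` always
starts afresh: information passes from `p` to `q` only through external memory. -/
theorem ncard_reach_seq_le [Finite W] [Finite Ω] (p q : Prog α W Ω) :
    (p.seq q).reach.ncard ≤ p.reach.ncard + q.reach.ncard :=
  (Set.ncard_le_ncard (reach_seq_subset p q)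
      ((p.reach_finite.image _).union q.reach_finite)).trans <|
    (Set.ncard_union_le _ _).trans <|
      Nat.add_le_add_right (Set.ncard_image_le p.reach_finite) _

theorem ncard_reach_seqList_le [Finite W] [Finite Ω] {ι : Type} (l : List ι)
    (p : ι → Prog α W Ω) {c : ℕ} (h : ∀ i, (p i).reach.ncard ≤ c) :
    (seqList (l.map p)).reach.ncard ≤ l.length * c := by
  induction l with
  | nil => simp [seqList, reach]
  | cons i l ih =>
    rw [List.length_cons, Nat.succ_mul, Nat.add_comm]
    exact (ncard_reach_seq_le _ _).trans (Nat.add_le_add (h i) ih)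

theorem den_seq [DecidableEq α] (μ : PMF Ω) (p q : Prog α W Ω) (s : Store α W) :
    (p.seq q).den μ s = (p.den μ s).bind (q.den μ) := by
  induction p generalizing s with
  | halt => exact (PMF.pure_bind _ _).symm
  | read a k ih => exact ih _ _
  | write a x k ih => exact ih _
  | sample k ih =>
    rw [seq, den, den, PMF.bind_bind]
    exact congrArg _ (funext fun r => ih r s)

theorem den_seqList_pure [DecidableEq α] (μ : PMF Ω) {ι : Type} (p : ι → Prog α W Ω)
    (f : ι → Store α W → Store α W) (h : ∀ i s, (p i).den μ s = PMF.pure (f i s))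
    (l : List ι) (s : Store α W) :
    (seqList (l.map p)).den μ s = PMF.pure (l.foldl (fun s i => f i s) s) := by
  induction l generalizing s with
  | nil => rfl
  | cons i l ih =>
    rw [List.map_cons, seqList, den_seq, h, PMF.pure_bind, ih, List.foldl_cons]

end Prog

/-! ### Execution of programs by machines -/

section Compile

variable {n k w m : ℕ} {β Ω : Type} [Fintype β]

/-- The numbering of the external cells: the input comes first. -/
def cellEquiv (n : ℕ) (β : Type) [Fintype β] : Fin n ⊕ β ≃ Fin (n + Fintype.card β) :=
  (Equiv.sumCongr (Equiv.refl _) (Fintype.equivFin β)).trans finSumFinEquiv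

/-- The access of the machine that corresponds to an access of a program. -/
def toAccess (n : ℕ) (β : Type) [Fintype β] (x : (Fin n ⊕ β) × Bool) :
    Access (n + Fintype.card β) :=
  if x.2 then Access.write (cellEquiv n β x.1) else Access.read (cellEquiv n β x.1)

/-- All continuations of a program, including the program itself. -/
def conts {α W Ω : Type} (P : Prog α W Ω) : Set (W → Prog α W Ω) := insert (fun _ => P) P.reach

/-- The reaction of the machine to a program with resolved sampling. -/
def react (enc : (BitVec w → Prog (Fin n ⊕ β) (BitVec w) Ω) → Fin m → BitVec w)
    (p : Fin (m + 1) → BitVec w) :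
    Prog (Fin n ⊕ β) (BitVec w) Ω →
      (Fin (m + 1) → BitVec w) × Instr (m + 1) (n + Fintype.card β)
  | .halt => (p, .halt)
  | .read a K => (Fin.cons (p 0) (enc K), .read (cellEquiv n β a) 0)
  | .write a x K => (Fin.cons x (enc fun _ => K), .write (cellEquiv n β a) 0)
  | .sample _ => (p, .halt)

/-- The machine that executes a program: register `0` is the data register and the other registers
hold the current continuation. -/
def compile (μ : PMF Ω) (P : Prog (Fin n ⊕ β) (BitVec w) Ω)
    (enc : (BitVec w → Prog (Fin n ⊕ β) (BitVec w) Ω) → Fin m → BitVec w)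
    (hk : k ≤ 2 ^ w) (out : Fin k → β) (f : ℕ) : Algorithm n k where
  wordBits := w
  privWords := m + 1
  extCells := n + Fintype.card β
  fracBits := f
  types_fit := hk
  input_fits := Nat.le_add_right _ _
  outCell i := cellEquiv n β (Sum.inr (out i))
  init := Fin.cons 0 (enc fun _ => P)
  prog p := ((Function.invFunOn enc (conts P) (Fin.tail p) (p 0)).resolve μ).map (react enc p)

/-- The law of the configuration after `t` steps from the configuration `c`. -/
def Algorithm.runFrom (A : Algorithm n k) (c : A.Config) : ℕ → PMF A.Config
  | 0 => PMF.pure c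
  | t + 1 => (A.step c).bind fun c' => A.runFrom c' t

/-- `Algorithm.run` appends steps at the end, while an induction over a program consumes the first
step. This lemma connects the two. -/
theorem Algorithm.runFrom_succ' (A : Algorithm n k) (c : A.Config) (t : ℕ) :
    A.runFrom c (t + 1) = (A.runFrom c t).bind A.step := by
  induction t generalizing c with
  | zero => simp [Algorithm.runFrom]
  | succ t ih =>
    rw [Algorithm.runFrom, Algorithm.runFrom, PMF.bind_bind]
    exact congrArg _ (funext fun c' => ih c')

theorem Algorithm.run_eq_runFrom (A : Algorithm n k) (D : Database n k) (t : ℕ) :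
    A.run D t = A.runFrom (A.start D) t := by
  induction t with
  | zero => rfl
  | succ t ih => rw [Algorithm.runFrom_succ', Algorithm.run, ih]

theorem Algorithm.runFrom_halted (A : Algorithm n k) (c : A.Config) (hc : c.halted = true)
    (t : ℕ) : A.runFrom c t = PMF.pure c := by
  induction t with
  | zero => rfl
  | succ t ih => rw [Algorithm.runFrom, Algorithm.step, if_pos hc, PMF.pure_bind, ih]

variable (μ : PMF Ω) (P : Prog (Fin n ⊕ β) (BitVec w) Ω)
  (enc : (BitVec w → Prog (Fin n ⊕ β) (BitVec w) Ω) → Fin m → BitVec w)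
  (hk : k ≤ 2 ^ w) (out : Fin k → β) (f : ℕ)

/-- The configuration of the machine with a given data register, continuation and store. -/
def config (p : Fin (m + 1) → BitVec w) (s : Store (Fin n ⊕ β) (BitVec w)) (h : Bool) :
    (compile μ P enc hk out f).Config where
  priv := p
  ext := fun a => s.1 ((cellEquiv n β).symm a)
  trace := s.2.map (toAccess n β)
  halted := h

/-- The configuration after the reaction to a program. -/
def after (p : Fin (m + 1) → BitVec w) (s : Store (Fin n ⊕ β) (BitVec w))
    (Q : Prog (Fin n ⊕ β) (BitVec w) Ω) : (compile μ P enc hk out f).Config :=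
  (compile μ P enc hk out f).perform (config μ P enc hk out f p s false)
    (react enc p Q).1 (react enc p Q).2

/-- Injectivity of `enc` on `conts P` lets the machine recover the continuation from its registers.
-/
theorem step_config (henc : Set.InjOn enc (conts P)) {K : BitVec w → Prog _ _ Ω}
    (hK : K ∈ conts P) (v : BitVec w) (s : Store (Fin n ⊕ β) (BitVec w)) :
    (compile μ P enc hk out f).step (config μ P enc hk out f (Fin.cons v (enc K)) s false) =
      ((K v).resolve μ).map (after μ P enc hk out f (Fin.cons v (enc K)) s) := by
  have h1 : Function.invFunOn enc (conts P) (enc K) = K := henc.leftInvOn_invFunOn hK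
  simp only [Algorithm.step, config, compile, Fin.tail_cons, Fin.cons_zero, h1, PMF.map_comp]
  rfl

theorem after_read (p : Fin (m + 1) → BitVec w) (s : Store (Fin n ⊕ β) (BitVec w))
    (a : Fin n ⊕ β) (K : BitVec w → Prog (Fin n ⊕ β) (BitVec w) Ω) :
    after μ P enc hk out f p s (.read a K) =
      config μ P enc hk out f (Fin.cons (s.1 a) (enc K)) (s.1, s.2 ++ [(a, false)]) false := by
  simp only [after, react, Algorithm.perform, config]
  congr 1
  · exact (Fin.update_cons_zero _ _ _).trans (by rw [Equiv.symm_apply_apply]; rfl)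
  · exact (List.map_append (f := toAccess n β) (l₁ := s.2) (l₂ := [(a, false)])).symm

theorem update_comp_symm {α γ W : Type} [DecidableEq α] [DecidableEq γ] (e : α ≃ γ) (g : α → W)
    (a : α) (x : W) :
    Function.update (fun c => g (e.symm c)) (e a) x = fun c => Function.update g a x (e.symm c) := by
  funext c
  by_cases h : c = e a
  · subst h
    simp
  · rw [Function.update_of_ne h, Function.update_of_ne]
    intro h'
    exact h (by rw [← h', Equiv.apply_symm_apply])

theorem after_write [DecidableEq β] (p : Fin (m + 1) → BitVec w)
    (s : Store (Fin n ⊕ β) (BitVec w))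
    (a : Fin n ⊕ β) (x : BitVec w) (K : Prog (Fin n ⊕ β) (BitVec w) Ω) :
    after μ P enc hk out f p s (.write a x K) =
      config μ P enc hk out f (Fin.cons x (enc fun _ => K))
        (Function.update s.1 a x, s.2 ++ [(a, true)]) false := by
  simp only [after, react, Algorithm.perform, config]
  congr 1
  · exact update_comp_symm _ _ _ _
  · exact (List.map_append (f := toAccess n β) (l₁ := s.2) (l₂ := [(a, true)])).symm

/-- What remains of a configuration when the private memory is forgotten. -/
def visible (c : (compile μ P enc hk out f).Config) :
    (Fin (n + Fintype.card β) → BitVec w) × List (Access (n + Fintype.card β)) × Bool :=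
  (c.ext, c.trace, c.halted)

/-- Induction on the program: sampling is absorbed into the free private computation of a step,
every access takes one step, and spare steps after halting change nothing. Private memory is
forgotten on both sides because `den` does not track it. -/
theorem resolve_bind_runFrom [DecidableEq β] (henc : Set.InjOn enc (conts P))
    (Q : Prog (Fin n ⊕ β) (BitVec w) Ω) (hQ : Q.reach ⊆ conts P) (T : ℕ) (hT : Q.Bounded T)
    (p : Fin (m + 1) → BitVec w) (s : Store (Fin n ⊕ β) (BitVec w)) :
    ((Q.resolve μ).bind fun Q' =>
      (compile μ P enc hk out f).runFrom (after μ P enc hk out f p s Q') T).map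
        (visible μ P enc hk out f) =
      (Q.den μ s).map fun s => visible μ P enc hk out f (config μ P enc hk out f p s true) := by
  induction Q generalizing T p s with
  | halt =>
    rw [Prog.resolve, PMF.pure_bind, Algorithm.runFrom_halted _ _ rfl, Prog.den, PMF.pure_map,
      PMF.pure_map]
    rfl
  | read a K ih =>
    obtain ⟨T, rfl⟩ : ∃ T', T = T' + 1 := ⟨T - 1, by have := hT.1; omega⟩
    rw [Prog.resolve, PMF.pure_bind, after_read, Algorithm.runFrom,
      step_config μ P enc hk out f henc (hQ (Or.inl rfl)), PMF.bind_map]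
    exact ih _ (fun J hJ => hQ (Or.inr (Set.mem_iUnion.2 ⟨_, hJ⟩))) _ (hT.2 _) _ _
  | write a x K ih =>
    obtain ⟨T, rfl⟩ : ∃ T', T = T' + 1 := ⟨T - 1, by have := hT.1; omega⟩
    rw [Prog.resolve, PMF.pure_bind, after_write, Algorithm.runFrom,
      step_config μ P enc hk out f henc (hQ (Or.inl rfl)), PMF.bind_map]
    exact ih (fun J hJ => hQ (Or.inr hJ)) _ hT.2 _ _
  | sample K ih =>
    rw [Prog.resolve, Prog.den, PMF.bind_bind, PMF.map_bind, PMF.map_bind]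
    exact congrArg _ (funext fun r =>
      ih r ((Set.subset_iUnion_of_subset r subset_rfl).trans hQ) T (hT r) p s)

/-- The initial content of the external memory. -/
def inputStore (w : ℕ) (β : Type) (D : Database n k) : Fin n ⊕ β → BitVec w :=
  Sum.elim (fun j => BitVec.ofNat w (D j).val) fun _ => 0

theorem start_eq_config (D : Database n k) :
    (compile μ P enc hk out f).start D =
      config μ P enc hk out f (Fin.cons 0 (enc fun _ => P)) (inputStore w β D, []) false := by
  simp only [Algorithm.start, config]
  congr 1
  funext a
  obtain ⟨x, rfl⟩ := (cellEquiv n β).surjective a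
  rw [Equiv.symm_apply_apply]
  rcases x with j | b
  · have : (cellEquiv n β (Sum.inl j)).val = j.val := rfl
    simp only [this, inputStore, Sum.elim_inl, j.isLt, dite_true]
    rfl
  · have : ¬ (cellEquiv n β (Sum.inr b)).val < n := by
      simp [cellEquiv]
    simp only [this, inputStore, Sum.elim_inr, dite_false]
    rfl

theorem run_map_visible [DecidableEq β] (henc : Set.InjOn enc (conts P)) {T : ℕ}
    (hT : P.Bounded T) (D : Database n k) :
    ((compile μ P enc hk out f).run D (T + 1)).map (visible μ P enc hk out f) =
      (P.den μ (inputStore w β D, [])).map fun s =>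
        visible μ P enc hk out f (config μ P enc hk out f (Fin.cons 0 (enc fun _ => P)) s true) := by
  rw [Algorithm.run_eq_runFrom, start_eq_config, Algorithm.runFrom,
    step_config μ P enc hk out f henc (Or.inl rfl), PMF.bind_map]
  exact resolve_bind_runFrom μ P enc hk out f henc P (Set.subset_insert _ _) T hT _ _

end Compile

/-- The numbers in the output cells of a store. -/
def storeOutput {n k w : ℕ} {β : Type} (out : Fin k → β) (f : ℕ)
    (s : Store (Fin n ⊕ β) (BitVec w)) (i : Fin k) : ℝ :=
  ((s.1 (Sum.inr (out i))).toInt : ℝ) / 2 ^ f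

/-- Every program can be executed by a machine whose private memory has room for its
continuations. -/
theorem exists_algorithm {n k w m : ℕ} {β Ω : Type} [Fintype β] [DecidableEq β] [Fintype Ω]
    (μ : PMF Ω) (P : Prog (Fin n ⊕ β) (BitVec w) Ω) {T : ℕ} (hT : P.Bounded T)
    (hP : P.reach.ncard + 1 ≤ 2 ^ (w * m)) (hk : k ≤ 2 ^ w) (out : Fin k → β) (f : ℕ) :
    ∃ A : Algorithm n k, A.wordBits = w ∧ A.privWords = m + 1 ∧ A.RunsInTime (T + 1) ∧
      ∃ g : List ((Fin n ⊕ β) × Bool) → List (Access A.extCells), ∀ D : Database n k,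
        A.view D (T + 1) = (P.den μ (inputStore w β D, [])).map fun s =>
          (storeOutput out f s, g s.2) := by
  classical
  obtain ⟨enc, henc⟩ : ∃ enc : (BitVec w → Prog (Fin n ⊕ β) (BitVec w) Ω) → Fin m → BitVec w,
      Set.InjOn enc (conts P) := by
    have hfin : (conts P).Finite := P.reach_finite.insert _
    -- `m` registers of `w` bits have `2 ^ (w * m)` contents; the summand `1` in `hP` accounts for
    -- the initial continuation.
    have hcard : (conts P).encard ≤ (Set.univ : Set (Fin m → BitVec w)).encard := by
      rw [← hfin.cast_ncard_eq, ← Set.finite_univ.cast_ncard_eq, Set.ncard_univ]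
      refine Nat.cast_le.2 (((Set.ncard_insert_le _ _).trans hP).trans ?_)
      have : Nat.card (BitVec w) = 2 ^ w := by
        rw [Nat.card_congr (BitVec.equivFin.toEquiv), Nat.card_fin]
      rw [Nat.card_fun, Nat.card_fin, this, pow_mul]
    obtain ⟨g, hg, hg'⟩ := hfin.exists_injOn_of_encard_le hcard
    exact ⟨g, hg'⟩
  have key := run_map_visible μ P enc hk out f henc hT
  refine ⟨compile μ P enc hk out f, rfl, rfl, ?_, List.map (toAccess n β), ?_⟩
  · intro D c hc
    have h1 : visible μ P enc hk out f c ∈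
        (((compile μ P enc hk out f).run D (T + 1)).map (visible μ P enc hk out f)).support := by
      rw [PMF.support_map]
      exact ⟨c, hc, rfl⟩
    rw [key, PMF.support_map] at h1
    obtain ⟨s, -, hs⟩ := h1
    exact (congrArg (fun x => x.2.2) hs).symm
  · intro D
    have h1 : (compile μ P enc hk out f).view D (T + 1) =
        (((compile μ P enc hk out f).run D (T + 1)).map (visible μ P enc hk out f)).map
          fun x => ((fun i => ((x.1 (cellEquiv n β (Sum.inr (out i)))).toInt : ℝ) / 2 ^ f),
            x.2.1) := by
      rw [PMF.map_comp]
      rfl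
    rw [h1, key, PMF.map_comp]
    refine congrArg (fun h => PMF.map h _) (funext fun s => ?_)
    simp only [visible, config, Function.comp, Equiv.symm_apply_apply]
    rfl

/-! ### Finite weights and the matching principle -/

section Mass

variable {X Y : Type} [Fintype X] [Fintype Y]

/-- The total weight of a set. -/
def mass (p : X → ℝ) (E : Set X) : ℝ := ∑ x, E.indicator p x

theorem mass_nonneg {p : X → ℝ} (hp : ∀ x, 0 ≤ p x) (E : Set X) : 0 ≤ mass p E :=
  Finset.sum_nonneg fun x _ => Set.indicator_nonneg (fun x _ => hp x) x

theorem mass_mono {p : X → ℝ} (hp : ∀ x, 0 ≤ p x) {E F : Set X} (h : E ⊆ F) :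
    mass p E ≤ mass p F :=
  Finset.sum_le_sum fun x _ => Set.indicator_le_indicator_of_subset h hp x

theorem mass_univ (p : X → ℝ) : mass p Set.univ = ∑ x, p x := by simp [mass]

theorem mass_union_le {p : X → ℝ} (hp : ∀ x, 0 ≤ p x) (E F : Set X) :
    mass p (E ∪ F) ≤ mass p E + mass p F := by
  classical
  rw [mass, mass, mass, ← Finset.sum_add_distrib]
  refine Finset.sum_le_sum fun x _ => ?_
  by_cases hE : x ∈ E <;> by_cases hF : x ∈ F <;> simp [hE, hF, hp x]

theorem mass_biUnion_le {ι : Type} {p : X → ℝ} (hp : ∀ x, 0 ≤ p x) (s : Finset ι)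
    (E : ι → Set X) : mass p {x | ∃ i ∈ s, x ∈ E i} ≤ ∑ i ∈ s, mass p (E i) := by
  classical
  induction s using Finset.induction_on with
  | empty => simp [mass]
  | insert i s hi ih =>
    rw [Finset.sum_insert hi]
    have : {x | ∃ j ∈ insert i s, x ∈ E j} = E i ∪ {x | ∃ j ∈ s, x ∈ E j} := by
      ext x
      simp
    rw [this]
    exact (mass_union_le hp _ _).trans (add_le_add_right ih _)

theorem mass_compl (p : X → ℝ) (E : Set X) : mass p Eᶜ = ∑ x, p x - mass p E := by
  rw [eq_sub_iff_add_eq, mass, mass, ← Finset.sum_add_distrib]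
  exact Finset.sum_congr rfl fun x _ => congrFun (Set.indicator_compl_add_self E p) x

theorem mass_le_of_injOn {p : X → ℝ} {q : Y → ℝ} (hq : ∀ y, 0 ≤ q y) {c : ℝ} (hc : 0 ≤ c)
    {E : Set X} {F : Set Y} (φ : X → Y) (hφ : Set.MapsTo φ E F) (hinj : Set.InjOn φ E)
    (h : ∀ x ∈ E, p x ≤ c * q (φ x)) : mass p E ≤ c * mass q F := by
  classical
  have h1 : mass p E = ∑ x ∈ Finset.univ.filter (· ∈ E), p x := by
    rw [mass, Finset.sum_filter]
    exact Finset.sum_congr rfl fun x _ => by simp [Set.indicator_apply]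
  have h2 : mass q F = ∑ x ∈ Finset.univ.filter (· ∈ F), q x := by
    rw [mass, Finset.sum_filter]
    exact Finset.sum_congr rfl fun x _ => by simp [Set.indicator_apply]
  rw [h1, h2]
  calc ∑ x ∈ Finset.univ.filter (· ∈ E), p x
      ≤ ∑ x ∈ Finset.univ.filter (· ∈ E), c * q (φ x) :=
        Finset.sum_le_sum fun x hx => h x (Finset.mem_filter.1 hx).2
    _ = c * ∑ y ∈ (Finset.univ.filter (· ∈ E)).image φ, q y := by
        rw [Finset.sum_image, Finset.mul_sum]
        intro x hx y hy hxy
        exact hinj (by simpa using hx) (by simpa using hy) hxy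
    _ ≤ c * ∑ y ∈ Finset.univ.filter (· ∈ F), q y := by
        refine mul_le_mul_of_nonneg_left ?_ hc
        refine Finset.sum_le_sum_of_subset_of_nonneg ?_ fun y _ _ => hq y
        intro y hy
        obtain ⟨x, hx, rfl⟩ := Finset.mem_image.1 hy
        exact Finset.mem_filter.2 ⟨Finset.mem_univ _, hφ (Finset.mem_filter.1 hx).2⟩

/-- The basic principle behind approximate privacy: outside a set of small weight, the seeds of one
run are matched injectively with seeds of the other run. -/
theorem mass_le_of_injOn_off {p : X → ℝ} (hp : ∀ x, 0 ≤ p x) {c δ : ℝ} (hc : 0 ≤ c)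
    {E F : Set X} (bad : Set X) (hbad : mass p bad ≤ δ) (φ : X → X)
    (hφ : ∀ x ∈ E, x ∉ bad → φ x ∈ F) (hinj : Set.InjOn φ badᶜ)
    (h : ∀ x ∉ bad, p x ≤ c * p (φ x)) : mass p E ≤ c * mass p F + δ := by
  have h1 : mass p E ≤ mass p (E \ bad ∪ bad) :=
    mass_mono hp (by rw [Set.sdiff_union_self]; exact Set.subset_union_left)
  refine h1.trans ((mass_union_le hp _ _).trans (add_le_add ?_ hbad))
  exact mass_le_of_injOn hp hc φ (fun x hx => hφ x hx.1 hx.2)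
    (hinj.mono fun x hx => hx.2) fun x hx => h x hx.2

/-- The probability mass function with given weights. -/
def weightPMF (p : X → ℝ) (hp : ∀ x, 0 ≤ p x) (h1 : ∑ x, p x = 1) : PMF X :=
  PMF.ofFintype (fun x => ENNReal.ofReal (p x)) (by
    rw [← ENNReal.ofReal_sum_of_nonneg fun x _ => hp x, h1, ENNReal.ofReal_one])

theorem weightPMF_apply (p : X → ℝ) (hp : ∀ x, 0 ≤ p x) (h1 : ∑ x, p x = 1) (x : X) :
    weightPMF p hp h1 x = ENNReal.ofReal (p x) := rfl

theorem toOuterMeasure_weightPMF (p : X → ℝ) (hp : ∀ x, 0 ≤ p x) (h1 : ∑ x, p x = 1)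
    (E : Set X) : (weightPMF p hp h1).toOuterMeasure E = ENNReal.ofReal (mass p E) := by
  rw [PMF.toOuterMeasure_apply_fintype, mass, ENNReal.ofReal_sum_of_nonneg]
  · refine Finset.sum_congr rfl fun x _ => ?_
    by_cases hx : x ∈ E <;> simp [hx, weightPMF_apply]
  · exact fun x _ => Set.indicator_nonneg (fun x _ => hp x) x

end Mass

/-! ### Independent seeds -/

section Product

variable {ι Ω : Type} [Fintype ι] [DecidableEq ι] [Fintype Ω]

/-- The weights of independent seeds. -/
def prodWeight (ι : Type) [Fintype ι] (p : Ω → ℝ) (ω : ι → Ω) : ℝ := ∏ i, p (ω i)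

theorem prodWeight_nonneg {p : Ω → ℝ} (hp : ∀ x, 0 ≤ p x) (ω : ι → Ω) : 0 ≤ prodWeight ι p ω :=
  Finset.prod_nonneg fun i _ => hp (ω i)

theorem sum_prodWeight {p : Ω → ℝ} (h1 : ∑ x, p x = 1) : ∑ ω, prodWeight ι p ω = 1 := by
  have := Finset.prod_univ_sum (fun _ : ι => (Finset.univ : Finset Ω)) fun _ x => p x
  simp only [h1, Finset.prod_const_one, Fintype.piFinset_univ] at this
  exact this.symm

/-- The probability that the seeds with index in `s` lie in given sets. -/
theorem mass_prodWeight_forall {p : Ω → ℝ} (h1 : ∑ x, p x = 1) (s : Finset ι)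
    (S : ι → Set Ω) :
    mass (prodWeight ι p) {ω | ∀ i ∈ s, ω i ∈ S i} = ∏ i ∈ s, mass p (S i) := by
  classical
  -- The restricted weight is again a product over coordinates, so its total factorizes.
  have h2 : ∀ ω : ι → Ω, Set.indicator {ω | ∀ i ∈ s, ω i ∈ S i} (prodWeight ι p) ω =
      ∏ i, if i ∈ s then (S i).indicator p (ω i) else p (ω i) := by
    intro ω
    by_cases h : ∀ i ∈ s, ω i ∈ S i
    · rw [Set.indicator_of_mem (by exact h), prodWeight]
      refine Finset.prod_congr rfl fun i _ => ?_
      by_cases hi : i ∈ s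
      · simp [hi, h i hi]
      · simp [hi]
    · rw [Set.indicator_of_notMem (by exact h)]
      push Not at h
      obtain ⟨i, hi, hi'⟩ := h
      exact (Finset.prod_eq_zero (Finset.mem_univ i) (by simp [hi, hi'])).symm
  rw [mass, Finset.sum_congr rfl fun ω _ => h2 ω]
  have := Finset.prod_univ_sum (fun _ : ι => (Finset.univ : Finset Ω))
    fun i x => if i ∈ s then (S i).indicator p x else p x
  rw [Fintype.piFinset_univ] at this
  rw [← this, ← Finset.prod_subset (Finset.subset_univ s)]
  · refine Finset.prod_congr rfl fun i hi => ?_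
    simp only [hi, if_true]
    rfl
  · intro i _ hi
    simp only [hi, if_false, h1]

theorem mass_prodWeight_apply {p : Ω → ℝ} (h1 : ∑ x, p x = 1) (i : ι) (S : Set Ω) :
    mass (prodWeight ι p) {ω | ω i ∈ S} = mass p S := by
  have := mass_prodWeight_forall (ι := ι) h1 {i} fun _ => S
  simpa using this

/-- The multiplicative form avoids a division by `p (ω i)`, which may vanish. -/
theorem prodWeight_update {p : Ω → ℝ} (ω : ι → Ω) (i : ι) (x : Ω) :
    p x * prodWeight ι p ω = p (ω i) * prodWeight ι p (Function.update ω i x) := by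
  have h1 := Finset.mul_prod_erase Finset.univ (fun j => p (ω j)) (Finset.mem_univ i)
  have h2 := Finset.mul_prod_erase Finset.univ (fun j => p (Function.update ω i x j))
    (Finset.mem_univ i)
  rw [prodWeight, prodWeight, ← h1, ← h2, Function.update_self]
  have h3 : ∏ j ∈ Finset.univ.erase i, p (Function.update ω i x j) =
      ∏ j ∈ Finset.univ.erase i, p (ω j) :=
    Finset.prod_congr rfl fun j hj => by rw [Function.update_of_ne (Finset.ne_of_mem_erase hj)]
  rw [h3]
  ring

/-- Exchanging a fresh seed with the seed at `i`. -/
def exchange (i : ι) : Ω × (ι → Ω) ≃ Ω × (ι → Ω) where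
  toFun y := (y.2 i, Function.update y.2 i y.1)
  invFun y := (y.2 i, Function.update y.2 i y.1)
  left_inv y := by simp
  right_inv y := by simp

variable (p : Ω → ℝ) (hp : ∀ x, 0 ≤ p x) (h1 : ∑ x, p x = 1)

/-- The law of independent seeds. -/
def seedsPMF (ι : Type) [Fintype ι] [DecidableEq ι] : PMF (ι → Ω) :=
  weightPMF (prodWeight ι p) (prodWeight_nonneg hp) (sum_prodWeight h1)

/-- Swapping a fresh seed with the one at `i` is an involution of pairs that preserves the product
weight, by `prodWeight_update`. Hence a seed may be redrawn without changing the law. -/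
theorem seedsPMF_resample (i : ι) :
    seedsPMF p hp h1 ι = (weightPMF p hp h1).bind fun x =>
      (seedsPMF p hp h1 ι).map fun ω => Function.update ω i x := by
  classical
  ext ω
  have key : ∑ y : Ω × (ι → Ω), (if ω = y.2 then
        ENNReal.ofReal (p y.1) * ENNReal.ofReal (prodWeight ι p y.2) else 0) =
      ∑ y : Ω × (ι → Ω), (if ω = Function.update y.2 i y.1 then
        ENNReal.ofReal (p y.1) * ENNReal.ofReal (prodWeight ι p y.2) else 0) := by
    rw [← Equiv.sum_comp (exchange i)]
    refine Finset.sum_congr rfl fun y _ => ?_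
    simp only [exchange, Equiv.coe_fn_mk]
    rw [← ENNReal.ofReal_mul (hp _), ← ENNReal.ofReal_mul (hp _), ← prodWeight_update y.2 i y.1]
    by_cases h : ω = Function.update y.2 i y.1 <;> simp only [if_pos, if_neg, h, not_false_eq_true]
  rw [PMF.bind_apply, tsum_fintype]
  simp only [PMF.map_apply, tsum_fintype, seedsPMF, weightPMF_apply]
  rw [Fintype.sum_prod_type, Fintype.sum_prod_type] at key
  simp only [Finset.sum_ite_eq, Finset.mem_univ, if_true] at key
  rw [← Finset.sum_mul, ← ENNReal.ofReal_sum_of_nonneg fun x _ => hp x, h1, ENNReal.ofReal_one,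
    one_mul] at key
  rw [key]
  refine Finset.sum_congr rfl fun x _ => ?_
  rw [Finset.mul_sum]
  exact Finset.sum_congr rfl fun y _ => by split_ifs <;> simp

theorem foldl_update_of_notMem {S : Type} (step : ι → Ω → S → S) (l : List ι) (i : ι)
    (hi : i ∉ l) (ω : ι → Ω) (x : Ω) (s : S) :
    l.foldl (fun s j => step j (Function.update ω i x j) s) s =
      l.foldl (fun s j => step j (ω j) s) s := by
  refine List.foldl_ext _ _ _ fun s j hj => ?_
  rw [Function.update_of_ne (ne_of_mem_of_not_mem hj hi)]

/-- A list of programs that draw one seed each can be executed with seeds drawn in advance. -/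
theorem den_seqList_seeds {α W : Type} [DecidableEq α] (P : ι → Prog α W Ω)
    (step : ι → Ω → Store α W → Store α W)
    (h : ∀ i s, (P i).den (weightPMF p hp h1) s = (weightPMF p hp h1).map fun x => step i x s)
    (l : List ι) (hl : l.Nodup) (s : Store α W) :
    (Prog.seqList (l.map P)).den (weightPMF p hp h1) s =
      (seedsPMF p hp h1 ι).map fun ω => l.foldl (fun s i => step i (ω i) s) s := by
  induction l generalizing s with
  | nil => exact (PMF.map_const _ _).symm
  | cons i l ih =>
    rw [List.nodup_cons] at hl
    -- The seed at `i` is redrawn for the first program; since `i` does not recur in the list, the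
    -- later programs do not see the change.
    rw [List.map_cons, Prog.seqList, Prog.den_seq, h, PMF.bind_map,
      seedsPMF_resample p hp h1 i, PMF.map_bind]
    refine congrArg _ (funext fun x => ?_)
    rw [Function.comp, ih hl.2, PMF.map_comp]
    refine congrArg (fun g => PMF.map g _) (funext fun ω => ?_)
    simp only [Function.comp, List.foldl_cons, Function.update_self]
    exact (foldl_update_of_notMem step l i hl.1 ω x _).symm

end Product

/-! ### Privacy and accuracy from seeds -/

section Transfer

variable {n k : ℕ} {X : Type} [Fintype X]

/-- If the view is a function of random seeds, privacy follows from a matching of seeds. -/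
theorem isObliviouslyDP_of_seeds (A : Algorithm n k) (t : ℕ) (p : X → ℝ) (hp : ∀ x, 0 ≤ p x)
    (h1 : ∑ x, p x = 1) (V : Database n k → X → (Fin k → ℝ) × List (Access A.extCells))
    (hV : ∀ D, A.view D t = (weightPMF p hp h1).map (V D)) {ε δ : ℝ} (hδ : 0 ≤ δ)
    (h : ∀ D₁ D₂ : Database n k, Neighboring D₁ D₂ → ∃ (bad : Set X) (φ : X → X),
      mass p bad ≤ δ ∧ (∀ x ∉ bad, V D₁ x = V D₂ (φ x)) ∧ Set.InjOn φ badᶜ ∧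
        ∀ x ∉ bad, p x ≤ Real.exp ε * p (φ x)) :
    A.IsObliviouslyDP t ε δ := by
  intro D₁ D₂ hD O S
  obtain ⟨bad, φ, hbad, hφ, hinj, hle⟩ := h D₁ D₂ hD
  rw [hV, hV, PMF.toOuterMeasure_map_apply, PMF.toOuterMeasure_map_apply,
    toOuterMeasure_weightPMF, toOuterMeasure_weightPMF, ← ENNReal.ofReal_mul (Real.exp_pos _).le,
    ← ENNReal.ofReal_add (mul_nonneg (Real.exp_pos _).le (mass_nonneg hp _)) hδ]
  refine ENNReal.ofReal_le_ofReal
    (mass_le_of_injOn_off hp (Real.exp_pos _).le bad hbad φ (fun x hx hxb => ?_) hinj hle)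
  rw [Set.mem_preimage, ← hφ x hxb]
  exact hx

/-- If the view is a function of random seeds, its properties hold with the probability of the
seeds for which they hold. -/
theorem le_toOuterMeasure_view (A : Algorithm n k) (t : ℕ) (p : X → ℝ) (hp : ∀ x, 0 ≤ p x)
    (h1 : ∑ x, p x = 1) (V : X → (Fin k → ℝ) × List (Access A.extCells)) (D : Database n k)
    (hV : A.view D t = (weightPMF p hp h1).map V) (E : Set _) {θ : ℝ} (F : Set X)
    (hF : mass p F ≤ θ) (h : ∀ x ∉ F, V x ∈ E) :
    ENNReal.ofReal (1 - θ) ≤ (A.view D t).toOuterMeasure E := by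
  rw [hV, PMF.toOuterMeasure_map_apply, toOuterMeasure_weightPMF]
  refine ENNReal.ofReal_le_ofReal (le_trans ?_
    (mass_mono hp (E := Fᶜ) (F := V ⁻¹' E) fun x hx => h x hx))
  rw [mass_compl, h1]
  linarith

end Transfer

/-! ### Folds with local effects -/

section Fold

variable {α W ι : Type}

/-- A fold over steps that extend the access pattern in a fixed way. -/
theorem foldl_store (f : ι → (α → W) → α → W) (tr : ι → List (α × Bool)) (l : List ι)
    (s : Store α W) :
    l.foldl (fun s i => ((f i s.1, s.2 ++ tr i) : Store α W)) s =
      (l.foldl (fun x i => f i x) s.1, s.2 ++ l.flatMap tr) := by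
  induction l generalizing s with
  | nil => simp
  | cons i l ih => simp [ih]

/-- A fold over steps with disjoint local effects: the cells of step `i` change as if no other step
was taken. -/
theorem foldl_local [DecidableEq ι] (f : ι → (α → W) → α → W) (own : α → Option ι)
    (h1 : ∀ i x a, own a ≠ some i → f i x a = x a)
    (h2 : ∀ i x y, (∀ a, own a = some i ∨ own a = none → x a = y a) →
      ∀ a, own a = some i → f i x a = f i y a)
    (l : List ι) (hl : l.Nodup) (x : α → W) (a : α) :
    (own a = none → l.foldl (fun x i => f i x) x a = x a) ∧
    ∀ i, own a = some i →
      l.foldl (fun x i => f i x) x a = if i ∈ l then f i x a else x a := by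
  induction l generalizing x a with
  | nil => simp
  | cons j l ih =>
    rw [List.nodup_cons] at hl
    refine ⟨fun ha => ?_, fun i hi => ?_⟩
    · rw [List.foldl_cons, (ih hl.2 _ _).1 ha, h1 j x a (by simp [ha])]
    · rw [List.foldl_cons, (ih hl.2 _ _).2 i hi]
      by_cases hij : i = j
      · subst hij
        rw [if_neg hl.1, if_pos (List.mem_cons_self)]
      · have hja : own a ≠ some j := by
          rw [hi]
          exact fun h => hij (Option.some.inj h)
        by_cases hil : i ∈ l
        · rw [if_pos hil, if_pos (List.mem_cons_of_mem _ hil)]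
          refine h2 i _ _ (fun b hb => h1 j x b ?_) a hi
          rcases hb with hb | hb
          · rw [hb]
            exact fun h => hij (Option.some.inj h)
          · simp [hb]
        · rw [if_neg hil, if_neg (by simp [hij, hil]), h1 j x a hja]

end Fold

/-! ### Word lengths -/

section Arithmetic

/-- A word length that suffices for the numbers up to `N`. -/
def bitsFor (N : ℕ) : ℕ := Nat.clog 2 (N + 1) + 1

/-- The factor `2` is room for the sign bit: numbers up to `N` are read correctly by `BitVec.toInt`.
-/
theorem two_mul_lt_two_pow_bitsFor (N : ℕ) : 2 * N < 2 ^ bitsFor N := by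
  have := Nat.le_pow_clog (b := 2) (by norm_num) (N + 1)
  rw [bitsFor, pow_succ]
  omega

theorem clog_le_log {N : ℕ} (hN : 1 ≤ N) : (Nat.clog 2 N : ℝ) ≤ 2 * Real.log N + 1 := by
  rcases hN.eq_or_lt with rfl | hN
  · simp
  have h1 : 2 ^ (Nat.clog 2 N - 1) < N := by
    rw [← Nat.pred_eq_sub_one]
    exact Nat.pow_pred_clog_lt_self (by norm_num) hN
  have h2 : ((2 : ℝ) ^ (Nat.clog 2 N - 1)) ≤ N := by exact_mod_cast h1.le
  have h3 := Real.log_le_log (by positivity) h2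
  rw [Real.log_pow] at h3
  have h4 : (1 : ℝ) / 2 ≤ Real.log 2 := by have := Real.log_two_gt_d9; linarith
  have h5 : (Nat.clog 2 N : ℝ) ≤ ((Nat.clog 2 N - 1 : ℕ) : ℝ) + 1 := by
    exact_mod_cast (by omega : Nat.clog 2 N ≤ Nat.clog 2 N - 1 + 1)
  nlinarith [Nat.cast_nonneg (α := ℝ) (Nat.clog 2 N - 1)]

end Arithmetic

/-! ### Algorithms with constant output -/

section Constant

variable {n k : ℕ}

/-- The program that writes the constant `x` to all output cells. -/
def constProg (α : Type) {W : Type} (k : ℕ) (out : Fin k → α) (x : W) : Prog α W Unit :=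
  Prog.seqList ((List.finRange k).map fun i => Prog.write (out i) x Prog.halt)

theorem bounded_constProg {α W : Type} (out : Fin k → α) (x : W) :
    (constProg α k out x).Bounded k := by
  have := Prog.bounded_seqList (Ω := Unit) (List.finRange k)
    (fun i => Prog.write (out i) x Prog.halt) (T := 1) fun i => ⟨le_rfl, trivial⟩
  rwa [List.length_finRange, mul_one] at this

theorem ncard_reach_constProg_le {α W : Type} [Fintype W] (out : Fin k → α) (x : W) :
    (constProg α k out x).reach.ncard ≤ k := by
  have := Prog.ncard_reach_seqList_le (Ω := Unit) (List.finRange k)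
    (fun i => Prog.write (out i) x Prog.halt) (c := 1) fun i =>
      (Prog.ncard_reach_le_cost _).trans (by simp [Prog.cost])
  rwa [List.length_finRange, mul_one] at this

theorem den_constProg {α W : Type} [DecidableEq α] (μ : PMF Unit) (out : Fin k → α) (x : W)
    (s : Store α W) :
    (constProg α k out x).den μ s =
      PMF.pure ((List.finRange k).foldl (fun y i => Function.update y (out i) x) s.1,
        s.2 ++ (List.finRange k).flatMap fun i => [(out i, true)]) := by
  rw [constProg, Prog.den_seqList_pure μ _
    (fun i s => (Function.update s.1 (out i) x, s.2 ++ [(out i, true)])) fun i s => rfl,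
    foldl_store (fun i y => Function.update y (out i) x)]

theorem foldl_constProg {α W : Type} [DecidableEq α] (out : Fin k → α)
    (x : W) (y : α → W) (i : Fin k) :
    (List.finRange k).foldl (fun y i => Function.update y (out i) x) y (out i) = x := by
  have : ∀ l : List (Fin k), ∀ y : α → W, i ∈ l ∨ y (out i) = x →
      l.foldl (fun y i => Function.update y (out i) x) y (out i) = x := by
    intro l
    induction l with
    | nil => simp
    | cons j l ih =>
      intro y h
      rw [List.foldl_cons]
      apply ih
      by_cases hij : out i = out j
      · right
        rw [hij, Function.update_self]
      · rcases h with h | h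
        · left
          exact (List.mem_cons.1 h).resolve_left (fun h => hij (h ▸ rfl))
        · right
          rw [Function.update_of_ne hij, h]
  exact this _ _ (Or.inl (List.mem_finRange i))

/-- An algorithm with constant output. -/
theorem exists_const_algorithm (hkn : k ≤ n) (c : ℕ) (hc : c ≤ n) :
    ∃ A : Algorithm n k, A.wordBits = bitsFor n ∧ A.privWords = 2 ∧ A.RunsInTime (k + 1) ∧
      (∀ ε δ : ℝ, 0 ≤ ε → 0 ≤ δ → A.IsObliviouslyDP (k + 1) ε δ) ∧
      ∀ (θ : ℝ) (D : Database n k) (E : Set ((Fin k → ℝ) × List (Access A.extCells))),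
        0 < θ → (∀ v : (Fin k → ℝ) × List (Access A.extCells), (∀ i, v.1 i = (c : ℝ)) → v ∈ E) →
        ENNReal.ofReal (1 - θ) ≤ (A.view D (k + 1)).toOuterMeasure E := by
  have hw := two_mul_lt_two_pow_bitsFor n
  have h1 : ∑ _x : Unit, (1 : ℝ) = 1 := by simp
  obtain ⟨A, hA1, hA2, hA3, g, hA4⟩ := exists_algorithm (n := n) (w := bitsFor n) (m := 1)
    (weightPMF (fun _ : Unit => (1 : ℝ)) (fun _ => zero_le_one) h1)
    (constProg (Fin n ⊕ Fin k) k Sum.inr (BitVec.ofNat (bitsFor n) c))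
    (bounded_constProg _ _)
    (by
      rw [mul_one]
      have := ncard_reach_constProg_le (α := Fin n ⊕ Fin k) (W := BitVec (bitsFor n)) Sum.inr
        (BitVec.ofNat (bitsFor n) c)
      omega) (by omega) id 0
  have hV : ∀ D, A.view D (k + 1) =
      (weightPMF (fun _ : Unit => (1 : ℝ)) (fun _ => zero_le_one) h1).map fun _ =>
        ((fun _ => (c : ℝ)), g ([] ++ (List.finRange k).flatMap fun i =>
          [(Sum.inr i, true)])) := by
    intro D
    rw [hA4, den_constProg, PMF.pure_map]
    refine Eq.trans ?_ (PMF.map_const _ _).symm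
    congr 2
    funext i
    have h := foldl_constProg Sum.inr (BitVec.ofNat (bitsFor n) c)
      (inputStore (bitsFor n) (Fin k) D) i
    simp only [storeOutput, id]
    rw [h, BitVec.toInt_eq_toNat_of_lt, BitVec.toNat_ofNat,
      Nat.mod_eq_of_lt (by omega)]
    · simp
    · rw [BitVec.toNat_ofNat, Nat.mod_eq_of_lt (by omega)]
      omega
  refine ⟨A, hA1, hA2, hA3, fun ε δ hε hδ => ?_, fun θ D E hθ hE => ?_⟩
  · refine isObliviouslyDP_of_seeds A _ _ (fun _ => zero_le_one) h1 _ hV hδ fun D₁ D₂ _ =>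
      ⟨∅, id, by simpa [mass] using hδ, fun _ _ => rfl, Set.injOn_id _, fun _ _ => ?_⟩
    simpa using hε
  · refine le_toOuterMeasure_view A _ _ (fun _ => zero_le_one) h1 _ D (hV D) E ∅
      (by simpa [mass] using hθ.le) fun x _ => hE _ fun i => rfl

end Constant

/-! ### Randomized response, for large `ε` -/

section RandomizedResponse

variable {n k : ℕ} [NeZero k]

/-- The type that a word stands for. -/
def decType (k : ℕ) [NeZero k] {w : ℕ} (v : BitVec w) : Fin k := Fin.ofNat k v.toNat

/-- Randomized response for one record. -/
def respond (w : ℕ) (j : Fin n) : Prog (Fin n ⊕ Fin k) (BitVec w) (Fin k) :=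
  .sample fun r => .read (Sum.inl j) fun v => .read (Sum.inr (decType k v + r)) fun x =>
    .write (Sum.inr (decType k v + r)) (x + 1) .halt

/-- Randomized response for all records. -/
def respondAll (n k w : ℕ) [NeZero k] : Prog (Fin n ⊕ Fin k) (BitVec w) (Fin k) :=
  Prog.seqList ((List.finRange n).map (respond w))

/-- The effect of the response to one record. -/
def respondStep (w : ℕ) (j : Fin n) (r : Fin k) (s : Store (Fin n ⊕ Fin k) (BitVec w)) :
    Store (Fin n ⊕ Fin k) (BitVec w) :=
  (Function.update s.1 (Sum.inr (decType k (s.1 (Sum.inl j)) + r))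
      (s.1 (Sum.inr (decType k (s.1 (Sum.inl j)) + r)) + 1),
    s.2 ++ [(Sum.inl j, false), (Sum.inr (decType k (s.1 (Sum.inl j)) + r), false),
      (Sum.inr (decType k (s.1 (Sum.inl j)) + r), true)])

theorem den_respond (w : ℕ) (μ : PMF (Fin k)) (j : Fin n)
    (s : Store (Fin n ⊕ Fin k) (BitVec w)) :
    (respond w j).den μ s = μ.map fun r => respondStep w j r s := by
  simp only [respond, Prog.den, respondStep, List.append_assoc, List.cons_append,
    List.nil_append]
  exact PMF.bind_pure_comp _ _

/-- Counters and accesses depend on the database and the seeds only through the reports `y`. So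
privacy reduces to the law of `D + ω`. -/
theorem foldl_respondStep (w : ℕ) (ω : Fin n → Fin k) (y : Fin n → Fin k) (l : List (Fin n))
    (s : Store (Fin n ⊕ Fin k) (BitVec w))
    (hs : ∀ j, decType k (s.1 (Sum.inl j)) + ω j = y j) :
    (∀ i, (l.foldl (fun s j => respondStep w j (ω j) s) s).1 (Sum.inr i) =
      s.1 (Sum.inr i) + BitVec.ofNat w (l.countP fun j => y j = i)) ∧
    (l.foldl (fun s j => respondStep w j (ω j) s) s).2 = s.2 ++ l.flatMap fun j =>
      [(Sum.inl j, false), (Sum.inr (y j), false), (Sum.inr (y j), true)] := by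
  induction l generalizing s with
  | nil => simp
  | cons j l ih =>
    have hstep : respondStep w j (ω j) s = (Function.update s.1 (Sum.inr (y j))
        (s.1 (Sum.inr (y j)) + 1), s.2 ++ [(Sum.inl j, false), (Sum.inr (y j), false),
          (Sum.inr (y j), true)]) := by
      rw [respondStep, hs j]
    rw [List.foldl_cons, hstep]
    obtain ⟨ih1, ih2⟩ := ih (Function.update s.1 (Sum.inr (y j)) (s.1 (Sum.inr (y j)) + 1),
      s.2 ++ [(Sum.inl j, false), (Sum.inr (y j), false), (Sum.inr (y j), true)])
      (fun j' => by simpa using hs j')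
    refine ⟨fun i => ?_, ?_⟩
    · rw [ih1, List.countP_cons]
      by_cases hi : y j = i
      · subst hi
        simp [BitVec.ofNat_add]
        ring
      · have : (Sum.inr i : Fin n ⊕ Fin k) ≠ Sum.inr (y j) := fun h => hi (Sum.inr.inj h).symm
        simp [hi, this]
    · rw [ih2]
      simp

theorem decType_ofNat {w : ℕ} (hk : k ≤ 2 ^ w) (i : Fin k) :
    decType k (BitVec.ofNat w i) = i := by
  rw [decType, BitVec.toNat_ofNat, Nat.mod_eq_of_lt (i.isLt.trans_le hk)]
  exact Fin.ofNat_val_eq_self i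

/-- The weights of randomized response. -/
def respondWeight (k : ℕ) [NeZero k] (η : ℝ) (r : Fin k) : ℝ :=
  if r = 0 then 1 - (k - 1) * η else η

theorem sum_respondWeight (η : ℝ) : ∑ r, respondWeight k η r = 1 := by
  rw [← Finset.add_sum_erase _ _ (Finset.mem_univ (0 : Fin k))]
  have : ∑ r ∈ Finset.univ.erase (0 : Fin k), respondWeight k η r =
      ∑ r ∈ Finset.univ.erase (0 : Fin k), η :=
    Finset.sum_congr rfl fun r hr => if_neg (Finset.ne_of_mem_erase hr)
  rw [this, Finset.sum_const, Finset.card_erase_of_mem (Finset.mem_univ _), Finset.card_univ,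
    Fintype.card_fin, respondWeight, if_pos rfl, nsmul_eq_mul,
    Nat.cast_sub (NeZero.one_le (n := k))]
  push_cast
  ring

/-- All weights lie between `η` and `1`, so with `η = exp (-ε)` any two of them differ by a factor
of at most `exp ε`. -/
theorem le_respondWeight {η : ℝ} (hη : k * η ≤ 1) (r : Fin k) : η ≤ respondWeight k η r := by
  rw [respondWeight]
  split_ifs
  · linarith
  · exact le_rfl

theorem mass_respondWeight_ne_zero_le {η : ℝ} (hη : 0 ≤ η) :
    mass (respondWeight k η) {r | r ≠ 0} ≤ k * η := by
  have : ∀ r ∈ (Finset.univ : Finset (Fin k)),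
      Set.indicator {r | r ≠ 0} (respondWeight k η) r ≤ η := by
    intro r _
    by_cases hr : r = 0
    · simp [hr, hη]
    · simp [hr, respondWeight]
  refine (Finset.sum_le_sum this).trans ?_
  simp

/-- A record with `ω j = 0` is counted under its true type, so only the others can contribute to the
error, simultaneously for all `i`. -/
theorem abs_countP_sub_histogram_le (D : Database n k) (ω : Fin n → Fin k) (i : Fin k) :
    |(((List.finRange n).countP fun j => D j + ω j = i : ℕ) : ℝ) - histogram D i| ≤
      ((Finset.univ.filter fun j => ω j ≠ 0).card : ℝ) := by
  have h0 : ((List.finRange n).countP fun j => D j + ω j = i) =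
      (Finset.univ.filter fun j => D j + ω j = i).card := by
    rw [List.countP_eq_length_filter]
    rfl
  rw [h0, histogram, abs_sub_le_iff]
  have key : ∀ S T : Finset (Fin n), (∀ j ∈ S, ω j = 0 → j ∈ T) →
      (S.card : ℝ) - T.card ≤ ((Finset.univ.filter fun j => ω j ≠ 0).card : ℝ) := by
    intro S T h
    have : S ⊆ T ∪ Finset.univ.filter fun j => ω j ≠ 0 := by
      intro j hj
      by_cases hω : ω j = 0
      · exact Finset.mem_union_left _ (h j hj hω)
      · exact Finset.mem_union_right _ (by simpa using hω)
    have h3 := (Finset.card_le_card this).trans (Finset.card_union_le _ _)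
    have : (S.card : ℝ) ≤ T.card + (Finset.univ.filter fun j => ω j ≠ 0).card := by
      exact_mod_cast h3
    linarith
  constructor
  · exact key _ _ fun j hj hω => by simpa [hω] using hj
  · exact key _ _ fun j hj hω => by simpa [hω] using hj

/-- Union bound over the sets of `s` falsified reports: at most `n ^ s` sets, each of probability at
most `(k * η) ^ s`. -/
theorem mass_card_ne_zero_le {η : ℝ} (hη : 0 ≤ η) (hη' : k * η ≤ 1) (s : ℕ) :
    mass (prodWeight (Fin n) (respondWeight k η))
      {ω : Fin n → Fin k | s ≤ (Finset.univ.filter fun j => ω j ≠ 0).card} ≤ (n * (k * η)) ^ s := by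
  have hp : ∀ r, 0 ≤ respondWeight k η r := fun r => hη.trans (le_respondWeight hη' r)
  have h1 : {ω : Fin n → Fin k | s ≤ (Finset.univ.filter fun j => ω j ≠ 0).card} ⊆
      {ω | ∃ S ∈ Finset.powersetCard s (Finset.univ : Finset (Fin n)),
        ω ∈ {ω : Fin n → Fin k | ∀ j ∈ S, ω j ∈ {r : Fin k | r ≠ 0}}} := by
    intro ω hω
    obtain ⟨S, hS, hcard⟩ := Finset.exists_subset_card_eq hω
    refine ⟨S, Finset.mem_powersetCard.2 ⟨Finset.subset_univ _, hcard⟩, fun j hj => ?_⟩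
    simpa using hS hj
  refine (mass_mono (prodWeight_nonneg hp) h1).trans ((mass_biUnion_le (prodWeight_nonneg hp) _
    _).trans ?_)
  have h2 : ∀ S ∈ Finset.powersetCard s (Finset.univ : Finset (Fin n)),
      mass (prodWeight (Fin n) (respondWeight k η))
        {ω : Fin n → Fin k | ∀ j ∈ S, ω j ∈ {r : Fin k | r ≠ 0}} ≤ (k * η) ^ s := by
    intro S hS
    rw [mass_prodWeight_forall (sum_respondWeight η), Finset.prod_const,
      (Finset.mem_powersetCard.1 hS).2]
    exact pow_le_pow_left₀ (mass_nonneg hp _) (mass_respondWeight_ne_zero_le hη) s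
  refine (Finset.sum_le_sum h2).trans ?_
  rw [Finset.sum_const, Finset.card_powersetCard, Finset.card_univ, Fintype.card_fin,
    nsmul_eq_mul, mul_pow (n : ℝ)]
  have h3 : (n.choose s : ℝ) ≤ (n : ℝ) ^ s := by exact_mod_cast Nat.choose_le_pow n s
  exact mul_le_mul_of_nonneg_right h3 (pow_nonneg (mul_nonneg k.cast_nonneg hη) s)

theorem cost_respond_le (w : ℕ) (j : Fin n) :
    (respond (k := k) w j).cost ≤ k * (1 + 2 ^ w * (1 + 2 ^ w)) := by
  have : Fintype.card (BitVec w) = 2 ^ w := by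
    rw [Fintype.card_congr BitVec.equivFin.toEquiv, Fintype.card_fin]
  simp [respond, Prog.cost, this]

/-- By `hnk` the probability of `s` falsified reports is at most `exp (-ε / 2) ^ s`, which is the
tail that the accuracy bound asks for. -/
theorem exists_respond_algorithm (hkn : k ≤ n) {ε : ℝ} (hε : 0 < ε)
    (hnk : n * (k * Real.exp (-ε)) ≤ Real.exp (-ε / 2)) :
    ∃ A : Algorithm n k, A.wordBits = bitsFor n ∧ A.privWords = 5 ∧
      A.RunsInTime (n * 3 + 1) ∧
      (∀ δ : ℝ, 0 ≤ δ → A.IsObliviouslyDP (n * 3 + 1) ε δ) ∧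
      ∀ (θ : ℝ) (D : Database n k), 0 < θ → θ < 1 →
        ENNReal.ofReal (1 - θ) ≤ (A.view D (n * 3 + 1)).toOuterMeasure
          {v | ∀ i, |v.1 i - (histogram D i : ℝ)| ≤ Real.log (k / θ) * (2 / ε)} := by
  have hw := two_mul_lt_two_pow_bitsFor n
  set w := bitsFor n with hwdef
  set η := Real.exp (-ε) with hηdef
  have hη : 0 < η := Real.exp_pos _
  have hk1 : (1 : ℝ) ≤ k := by exact_mod_cast NeZero.one_le (n := k)
  have hn1 : (1 : ℝ) ≤ n := hk1.trans (by exact_mod_cast hkn)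
  have hkη : k * η ≤ 1 := by
    have h1 : k * η ≤ n * (k * η) := le_mul_of_one_le_left (by positivity) hn1
    exact h1.trans (hnk.trans (Real.exp_le_one_iff.2 (by linarith)))
  have hp : ∀ r, 0 ≤ respondWeight k η r := fun r => hη.le.trans (le_respondWeight hkη r)
  have hp1 : ∀ r, respondWeight k η r ≤ 1 := by
    intro r
    rw [← sum_respondWeight (k := k) η]
    exact Finset.single_le_sum (fun r _ => hp r) (Finset.mem_univ r)
  have h1 := sum_respondWeight (k := k) η
  have hbd : (respondAll n k w).Bounded (n * 3) := by
    have := Prog.bounded_seqList (List.finRange n) (respond (k := k) w) (T := 3)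
      fun j r => ⟨by norm_num, fun v => ⟨by norm_num, fun x => ⟨by norm_num, trivial⟩⟩⟩
    rwa [List.length_finRange] at this
  have hreach : (respondAll n k w).reach.ncard + 1 ≤ 2 ^ (w * 4) := by
    have h2 := Prog.ncard_reach_seqList_le (List.finRange n) (respond (k := k) w)
      fun j => (Prog.ncard_reach_le_cost _).trans (cost_respond_le w j)
    rw [List.length_finRange] at h2
    refine (Nat.add_le_add_right h2 1).trans ?_
    rw [pow_mul]
    generalize 2 ^ w = N at *
    have h3 : 1 ≤ k := NeZero.one_le
    have h4 : n * (k * (1 + N * (1 + N))) ≤ n * (n * (1 + N * (1 + N))) := by gcongr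
    have h5 : 2 * n + 1 ≤ N := hw
    have h6 : n * (n * (1 + N * (1 + N))) * 4 ≤ N * (N * (3 * (N * N))) := by
      calc n * (n * (1 + N * (1 + N))) * 4 = (2 * n) * ((2 * n) * (1 + N * (1 + N))) := by ring
        _ ≤ N * (N * (3 * (N * N))) :=
          Nat.mul_le_mul (by omega) (Nat.mul_le_mul (by omega) (by nlinarith))
    have h7 : 3 ≤ N := by omega
    have h8 : 81 ≤ N ^ 4 := by
      calc 81 = 3 ^ 4 := by norm_num
        _ ≤ N ^ 4 := by gcongr
    have h9 : N * (N * (3 * (N * N))) = 3 * N ^ 4 := by ring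
    omega
  obtain ⟨A, hA1, hA2, hA3, g, hA4⟩ := exists_algorithm (n := n) (k := k) (w := w) (m := 4)
    (weightPMF (respondWeight k η) hp h1) (respondAll n k w) hbd hreach (by omega) id 0
  set G : (Fin n → Fin k) → (Fin k → ℝ) × List (Access A.extCells) := fun y =>
    (fun i => (((List.finRange n).countP fun j => y j = i : ℕ) : ℝ),
      g ([] ++ (List.finRange n).flatMap fun j =>
        [(Sum.inl j, false), (Sum.inr (y j), false), (Sum.inr (y j), true)])) with hG
  have hV : ∀ D, A.view D (n * 3 + 1) =
      (weightPMF (prodWeight (Fin n) (respondWeight k η)) (prodWeight_nonneg hp)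
        (sum_prodWeight h1)).map fun ω => G (D + ω) := by
    intro D
    rw [hA4, respondAll, den_seqList_seeds _ hp h1 _ _ (fun j s => den_respond w _ j s) _
      (List.nodup_finRange n), PMF.map_comp, seedsPMF]
    refine congrArg (fun h => PMF.map h _) (funext fun ω => ?_)
    obtain ⟨h3, h4⟩ := foldl_respondStep w ω (D + ω) (List.finRange n)
      (inputStore w (Fin k) D, []) fun j => by
        simp [inputStore, decType_ofNat (show k ≤ 2 ^ w by omega)]
    simp only [Function.comp, hG, h4]
    refine Prod.ext (funext fun i => ?_) rfl
    have h5 : (List.finRange n).countP (fun j => decide ((D + ω) j = i)) ≤ n :=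
      List.countP_le_length.trans (List.length_finRange).le
    simp only [storeOutput, id]
    have h6 : inputStore w (Fin k) D (Sum.inr i) = 0#w := rfl
    rw [h3]
    simp only [h6]
    rw [BitVec.zero_add,
      BitVec.toInt_eq_toNat_of_lt, BitVec.toNat_ofNat, Nat.mod_eq_of_lt (by omega)]
    · simp
    · rw [BitVec.toNat_ofNat, Nat.mod_eq_of_lt (by omega)]
      omega
  refine ⟨A, hA1, hA2, hA3, fun δ hδ => ?_, fun θ D hθ hθ' => ?_⟩
  -- Shifting the seed of the changed record by `D₁ j - D₂ j` reproduces the same reports from `D₂`;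
  -- no seeds are bad, so the privacy is pure.
  · refine isObliviouslyDP_of_seeds A _ _ (prodWeight_nonneg hp) (sum_prodWeight h1) _ hV hδ
      fun D₁ D₂ ⟨j, hj, hjs⟩ => ⟨∅, fun ω => Function.update ω j (ω j + (D₁ j - D₂ j)),
        by simpa [mass] using hδ, fun ω _ => congrArg G ?_, fun ω _ ω' _ h => ?_, fun ω _ => ?_⟩
    · funext j'
      by_cases h : j' = j
      · subst h
        simp
        abel
      · simp [h, hjs j' h]
    · funext j'
      have h2 := congrFun h j'
      by_cases h : j' = j
      · subst h
        simpa using h2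
      · simpa [h] using h2
    · have h2 := prodWeight_update (p := respondWeight k η) ω j (ω j + (D₁ j - D₂ j))
      set ω' := Function.update ω j (ω j + (D₁ j - D₂ j))
      have h3 : η * prodWeight (Fin n) (respondWeight k η) ω ≤
          prodWeight (Fin n) (respondWeight k η) ω' := by
        calc η * prodWeight (Fin n) (respondWeight k η) ω ≤ _ :=
              mul_le_mul_of_nonneg_right (le_respondWeight hkη _) (prodWeight_nonneg hp _)
          _ = _ := h2
          _ ≤ _ := mul_le_of_le_one_left (prodWeight_nonneg hp _) (hp1 _)
      have h4 : Real.exp ε * η = 1 := by rw [hηdef, ← Real.exp_add, add_neg_cancel, Real.exp_zero]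
      calc prodWeight (Fin n) (respondWeight k η) ω
          = Real.exp ε * (η * prodWeight (Fin n) (respondWeight k η) ω) := by
            rw [← mul_assoc, h4, one_mul]
        _ ≤ _ := mul_le_mul_of_nonneg_left h3 (Real.exp_pos _).le
  · set t := Real.log (k / θ) * (2 / ε) with ht
    have hkθ : 1 ≤ k / θ := by rw [le_div_iff₀ hθ]; linarith
    have ht0 : 0 ≤ t := mul_nonneg (Real.log_nonneg hkθ) (by positivity)
    -- `⌊t⌋₊ + 1` is the least integer beyond `t`.
    refine le_toOuterMeasure_view A _ _ (prodWeight_nonneg hp) (sum_prodWeight h1) _ D (hV D) _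
      {ω : Fin n → Fin k | ⌊t⌋₊ + 1 ≤ (Finset.univ.filter fun j => ω j ≠ 0).card} ?_ fun ω hω i => ?_
    · refine (mass_card_ne_zero_le hη.le hkη _).trans ?_
      calc (n * (k * η)) ^ (⌊t⌋₊ + 1) ≤ Real.exp (-ε / 2) ^ (⌊t⌋₊ + 1) :=
            pow_le_pow_left₀ (by positivity) hnk _
        _ = Real.exp ((⌊t⌋₊ + 1 : ℕ) * (-ε / 2)) := by rw [Real.exp_nat_mul]
        _ ≤ Real.exp (-Real.log (k / θ)) := by
            refine Real.exp_le_exp.2 ?_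
            have h2 : t * (ε / 2) = Real.log (k / θ) := by
              rw [ht]
              field_simp
            have h3 := (Nat.lt_floor_add_one t).le
            push_cast
            nlinarith
        _ = θ / k := by rw [Real.exp_neg, Real.exp_log (by linarith), inv_div]
        _ ≤ θ := div_le_self hθ.le hk1
    · refine (abs_countP_sub_histogram_le D ω i).trans ?_
      have h2 : (Finset.univ.filter fun j => ω j ≠ 0).card ≤ ⌊t⌋₊ :=
        Nat.lt_succ_iff.1 (not_le.1 hω)
      exact (Nat.cast_le.2 h2).trans (Nat.floor_le ht0)

end RandomizedResponse

/-! ### Multiplicities of words -/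

section Counting

variable {X Y W : Type} [Fintype X] [Fintype Y] [Fintype W] [DecidableEq W]

/-- The number of occurrences of the word `u`. -/
def cnt (x : X → W) (u : W) : ℕ := (Finset.univ.filter fun c => x c = u).card

theorem card_filter_eq_sum_cnt (x : X → W) (P : W → Prop) [DecidablePred P] :
    (Finset.univ.filter fun c => P (x c)).card = ∑ u ∈ Finset.univ.filter P, cnt x u := by
  rw [Finset.card_eq_sum_card_fiberwise (f := x) (t := Finset.univ.filter P)
    fun c hc => by simpa using hc]
  refine Finset.sum_congr rfl fun u hu => ?_
  rw [cnt, Finset.filter_filter]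
  congr 1
  ext c
  simp only [Finset.mem_filter, Finset.mem_univ, true_and, and_iff_right_iff_imp]
  rintro rfl
  simpa using hu

theorem card_filter_congr_of_cnt_eq {x : X → W} {y : Y → W} (P : W → Prop) [DecidablePred P]
    (h : ∀ u, P u → cnt x u = cnt y u) :
    (Finset.univ.filter fun c => P (x c)).card = (Finset.univ.filter fun c => P (y c)).card := by
  rw [card_filter_eq_sum_cnt, card_filter_eq_sum_cnt]
  exact Finset.sum_congr rfl fun u hu => h u (by simpa using hu)

theorem cnt_comp_equiv (x : X → W) (σ : Equiv.Perm X) : cnt (x ∘ σ) = cnt x := by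
  funext u
  refine Finset.card_bij (fun c _ => σ c) (fun c hc => by simpa using hc)
    (fun c _ c' _ h => σ.injective h) fun c hc => ⟨σ.symm c, by simpa using hc, by simp⟩

/-- The number of cells is fixed, so the multiplicity of the last word follows from the others. This
spares any bookkeeping of empty cells. -/
theorem cnt_eq_of_forall_ne {x y : X → W} (e : W) (h : ∀ u, u ≠ e → cnt x u = cnt y u) :
    cnt x = cnt y := by
  funext u
  by_cases hu : u = e
  · subst hu
    have h1 := card_filter_congr_of_cnt_eq (· ≠ u) h
    have key : ∀ z : X → W, cnt z u + (Finset.univ.filter fun c => z c ≠ u).card =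
        Fintype.card X := fun z => by
      rw [cnt, Finset.card_filter_add_card_filter_not, Finset.card_univ]
    have h2 := key x
    have h3 := key y
    omega
  · exact h u hu

end Counting

/-! ### Rearranging lines of buckets -/

section Arrange

variable {L B Z : ℕ} {W : Type} [Fintype W] [DecidableEq W] (e : W) (lab : W → Fin L → Fin B)

/-- Every nonempty word is in the bucket that the digit `l` of its label prescribes. -/
def IsSorted (l : Fin L) (y : Fin B × Fin Z → W) : Prop := ∀ c, y c ≠ e → lab (y c) l = c.1

open Classical in
/-- A sorted arrangement of words with given multiplicities. -/
def pick (l : Fin L) (m : W → ℕ) : Fin B × Fin Z → W :=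
  if h : ∃ y : Fin B × Fin Z → W, cnt y = m ∧ IsSorted e lab l y then h.choose else fun _ => e

open Classical in
/-- Rearranges words so that they are sorted, if that is possible. -/
def arrange (l : Fin L) (x : Fin B × Fin Z → W) : Fin B × Fin Z → W :=
  if ∃ y : Fin B × Fin Z → W, cnt y = cnt x ∧ IsSorted e lab l y then pick e lab l (cnt x) else x

theorem pick_spec {l : Fin L} {m : W → ℕ}
    (h : ∃ y : Fin B × Fin Z → W, cnt y = m ∧ IsSorted e lab l y) :
    cnt (pick (Z := Z) e lab l m) = m ∧ IsSorted e lab l (pick (Z := Z) e lab l m) := by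
  rw [pick, dif_pos h]
  exact h.choose_spec

/-- This needs no assumption on overflow: if no sorted arrangement exists, the line is left alone,
so words are never lost and the counts stay exact. -/
theorem cnt_arrange (l : Fin L) (x : Fin B × Fin Z → W) : cnt (arrange e lab l x) = cnt x := by
  rw [arrange]
  split_ifs with h
  · exact (pick_spec e lab h).1
  · rfl

/-- The nonempty words with digit `d` are injected into the `Z` cells of bucket `d`; together these
injections move all nonempty words to distinct cells. -/
theorem exists_sorted (l : Fin L) (x : Fin B × Fin Z → W)
    (h : ∀ d, (Finset.univ.filter fun c => x c ≠ e ∧ lab (x c) l = d).card ≤ Z) :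
    ∃ y : Fin B × Fin Z → W, cnt y = cnt x ∧ IsSorted e lab l y := by
  classical
  have h1 : ∀ d, ∃ f : Fin B × Fin Z → Fin Z,
      Set.InjOn f {c | x c ≠ e ∧ lab (x c) l = d} := by
    intro d
    rcases (Finset.univ.filter fun c => x c ≠ e ∧ lab (x c) l = d).eq_empty_or_nonempty with
      h0 | ⟨c, hc⟩
    · refine ⟨fun c => c.2, fun c hc => ?_⟩
      have : c ∈ (Finset.univ.filter fun c => x c ≠ e ∧ lab (x c) l = d) := by simpa using hc
      rw [h0] at this
      simp at this
    · have : Nonempty (Fin Z) := ⟨c.2⟩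
      have h2 : ((Finset.univ.filter fun c => x c ≠ e ∧ lab (x c) l = d) :
          Set (Fin B × Fin Z)).encard ≤ (Set.univ : Set (Fin Z)).encard := by
        rw [Set.encard_coe_eq_coe_finsetCard, Set.encard_univ, ENat.card_eq_coe_fintype_card,
          Fintype.card_fin]
        exact_mod_cast h d
      obtain ⟨f, -, hf⟩ := (Finset.finite_toSet _).exists_injOn_of_encard_le h2
      exact ⟨f, by simpa using hf⟩
  choose f hf using h1
  have h2 : Set.InjOn (fun c => (lab (x c) l, f (lab (x c) l) c)) {c | x c ≠ e} := by
    intro c hc c' hc' hcc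
    simp only [Prod.mk.injEq] at hcc
    refine hf _ (show c ∈ {c | x c ≠ e ∧ lab (x c) l = lab (x c') l} from ⟨hc, hcc.1⟩)
      ⟨hc', rfl⟩ ?_
    rw [← hcc.1, hcc.2, ← hcc.1]
  -- The injection of the nonempty cells extends to a permutation of all cells; empty words fill the
  -- remaining places.
  obtain ⟨g, hg⟩ := Set.MapsTo.exists_equiv_extend_of_card_eq (t := Finset.univ)
    (by simp) (Set.mapsTo_univ _ _ |>.mono_right (by simp)) h2
  let σ : Equiv.Perm (Fin B × Fin Z) := g.trans (Equiv.subtypeUnivEquiv fun c => Finset.mem_univ c)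
  refine ⟨x ∘ σ.symm, cnt_comp_equiv x σ.symm, fun c hc => ?_⟩
  have h3 : σ (σ.symm c) = _ := hg (σ.symm c) hc
  rw [Equiv.apply_symm_apply] at h3
  exact (congrArg Prod.fst h3).symm

/-- The words in the buckets that differ from `b` at most in the digit `l`. -/
def line (l : Fin L) (b : Fin L → Fin B) (A : (Fin L → Fin B) × Fin Z → W) (c : Fin B × Fin Z) :
    W := A (Function.update b l c.1, c.2)

/-- Rearranges all lines in direction `l`. -/
def pass (l : Fin L) (A : (Fin L → Fin B) × Fin Z → W) (c : (Fin L → Fin B) × Fin Z) : W :=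
  arrange e lab l (line l c.1 A) (c.1 l, c.2)

theorem line_update (l : Fin L) (b : Fin L → Fin B) (d : Fin B)
    (A : (Fin L → Fin B) × Fin Z → W) : line l (Function.update b l d) A = line l b A := by
  funext c
  simp [line]

theorem line_pass (l : Fin L) (b : Fin L → Fin B) (A : (Fin L → Fin B) × Fin Z → W) :
    line l b (pass e lab l A) = arrange e lab l (line l b A) := by
  funext c
  simp only [line, pass, Function.update_self]
  rw [line_update]

/-- Every bucket arises from exactly `B` choices of the overwritten digit, which `exchange`
expresses as a bijection. -/
theorem sum_update (l : Fin L) (f : (Fin L → Fin B) → ℕ) :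
    ∑ b : Fin L → Fin B, ∑ d : Fin B, f (Function.update b l d) = B * ∑ b, f b := by
  have h := Equiv.sum_comp (exchange (Ω := Fin B) l) fun y => f y.2
  rw [Fintype.sum_prod_type, Fintype.sum_prod_type] at h
  simp only [exchange, Equiv.coe_fn_mk, Finset.sum_const, Finset.card_univ, Fintype.card_fin,
    smul_eq_mul] at h
  rw [Finset.sum_comm]
  exact h

theorem cnt_eq_sum (A : (Fin L → Fin B) × Fin Z → W) (u : W) :
    cnt A u = ∑ b, (Finset.univ.filter fun z => A (b, z) = u).card := by
  rw [cnt, Finset.card_filter, Fintype.sum_prod_type]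
  exact Finset.sum_congr rfl fun b _ => (Finset.card_filter _ _).symm

theorem cnt_line_eq_sum (l : Fin L) (b : Fin L → Fin B) (A : (Fin L → Fin B) × Fin Z → W)
    (u : W) : cnt (line l b A) u =
      ∑ d, (Finset.univ.filter fun z => A (Function.update b l d, z) = u).card := by
  rw [cnt, Finset.card_filter, Fintype.sum_prod_type]
  exact Finset.sum_congr rfl fun b _ => (Finset.card_filter _ _).symm

/-- The sum over all `b` runs through every line `B` times, hence the comparison of `B`-fold
multiplicities. -/
theorem cnt_pass (l : Fin L) (A : (Fin L → Fin B) × Fin Z → W) : cnt (pass e lab l A) = cnt A := by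
  funext u
  have key : ∀ A : (Fin L → Fin B) × Fin Z → W,
      B * cnt A u = ∑ b, cnt (line l b A) u := by
    intro A
    rw [cnt_eq_sum, ← sum_update l]
    exact Finset.sum_congr rfl fun b _ => (cnt_line_eq_sum l b A u).symm
  rcases Nat.eq_zero_or_pos B with rfl | hB
  · have : IsEmpty (Fin L → Fin 0) := ⟨fun b => (b l).elim0⟩
    simp [cnt]
  · refine Nat.eq_of_mul_eq_mul_left hB ?_
    rw [key, key]
    refine Finset.sum_congr rfl fun b _ => ?_
    rw [line_pass, cnt_arrange]

/-- The levels of the network as a function of a natural number. -/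
def level (l : ℕ) (A : (Fin L → Fin B) × Fin Z → W) : (Fin L → Fin B) × Fin Z → W :=
  if h : l < L then pass e lab ⟨l, h⟩ A else A

theorem cnt_level (l : ℕ) (A : (Fin L → Fin B) × Fin Z → W) : cnt (level e lab l A) = cnt A := by
  rw [level]
  split_ifs
  · exact cnt_pass e lab _ A
  · rfl

theorem cnt_levels (l : List ℕ) (A : (Fin L → Fin B) × Fin Z → W) :
    cnt (l.foldl (fun A l => level e lab l A) A) = cnt A := by
  induction l generalizing A with
  | nil => rfl
  | cons l l' ih => rw [List.foldl_cons, ih, cnt_level]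

/-! ### Routing without overflow -/

section Network

variable {E : Type} [Fintype E] (pos : E → Fin L → Fin B) (word : E → W)

/-- The elements that belong to bucket `b` after `l` levels. -/
def inBucket (l : ℕ) (b : Fin L → Fin B) (x : E) : Prop :=
  (∀ j : Fin L, l ≤ j.val → pos x j = b j) ∧ ∀ j : Fin L, j.val < l → lab (word x) j = b j

open Classical in
/-- The number of elements that belong to bucket `b` after `l` levels. -/
def load (l : ℕ) (b : Fin L → Fin B) : ℕ :=
  (Finset.univ.filter fun x => inBucket lab pos word l b x).card

open Classical in
/-- After `l` levels every bucket holds the words that belong to it. -/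
def Routed (l : ℕ) (A : (Fin L → Fin B) × Fin Z → W) : Prop :=
  ∀ b u, u ≠ e → (Finset.univ.filter fun z => A (b, z) = u).card =
    (Finset.univ.filter fun x => word x = u ∧ inBucket lab pos word l b x).card

variable {pos word}

open Classical in
-- Summing over the buckets of a line removes the condition on digit `l` of the position. A line
-- thus constrains neither position nor label in that digit.
theorem Routed.cnt_line {l : Fin L} {A : (Fin L → Fin B) × Fin Z → W}
    (hA : Routed e lab pos word l A) (b : Fin L → Fin B) {u : W} (hu : u ≠ e) :
    cnt (line l b A) u = (Finset.univ.filter fun x => word x = u ∧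
      (∀ j, l < j → pos x j = b j) ∧ ∀ j, j < l → lab (word x) j = b j).card := by
  rw [cnt_line_eq_sum, Finset.card_eq_sum_card_fiberwise (f := fun x => pos x l)
    (t := Finset.univ) fun x _ => Finset.mem_coe.2 (Finset.mem_univ _)]
  refine Finset.sum_congr rfl fun d _ => ?_
  rw [hA _ u hu, Finset.filter_filter]
  congr 1
  ext x
  simp only [Finset.mem_filter, Finset.mem_univ, true_and]
  unfold inBucket
  constructor
  · rintro ⟨h1, h2, h3⟩
    refine ⟨⟨h1, fun j hj => ?_, fun j hj => ?_⟩, ?_⟩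
    · rw [h2 j hj.le, Function.update_of_ne hj.ne']
    · rw [h3 j hj, Function.update_of_ne hj.ne]
    · rw [h2 l le_rfl, Function.update_self]
  · rintro ⟨⟨h1, h2, h3⟩, h4⟩
    refine ⟨h1, fun j hj => ?_, fun j hj => ?_⟩
    · rcases (show l ≤ j from hj).eq_or_lt with rfl | hj
      · rw [Function.update_self, h4]
      · rw [h2 j hj, Function.update_of_ne hj.ne']
    · rw [h3 j hj, Function.update_of_ne (show j < l from hj).ne]

open Classical in
-- The words of the line with digit `d` are those that belong to one bucket of the next level, where
-- the load bound applies.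
theorem Routed.exists_sorted_line {l : Fin L} {A : (Fin L → Fin B) × Fin Z → W}
    (hA : Routed e lab pos word l A) (hload : ∀ b, load lab pos word (l + 1) b ≤ Z)
    (b : Fin L → Fin B) :
    ∃ y : Fin B × Fin Z → W, cnt y = cnt (line l b A) ∧ IsSorted e lab l y := by
  refine exists_sorted e lab l _ fun d => ?_
  refine le_trans ?_ (hload (Function.update b l d))
  rw [card_filter_eq_sum_cnt (line l b A) fun u => u ≠ e ∧ lab u l = d, load]
  have h1 : ∀ u ∈ Finset.univ.filter (fun u => u ≠ e ∧ lab u l = d), cnt (line l b A) u =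
      ((Finset.univ.filter fun x => inBucket lab pos word (l + 1) (Function.update b l d) x).filter
        fun x => word x = u).card := by
    intro u hu
    simp only [Finset.mem_filter, Finset.mem_univ, true_and] at hu
    rw [hA.cnt_line e lab b hu.1, Finset.filter_filter]
    congr 1
    ext x
    simp only [Finset.mem_filter, Finset.mem_univ, true_and]
    unfold inBucket
    constructor
    · rintro ⟨h1, h2, h3⟩
      refine ⟨⟨fun j hj => ?_, fun j hj => ?_⟩, h1⟩
      · have hj : l < j := hj
        rw [h2 j hj, Function.update_of_ne hj.ne']
      · rcases (show j ≤ l from Nat.lt_succ_iff.1 hj).eq_or_lt with rfl | hj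
        · rw [Function.update_self, h1, hu.2]
        · rw [h3 j hj, Function.update_of_ne hj.ne]
    · rintro ⟨⟨h2, h3⟩, h1⟩
      refine ⟨h1, fun j hj => ?_, fun j hj => ?_⟩
      · rw [h2 j hj, Function.update_of_ne hj.ne']
      · rw [h3 j (Nat.lt_succ_of_lt hj), Function.update_of_ne hj.ne]
  rw [Finset.sum_congr rfl h1, ← Finset.card_biUnion]
  · refine Finset.card_le_card ?_
    intro x hx
    simp only [Finset.mem_biUnion, Finset.mem_filter] at hx ⊢
    obtain ⟨u, -, hx, -⟩ := hx
    exact hx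
  · intro u _ v _ huv
    rw [Function.onFun, Finset.disjoint_filter]
    rintro x _ rfl
    exact huv

/-- In a sorted line a bucket holds either all copies of `u` or none, according to digit `l` of the
label of `u`. This is the condition that `inBucket` gains at level `l + 1`. -/
theorem Routed.pass {l : Fin L} {A : (Fin L → Fin B) × Fin Z → W}
    (hA : Routed e lab pos word l A) (hload : ∀ b, load lab pos word (l + 1) b ≤ Z) :
    Routed e lab pos word (l + 1) (pass e lab l A) := by
  classical
  intro b u hu
  have hex := hA.exists_sorted_line e lab hload b
  have h1 := pick_spec e lab hex
  have h2 : ∀ z, ODP.pass e lab l A (b, z) = pick e lab l (cnt (line l b A)) (b l, z) := by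
    intro z
    rw [ODP.pass, arrange, if_pos hex]
  simp only [h2]
  by_cases hub : lab u l = b l
  · have h3 : (Finset.univ.filter fun z => pick (Z := Z) e lab l (cnt (line l b A)) (b l, z) =
        u).card = cnt (pick (Z := Z) e lab l (cnt (line l b A))) u := by
      refine Finset.card_bij (fun z _ => (b l, z)) (fun z hz => by simpa using hz)
        (fun z _ z' _ h => (Prod.mk.inj h).2) ?_
      rintro ⟨d, z⟩ hc
      simp only [Finset.mem_filter, Finset.mem_univ, true_and] at hc
      have h4 := h1.2 (d, z) (by rw [hc]; exact hu)
      rw [hc, hub] at h4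
      subst h4
      exact ⟨z, by simpa using hc, rfl⟩
    rw [h3, h1.1, hA.cnt_line e lab b hu]
    congr 1
    ext x
    simp only [Finset.mem_filter, Finset.mem_univ, true_and]
    unfold inBucket
    constructor
    · rintro ⟨g1, g2, g3⟩
      refine ⟨g1, fun j hj => g2 j hj, fun j hj => ?_⟩
      rcases (show j ≤ l from Nat.lt_succ_iff.1 hj).eq_or_lt with rfl | hj
      · rw [g1, hub]
      · exact g3 j hj
    · rintro ⟨h1, h2, h3⟩
      exact ⟨h1, fun j hj => h2 j hj, fun j hj => h3 j (Nat.lt_succ_of_lt hj)⟩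
  · rw [Finset.card_eq_zero.2, Finset.card_eq_zero.2]
    · rw [Finset.filter_eq_empty_iff]
      rintro x - ⟨rfl, h3⟩
      exact hub (h3.2 l (Nat.lt_succ_self _))
    · rw [Finset.filter_eq_empty_iff]
      intro z _ hz
      have h4 := h1.2 (b l, z) (by rw [hz]; exact hu)
      rw [hz] at h4
      exact hub h4

theorem Routed.levels {A : (Fin L → Fin B) × Fin Z → W} (hA : Routed e lab pos word 0 A) {l : ℕ}
    (hl : l ≤ L) (hload : ∀ l' ≤ l, ∀ b, load lab pos word l' b ≤ Z) :
    Routed e lab pos word l ((List.range l).foldl (fun A l => level e lab l A) A) := by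
  induction l with
  | zero => exact hA
  | succ l ih =>
    have h1 := ih (Nat.le_of_succ_le hl) fun l' hl' => hload l' (hl'.trans (Nat.le_succ l))
    rw [List.range_succ, List.foldl_append, List.foldl_cons, List.foldl_nil, level,
      dif_pos (Nat.lt_of_succ_le hl)]
    exact Routed.pass e lab (l := ⟨l, Nat.lt_of_succ_le hl⟩) h1 (hload (l + 1) le_rfl)

/-- Without overflow, the final content depends only on the collection of words. -/
theorem levels_eq_of_perm (hL : 0 < L) {word' : E → W} (π : Equiv.Perm E)
    (hπ : ∀ x, word' x = word (π x)) {A A' : (Fin L → Fin B) × Fin Z → W}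
    (hA : Routed e lab pos word 0 A) (hA' : Routed e lab pos word' 0 A')
    (hload : ∀ l ≤ L, ∀ b, load lab pos word l b ≤ Z)
    (hload' : ∀ l ≤ L, ∀ b, load lab pos word' l b ≤ Z) :
    (List.range L).foldl (fun A l => level e lab l A) A =
      (List.range L).foldl (fun A l => level e lab l A) A' := by
  classical
  obtain ⟨l, rfl⟩ : ∃ l, L = l + 1 := ⟨L - 1, by omega⟩
  have h1 := hA.levels e lab (Nat.le_succ l) fun l' hl' => hload l' (hl'.trans (Nat.le_succ l))
  have h1' := hA'.levels e lab (Nat.le_succ l) fun l' hl' => hload' l' (hl'.trans (Nat.le_succ l))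
  rw [List.range_succ, List.foldl_append, List.foldl_append, List.foldl_cons, List.foldl_nil,
    List.foldl_cons, List.foldl_nil, level, level, dif_pos (Nat.lt_succ_self l),
    dif_pos (Nat.lt_succ_self l)]
  generalize (List.range l).foldl (fun A l => level e lab l A) A = A₁ at *
  generalize (List.range l).foldl (fun A l => level e lab l A) A' = A₂ at *
  set l' : Fin (l + 1) := ⟨l, Nat.lt_succ_self l⟩ with hl'
  have h1 : Routed e lab pos word l' A₁ := h1
  have h1' : Routed e lab pos word' l' A₂ := h1'
  funext c
  -- At the last level no digit of the initial position remains in the count, so `π` preserves it.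
  -- As `pick` depends only on multiplicities, the two arrangements are then identical.
  have h2 : cnt (line l' c.1 A₁) = cnt (line l' c.1 A₂) := by
    refine cnt_eq_of_forall_ne e fun u hu => ?_
    rw [h1.cnt_line e lab _ hu, h1'.cnt_line e lab _ hu]
    refine (Finset.card_bij (fun x _ => π x) ?_ (fun x _ y _ h => π.injective h) ?_).symm
    · intro x hx
      simp only [Finset.mem_filter, Finset.mem_univ, true_and, hπ] at hx ⊢
      refine ⟨hx.1, fun j hj => absurd hj ?_, hx.2.2⟩
      exact not_lt.2 (Nat.lt_succ_iff.1 j.isLt)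
    · intro x hx
      refine ⟨π.symm x, ?_, by simp⟩
      simp only [Finset.mem_filter, Finset.mem_univ, true_and, hπ, Equiv.apply_symm_apply] at hx ⊢
      refine ⟨hx.1, fun j hj => absurd hj ?_, hx.2.2⟩
      exact not_lt.2 (Nat.lt_succ_iff.1 j.isLt)
  rw [pass, pass, arrange, arrange,
    if_pos (h1.exists_sorted_line e lab (hload (l + 1) le_rfl) c.1),
    if_pos (h1'.exists_sorted_line e lab (hload' (l + 1) le_rfl) c.1), h2]

end Network

end Arrange

/-! ### Reading and writing blocks of cells -/

section Blocks

variable {α W Ω X : Type} [DecidableEq α] [DecidableEq X]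

/-- Reads the cells `addr x` for `x` in a list. -/
def readAll (addr : X → α) : List X → (X → W) → ((X → W) → Prog α W Ω) → Prog α W Ω
  | [], acc, K => K acc
  | x :: l, acc, K => .read (addr x) fun v => readAll addr l (Function.update acc x v) K

/-- Writes the cells `addr x` for `x` in a list. -/
def writeAll (addr : X → α) : List X → (X → W) → Prog α W Ω
  | [], _ => .halt
  | x :: l, y => .write (addr x) (y x) (writeAll addr l y)

theorem den_readAll (μ : PMF Ω) (addr : X → α) (l : List X) (acc : X → W)
    (K : (X → W) → Prog α W Ω) (s : Store α W) :
    (readAll addr l acc K).den μ s = (K fun x => if x ∈ l then s.1 (addr x) else acc x).den μ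
      (s.1, s.2 ++ l.map fun x => (addr x, false)) := by
  induction l generalizing acc s with
  | nil => simp [readAll]
  | cons x l ih =>
    rw [readAll, Prog.den, ih]
    congr 1
    · congr 1
      funext y
      by_cases hy : y ∈ l
      · simp [hy]
      · by_cases hyx : y = x
        · subst hyx
          simp
        · simp [hy, hyx]
    · simp

theorem den_readAll_of_forall_mem (μ : PMF Ω) (addr : X → α) (l : List X) (hl : ∀ x, x ∈ l)
    (acc : X → W) (K : (X → W) → Prog α W Ω) (s : Store α W) :
    (readAll addr l acc K).den μ s = (K fun x => s.1 (addr x)).den μ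
      (s.1, s.2 ++ l.map fun x => (addr x, false)) := by
  rw [den_readAll]
  simp only [hl, if_true]

theorem den_writeAll (μ : PMF Ω) (addr : X → α) (l : List X) (y : X → W) (s : Store α W) :
    (writeAll addr l y).den μ s =
      PMF.pure (l.foldl (fun e x => Function.update e (addr x) (y x)) s.1,
        s.2 ++ l.map fun x => (addr x, true)) := by
  induction l generalizing s with
  | nil => simp [writeAll, Prog.den]
  | cons x l ih =>
    rw [writeAll, Prog.den, ih]
    simp

/-- A fold of updates of distinct cells. -/
theorem foldl_update {ι : Type} (addr : ι → α) (haddr : Function.Injective addr)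
    (val : ι → (α → W) → W)
    (hval : ∀ i y y', (∀ a, (∀ j, j ≠ i → a ≠ addr j) → y a = y' a) → val i y = val i y')
    (l : List ι) (hl : l.Nodup) (y : α → W) :
    (∀ i ∈ l, l.foldl (fun y i => Function.update y (addr i) (val i y)) y (addr i) = val i y) ∧
    ∀ a, (∀ i ∈ l, a ≠ addr i) →
      l.foldl (fun y i => Function.update y (addr i) (val i y)) y a = y a := by
  induction l generalizing y with
  | nil => simp
  | cons j l ih =>
    rw [List.nodup_cons] at hl
    obtain ⟨ih1, ih2⟩ := ih hl.2 (Function.update y (addr j) (val j y))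
    refine ⟨fun i hi => ?_, fun a ha => ?_⟩
    · rw [List.foldl_cons]
      by_cases hij : i = j
      · subst hij
        rw [ih2 _ fun i' hi' h => hl.1 (by rwa [haddr h]), Function.update_self]
      · rw [ih1 i ((List.mem_cons.1 hi).resolve_left hij)]
        refine hval i _ _ fun a ha => ?_
        rw [Function.update_of_ne (ha j (Ne.symm hij))]
    · rw [List.foldl_cons, ih2 a fun i hi => ha i (List.mem_cons_of_mem _ hi),
        Function.update_of_ne (ha j List.mem_cons_self)]

end Blocks

/-! ### The network algorithm as a program -/

/-- An encoding of types and labels by words, in which `0` has no type. -/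
structure Coding (k w : ℕ) (Λ : Type) where
  word : Option (Fin k) → Λ → BitVec w
  typ : BitVec w → Option (Fin k)
  lab : BitVec w → Λ
  typ_word : ∀ t r, typ (word t r) = t
  lab_word : ∀ t r, lab (word t r) = r
  typ_zero : typ 0 = none

/-- The cells that are not part of the input: counters and the main array. -/
abbrev Work (k L B Z : ℕ) : Type := Option (Fin k) ⊕ ((Fin L → Fin B) × Fin Z)

/-- The elements that are routed through the network: the records and the dummies. -/
abbrev Elem (n k R : ℕ) : Type := Fin n ⊕ Fin k × Fin (2 * R)

/-- Seeds: a sign and an absolute value for the noise, and a label. -/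
abbrev Seed (L B R m : ℕ) : Type := (Bool × Fin (R * m + 1)) × (Fin L → Fin B)

/-- The noise, shifted by `R * m` so that it is nonnegative. -/
def shifted {R m : ℕ} (x : Bool × Fin (R * m + 1)) : ℕ :=
  if x.1 then R * m + x.2 else R * m - x.2

theorem shifted_le {R m : ℕ} (x : Bool × Fin (R * m + 1)) : shifted x ≤ 2 * (R * m) := by
  have := x.2.isLt
  rw [shifted]
  split_ifs <;> omega

section Network

variable {n k L B Z R m w : ℕ} [NeZero k] [NeZero B]

/-- The address of a counter. -/
def ctr (t : Option (Fin k)) : Fin n ⊕ Work k L B Z := Sum.inr (Sum.inl t)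

/-- The address of a cell of the main array. -/
def arr (c : (Fin L → Fin B) × Fin Z) : Fin n ⊕ Work k L B Z := Sum.inr (Sum.inr c)

theorem arr_injective :
    Function.Injective (arr : (Fin L → Fin B) × Fin Z → Fin n ⊕ Work k L B Z) :=
  fun _ _ h => Sum.inr.inj (Sum.inr.inj h)

theorem ctr_injective : Function.Injective (ctr : Option (Fin k) → Fin n ⊕ Work k L B Z) :=
  fun _ _ h => Sum.inl.inj (Sum.inr.inj h)

theorem arr_ne_ctr (c : (Fin L → Fin B) × Fin Z) (t : Option (Fin k)) :
    (arr c : Fin n ⊕ Work k L B Z) ≠ ctr t := fun h => by simp [arr, ctr] at h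

theorem inl_ne_ctr (j : Fin n) (t : Option (Fin k)) :
    (Sum.inl j : Fin n ⊕ Work k L B Z) ≠ ctr t := fun h => by simp [ctr] at h

theorem inl_ne_arr (j : Fin n) (c : (Fin L → Fin B) × Fin Z) :
    (Sum.inl j : Fin n ⊕ Work k L B Z) ≠ arr c := fun h => by simp [arr] at h

/-- Draws the noise for type `i`. -/
def noiseProg (i : Fin k) : Prog (Fin n ⊕ Work k L B Z) (BitVec w) (Seed L B R m) :=
  .sample fun r => .write (ctr (some i)) (BitVec.ofNat w (shifted r.1)) .halt

/-- The cell that determines the type of an element. -/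
def source : Elem n k R → Fin n ⊕ Work k L B Z :=
  Sum.elim Sum.inl fun x => ctr (some x.1)

/-- The type of an element, given the content of its source. -/
def sourceType (m : ℕ) (x : Elem n k R) (v : BitVec w) : Option (Fin k) :=
  match x with
  | .inl _ => some (decType k v)
  | .inr (i, d) => if d.val < v.toNat / m then some i else none

variable (cd : Coding k w (Fin L → Fin B)) (slot : Elem n k R → (Fin L → Fin B) × Fin Z)

/-- Writes an element with a random label to its slot. -/
def elemProg (x : Elem n k R) : Prog (Fin n ⊕ Work k L B Z) (BitVec w) (Seed L B R m) :=
  .sample fun r => .read (source x) fun v =>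
    .write (arr (slot x)) (cd.word (sourceType m x v) r.2) .halt

/-- Replaces the shifted noise of type `i` by the initial value of the counter. -/
def initProg (i : Fin k) : Prog (Fin n ⊕ Work k L B Z) (BitVec w) (Seed L B R m) :=
  .read (ctr (some i)) fun v =>
    .write (ctr (some i)) (BitVec.ofInt w ((v.toNat % m : ℕ) - (R * m : ℕ))) .halt

/-- Rearranges a line. -/
def lineProg (l : Fin L) (b : Fin L → Fin B) :
    Prog (Fin n ⊕ Work k L B Z) (BitVec w) (Seed L B R m) :=
  readAll (fun c : Fin B × Fin Z => arr (Function.update b l c.1, c.2)) Finset.univ.toList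
    (fun _ => 0) fun x =>
      writeAll (fun c : Fin B × Fin Z => arr (Function.update b l c.1, c.2)) Finset.univ.toList
        (arrange 0 cd.lab l x)

/-- Representatives of the lines in direction `l`. -/
def lineReps (l : Fin L) : List (Fin L → Fin B) := (Finset.univ.filter fun b => b l = 0).toList

/-- Rearranges all lines in direction `l`. -/
def levelProg (l : ℕ) : Prog (Fin n ⊕ Work k L B Z) (BitVec w) (Seed L B R m) :=
  if h : l < L then Prog.seqList ((lineReps ⟨l, h⟩).map (lineProg cd ⟨l, h⟩)) else .halt

/-- Counts the content of one cell. -/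
def scanProg (c : (Fin L → Fin B) × Fin Z) :
    Prog (Fin n ⊕ Work k L B Z) (BitVec w) (Seed L B R m) :=
  .read (arr c) fun v => .read (ctr (cd.typ v)) fun y =>
    .write (ctr (cd.typ v)) (y + BitVec.ofNat w m) .halt

/-- The indices of the seeds, in the order in which they are drawn. -/
def seedList (n k R : ℕ) : List (Fin k ⊕ Elem n k R) :=
  (List.finRange k).map Sum.inl ++ (Finset.univ : Finset (Elem n k R)).toList.map Sum.inr

/-- The randomized part of the algorithm. -/
def seedProg : Fin k ⊕ Elem n k R → Prog (Fin n ⊕ Work k L B Z) (BitVec w) (Seed L B R m) :=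
  Sum.elim noiseProg (elemProg cd slot)

/-- The oblivious histogram algorithm. -/
def mainProg : Prog (Fin n ⊕ Work k L B Z) (BitVec w) (Seed L B R m) :=
  (Prog.seqList ((seedList n k R).map (seedProg cd slot))).seq
    ((Prog.seqList ((List.finRange k).map initProg)).seq
      ((Prog.seqList ((List.range L).map (levelProg cd))).seq
        (Prog.seqList (Finset.univ.toList.map (scanProg cd)))))

/-- The content of the main array. -/
def getArr (y : Fin n ⊕ Work k L B Z → BitVec w) (c : (Fin L → Fin B) × Fin Z) : BitVec w :=
  y (arr c)

/-- Changes the content of the main array. -/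
def setArr (y : Fin n ⊕ Work k L B Z → BitVec w) (A : (Fin L → Fin B) × Fin Z → BitVec w) :
    Fin n ⊕ Work k L B Z → BitVec w :=
  Sum.elim (fun j => y (Sum.inl j)) (Sum.elim (fun t => y (ctr t)) A)

theorem setArr_ctr (y : Fin n ⊕ Work k L B Z → BitVec w) (A : (Fin L → Fin B) × Fin Z → BitVec w)
    (t : Option (Fin k)) : setArr y A (ctr t) = y (ctr t) := rfl

theorem setArr_getArr (y : Fin n ⊕ Work k L B Z → BitVec w) : setArr y (getArr y) = y := by
  funext a
  rcases a with j | t | c <;> rfl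

theorem getArr_setArr (y : Fin n ⊕ Work k L B Z → BitVec w)
    (A : (Fin L → Fin B) × Fin Z → BitVec w) : getArr (setArr y A) = A := rfl

theorem setArr_setArr (y : Fin n ⊕ Work k L B Z → BitVec w)
    (A A' : (Fin L → Fin B) × Fin Z → BitVec w) : setArr (setArr y A) A' = setArr y A' := by
  funext a
  rcases a with j | t | c <;> rfl

/-- The effect of rearranging a line on the main array. -/
def lineStep (l : Fin L) (b : Fin L → Fin B) (A : (Fin L → Fin B) × Fin Z → BitVec w)
    (c : (Fin L → Fin B) × Fin Z) : BitVec w :=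
  if Function.update c.1 l 0 = Function.update b l 0 then
    arrange 0 cd.lab l (line l b A) (c.1 l, c.2)
  else A c

/-- The accesses of rearranging a line. -/
def lineTrace (n k Z : ℕ) (l : Fin L) (b : Fin L → Fin B) :
    List ((Fin n ⊕ Work k L B Z) × Bool) :=
  (Finset.univ : Finset (Fin B × Fin Z)).toList.map
      (fun c => (arr (Function.update b l c.1, c.2), false)) ++
    (Finset.univ : Finset (Fin B × Fin Z)).toList.map
      (fun c => (arr (Function.update b l c.1, c.2), true))

theorem line_injective (l : Fin L) (b : Fin L → Fin B) :
    Function.Injective fun c : Fin B × Fin Z =>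
      (arr (Function.update b l c.1, c.2) : Fin n ⊕ Work k L B Z) := by
  intro c c' h
  have h1 := Prod.mk.inj (arr_injective h)
  have h2 := congrFun h1.1 l
  rw [Function.update_self, Function.update_self] at h2
  exact Prod.ext h2 h1.2

theorem den_lineProg (μ : PMF (Seed L B R m)) (l : Fin L) (b : Fin L → Fin B)
    (s : Store (Fin n ⊕ Work k L B Z) (BitVec w)) :
    (lineProg cd l b).den μ s =
      PMF.pure (setArr s.1 (lineStep cd l b (getArr s.1)), s.2 ++ lineTrace n k Z l b) := by
  rw [lineProg, den_readAll_of_forall_mem μ _ _ (by simp), den_writeAll]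
  congr 1
  refine Prod.ext ?_ (by simp [lineTrace])
  obtain ⟨h1, h2⟩ := foldl_update (fun c : Fin B × Fin Z =>
    (arr (Function.update b l c.1, c.2) : Fin n ⊕ Work k L B Z)) (line_injective l b)
    (fun c _ => arrange 0 cd.lab l (line l b (getArr s.1)) c) (fun _ _ _ _ => rfl)
    Finset.univ.toList (Finset.nodup_toList _) s.1
  funext a
  rcases a with j | t | c
  · exact h2 _ fun i _ => inl_ne_arr _ _
  · exact h2 _ fun i _ => (arr_ne_ctr _ _).symm
  · change _ = lineStep cd l b (getArr s.1) c
    rw [lineStep]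
    split_ifs with hc
    · have h3 := h1 (c.1 l, c.2) (by simp)
      have h4 : Function.update b l (c.1 l) = c.1 := by
        funext j
        by_cases hj : j = l
        · subst hj
          simp
        · have := congrFun hc j
          rw [Function.update_of_ne hj, Function.update_of_ne hj] at this
          rw [Function.update_of_ne hj, this]
      simp only [h4] at h3
      exact h3
    · refine h2 _ fun i _ h => hc ?_
      have h3 : c = (Function.update b l i.1, i.2) := arr_injective h
      rw [h3]
      simp

/-- The lines in direction `l` partition the cells, so rearranging them one after another has the
effect of the simultaneous `pass`. -/
theorem den_levelProg (μ : PMF (Seed L B R m)) (l : ℕ)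
    (s : Store (Fin n ⊕ Work k L B Z) (BitVec w)) :
    (levelProg cd l).den μ s =
      PMF.pure (setArr s.1 (level 0 cd.lab l (getArr s.1)), s.2 ++
        if h : l < L then (lineReps ⟨l, h⟩).flatMap (lineTrace n k Z ⟨l, h⟩) else []) := by
  rw [levelProg, level]
  split_ifs with h
  · rw [Prog.den_seqList_pure μ _ _ (den_lineProg cd μ ⟨l, h⟩),
      foldl_store (fun b y => setArr y (lineStep cd ⟨l, h⟩ b (getArr y)))]
    congr 2
    set l' : Fin L := ⟨l, h⟩
    have h0 : ∀ (ls : List (Fin L → Fin B)) (y : Fin n ⊕ Work k L B Z → BitVec w),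
        ls.foldl (fun y b => setArr y (lineStep cd l' b (getArr y))) y =
          setArr y (ls.foldl (fun A b => lineStep cd l' b A) (getArr y)) := by
      intro ls
      induction ls with
      | nil => exact fun y => (setArr_getArr y).symm
      | cons b ls ih =>
        intro y
        rw [List.foldl_cons, ih, setArr_setArr, getArr_setArr, List.foldl_cons]
    rw [h0]
    congr 1
    funext c
    -- The owner of a cell is the representative of its line, obtained by setting digit `l` to `0`.
    have h1 := (foldl_local (fun b (A : (Fin L → Fin B) × Fin Z → BitVec w) c =>
        if Function.update c.1 l' 0 = b then arrange 0 cd.lab l' (line l' b A) (c.1 l', c.2)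
        else A c)
      (fun c : (Fin L → Fin B) × Fin Z => some (Function.update c.1 l' 0)) ?_ ?_
      (lineReps l') (Finset.nodup_toList _) (getArr s.1) c).2 _ rfl
    · have h2 : ∀ ls : List (Fin L → Fin B), (∀ b ∈ ls, b l' = 0) →
          ∀ A : (Fin L → Fin B) × Fin Z → BitVec w,
          ls.foldl (fun A b => lineStep cd l' b A) A = ls.foldl (fun A b c =>
            if Function.update c.1 l' 0 = b then arrange 0 cd.lab l' (line l' b A) (c.1 l', c.2)
            else A c) A := by
        intro ls hls A
        refine List.foldl_ext _ _ _ fun A b hb => funext fun c => ?_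
        have hb' : Function.update b l' 0 = b := by rw [← hls b hb, Function.update_eq_self]
        rw [lineStep, hb']
      rw [h2 _ fun b hb => by simpa [lineReps] using hb, h1, if_pos (by simp [lineReps]),
        if_pos rfl, line_update]
      rfl
    · intro b A c hc
      exact if_neg fun h => hc (congrArg some h)
    · intro b A A' hA c hc
      have hc' : Function.update c.1 l' 0 = b := Option.some.inj hc
      have h3 : line l' b A = line l' b A' := by
        funext c'
        refine hA _ (Or.inl ?_)
        rw [← hc']
        simp
      rw [if_pos hc', if_pos hc', h3]
  · rw [setArr_getArr, List.append_nil]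
    rfl

/-- The pattern `tr` is quantified before the store: routing is oblivious. -/
theorem den_levels (μ : PMF (Seed L B R m)) (n k Z : ℕ) [NeZero k]
    (cd : Coding k w (Fin L → Fin B)) (ls : List ℕ) :
    ∃ tr : List ((Fin n ⊕ Work k L B Z) × Bool),
      ∀ s : Store (Fin n ⊕ Work k L B Z) (BitVec w),
        (Prog.seqList (ls.map (levelProg cd))).den μ s = PMF.pure
          (setArr s.1 (ls.foldl (fun A l => level 0 cd.lab l A) (getArr s.1)), s.2 ++ tr) := by
  induction ls with
  | nil =>
    refine ⟨[], fun s => ?_⟩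
    rw [List.foldl_nil, setArr_getArr, List.append_nil]
    rfl
  | cons l ls ih =>
    obtain ⟨tr, htr⟩ := ih
    refine ⟨(if h : l < L then (lineReps ⟨l, h⟩).flatMap (lineTrace n k Z ⟨l, h⟩) else []) ++ tr,
      fun s => ?_⟩
    rw [List.map_cons, Prog.seqList, Prog.den_seq, den_levelProg, PMF.pure_bind, htr,
      getArr_setArr, setArr_setArr, List.foldl_cons, List.append_assoc]

end Network

/-! ### Output and access pattern as functions of the seeds -/

section Main

variable {n k L B Z R m w : ℕ} [NeZero k] [NeZero B]
  (cd : Coding k w (Fin L → Fin B)) (slot : Elem n k R → (Fin L → Fin B) × Fin Z)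

/-- The effect of one step of the randomized part. -/
def seedStep (i : Fin k ⊕ Elem n k R) (r : Seed L B R m)
    (s : Store (Fin n ⊕ Work k L B Z) (BitVec w)) : Store (Fin n ⊕ Work k L B Z) (BitVec w) :=
  match i with
  | .inl i => (Function.update s.1 (ctr (some i)) (BitVec.ofNat w (shifted r.1)),
      s.2 ++ [(ctr (some i), true)])
  | .inr x => (Function.update s.1 (arr (slot x))
      (cd.word (sourceType m x (s.1 (source x))) r.2),
      s.2 ++ [(source x, false), (arr (slot x), true)])

theorem den_seedProg (μ : PMF (Seed L B R m)) (i : Fin k ⊕ Elem n k R)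
    (s : Store (Fin n ⊕ Work k L B Z) (BitVec w)) :
    (seedProg cd slot i).den μ s = μ.map fun r => seedStep cd slot i r s := by
  rcases i with i | x
  · exact PMF.bind_pure_comp _ _
  · simp only [seedProg, Sum.elim_inr, elemProg, Prog.den, seedStep, List.append_assoc,
      List.cons_append, List.nil_append]
    exact PMF.bind_pure_comp _ _

/-- The accesses of the randomized part. -/
def seedTrace : List ((Fin n ⊕ Work k L B Z) × Bool) :=
  (List.finRange k).flatMap (fun i => [(ctr (some i), true)]) ++
    (Finset.univ : Finset (Elem n k R)).toList.flatMap
      fun x => [(source x, false), (arr (slot x), true)]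

/-- The type of an element. -/
def elemType (m : ℕ) (D : Database n k) (z : Fin k → ℕ) : Elem n k R → Option (Fin k)
  | .inl j => some (D j)
  | .inr (i, d) => if d.val < z i / m then some i else none

/-- The shifted noise for type `i`. -/
def noiseOf (ω : Fin k ⊕ Elem n k R → Seed L B R m) (i : Fin k) : ℕ := shifted (ω (.inl i)).1

/-- The word of an element. -/
def elemWord (D : Database n k) (ω : Fin k ⊕ Elem n k R → Seed L B R m) (x : Elem n k R) :
    BitVec w :=
  cd.word (elemType m D (noiseOf ω) x) (ω (.inr x)).2

/-- The content of the main array before the elements are routed. -/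
def initArr (D : Database n k) (ω : Fin k ⊕ Elem n k R → Seed L B R m) :
    (Fin L → Fin B) × Fin Z → BitVec w :=
  Function.extend slot (elemWord cd D ω) fun _ => 0

/-- The content of the main array after the elements have been routed. -/
def finalArr (D : Database n k) (ω : Fin k ⊕ Elem n k R → Seed L B R m) :
    (Fin L → Fin B) × Fin Z → BitVec w :=
  (List.range L).foldl (fun A l => level 0 cd.lab l A) (initArr cd slot D ω)

/-- While the array is being filled, the source cells are not overwritten, so the successive writes
amount to one extension along `slot`. The addresses are fixed by `slot`, so the pattern involves
neither `D` nor `ω`. -/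
theorem foldl_seedStep (hslot : Function.Injective slot) (hk : k ≤ 2 ^ w)
    (hw : 2 * (R * m) < 2 ^ w) (D : Database n k) (ω : Fin k ⊕ Elem n k R → Seed L B R m) :
    let s := (seedList n k R).foldl (fun s i => seedStep cd slot i (ω i) s)
      ((inputStore w (Work k L B Z) D, []) : Store (Fin n ⊕ Work k L B Z) (BitVec w))
    s.2 = seedTrace slot ∧ getArr s.1 = initArr cd slot D ω ∧
      ∀ i, s.1 (ctr (some i)) = BitVec.ofNat w (noiseOf ω i) := by
  intro s
  set y₀ := inputStore w (Work k L B Z) D with hy₀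
  set y₁ := (List.finRange k).foldl (fun (y : Fin n ⊕ Work k L B Z → BitVec w) i =>
    Function.update y (ctr (some i)) (BitVec.ofNat w (noiseOf ω i))) y₀ with hy₁
  have hs : s = ((Finset.univ : Finset (Elem n k R)).toList.foldl
      (fun (y : Fin n ⊕ Work k L B Z → BitVec w) x => Function.update y (arr (slot x))
        (cd.word (sourceType m x (y (source x))) (ω (.inr x)).2)) y₁, seedTrace slot) := by
    simp only [s, seedList, List.foldl_append, List.foldl_map]
    have h1 := foldl_store (fun i (y : Fin n ⊕ Work k L B Z → BitVec w) =>
      Function.update y (ctr (some i)) (BitVec.ofNat w (noiseOf ω i)))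
      (fun i => [((ctr (some i) : Fin n ⊕ Work k L B Z), true)]) (List.finRange k) (y₀, [])
    have h2 := foldl_store (fun (x : Elem n k R) (y : Fin n ⊕ Work k L B Z → BitVec w) =>
      Function.update y (arr (slot x))
        (cd.word (sourceType m x (y (source x))) (ω (.inr x)).2))
      (fun x => [(source x, false), (arr (slot x), true)])
      (Finset.univ : Finset (Elem n k R)).toList (y₁, [] ++ (List.finRange k).flatMap
        fun i => [((ctr (some i) : Fin n ⊕ Work k L B Z), true)])
    refine Eq.trans (congrArg (fun t => List.foldl _ t _) h1) (h2.trans ?_)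
    rw [List.nil_append, seedTrace]
  have hctr : Function.Injective fun i : Fin k => (ctr (some i) : Fin n ⊕ Work k L B Z) :=
    fun i j h => Option.some.inj (ctr_injective h)
  obtain ⟨h1, h2⟩ := foldl_update (fun i : Fin k => (ctr (some i) : Fin n ⊕ Work k L B Z)) hctr
    (fun i _ => BitVec.ofNat w (noiseOf ω i)) (fun _ _ _ _ => rfl) (List.finRange k)
    (List.nodup_finRange k) y₀
  obtain ⟨h3, h4⟩ := foldl_update (fun x : Elem n k R => (arr (slot x) : Fin n ⊕ Work k L B Z))
    (arr_injective.comp hslot)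
    (fun x y => cd.word (sourceType m x (y (source x))) (ω (.inr x)).2) (fun x y y' h => by
      rw [h (source x) fun x' _ => ?_]
      rcases x with j | ⟨i, d⟩
      · exact inl_ne_arr _ _
      · exact (arr_ne_ctr _ _).symm) (Finset.univ : Finset (Elem n k R)).toList
    (Finset.nodup_toList _) y₁
  have h5 : ∀ i, y₁ (ctr (some i)) = BitVec.ofNat w (noiseOf ω i) := fun i =>
    h1 i (List.mem_finRange i)
  rw [hs]
  refine ⟨rfl, funext fun c => ?_, fun i => ?_⟩
  · by_cases hc : ∃ x, slot x = c
    · obtain ⟨x, rfl⟩ := hc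
      dsimp only [getArr]
      rw [initArr, hslot.extend_apply, h3 x (by simp), elemWord]
      congr 1
      rcases x with j | ⟨i, d⟩
      · have h6 : y₁ (Sum.inl j) = BitVec.ofNat w (D j) := h2 _ fun i _ => inl_ne_ctr _ _
        rw [source, Sum.elim_inl, h6, sourceType, elemType, decType_ofNat hk]
      · have h7 : noiseOf ω i < 2 ^ w := (shifted_le _).trans_lt hw
        rw [source, Sum.elim_inr, h5, sourceType, elemType, BitVec.toNat_ofNat,
          Nat.mod_eq_of_lt h7]
    · dsimp only [getArr]
      rw [initArr, Function.extend_apply' _ _ _ hc, h4 _ fun x _ h =>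
        hc ⟨x, (arr_injective h).symm⟩, hy₁, h2 _ fun i _ => arr_ne_ctr _ _]
      rfl
  · dsimp only
    rw [h4 _ fun x _ => (arr_ne_ctr _ _).symm, h5]

theorem den_initProgs (μ : PMF (Seed L B R m)) :
    ∃ tr : List ((Fin n ⊕ Work k L B Z) × Bool),
      ∀ s : Store (Fin n ⊕ Work k L B Z) (BitVec w), ∃ y : Fin n ⊕ Work k L B Z → BitVec w,
        (Prog.seqList ((List.finRange k).map initProg)).den μ s = PMF.pure (y, s.2 ++ tr) ∧
        getArr y = getArr s.1 ∧ ∀ i, y (ctr (some i)) =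
          BitVec.ofInt w (((s.1 (ctr (some i))).toNat % m : ℕ) - (R * m : ℕ)) := by
  refine ⟨(List.finRange k).flatMap fun i => [(ctr (some i), false), (ctr (some i), true)],
    fun s => ⟨(List.finRange k).foldl (fun y i => Function.update y (ctr (some i))
      (BitVec.ofInt w (((y (ctr (some i))).toNat % m : ℕ) - (R * m : ℕ)))) s.1, ?_, ?_⟩⟩
  · rw [Prog.den_seqList_pure μ _ (fun i s => (Function.update s.1 (ctr (some i))
      (BitVec.ofInt w (((s.1 (ctr (some i))).toNat % m : ℕ) - (R * m : ℕ))),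
        s.2 ++ [(ctr (some i), false), (ctr (some i), true)])) fun i s => by
          simp [initProg, Prog.den]]
    congr 1
    exact foldl_store (fun i y => Function.update y (ctr (some i))
      (BitVec.ofInt w (((y (ctr (some i))).toNat % m : ℕ) - (R * m : ℕ)))) _ _ _
  · have hctr : Function.Injective fun i : Fin k => (ctr (some i) : Fin n ⊕ Work k L B Z) :=
      fun i j h => Option.some.inj (ctr_injective h)
    obtain ⟨h1, h2⟩ := foldl_update (fun i : Fin k => (ctr (some i) : Fin n ⊕ Work k L B Z)) hctr
      (fun i y => BitVec.ofInt w (((y (ctr (some i))).toNat % m : ℕ) - (R * m : ℕ)))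
      (fun i y y' h => by rw [h _ fun j hj h => hj (hctr h).symm]) (List.finRange k)
      (List.nodup_finRange k) s.1
    exact ⟨funext fun c => h2 _ fun i _ => arr_ne_ctr _ _, fun i => h1 i (List.mem_finRange i)⟩

/-- The accesses of the final scan. -/
def scanTrace (A : (Fin L → Fin B) × Fin Z → BitVec w)
    (cs : List ((Fin L → Fin B) × Fin Z)) : List ((Fin n ⊕ Work k L B Z) × Bool) :=
  cs.flatMap fun c => [(arr c, false), (ctr (cd.typ (A c)), false), (ctr (cd.typ (A c)), true)]

/-- These are the only accesses that depend on the data, and they show only the types in the array.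
The scan writes only to counters, so `A` stays fixed throughout. -/
theorem den_scanProgs (μ : PMF (Seed L B R m)) (A : (Fin L → Fin B) × Fin Z → BitVec w)
    (cs : List ((Fin L → Fin B) × Fin Z)) (s : Store (Fin n ⊕ Work k L B Z) (BitVec w))
    (hs : getArr s.1 = A) :
    ∃ y : Fin n ⊕ Work k L B Z → BitVec w,
      (Prog.seqList (cs.map (scanProg cd))).den μ s = PMF.pure (y, s.2 ++ scanTrace cd A cs) ∧
      ∀ t, y (ctr t) = s.1 (ctr t) +
        BitVec.ofNat w (m * cs.countP fun c => cd.typ (A c) = t) := by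
  induction cs generalizing s with
  | nil => exact ⟨s.1, by simp [Prog.seqList, Prog.den, scanTrace], by simp⟩
  | cons c cs ih =>
    obtain ⟨t₀, ht₀⟩ : ∃ t, t = cd.typ (A c) := ⟨_, rfl⟩
    have hc : s.1 (arr c) = A c := congrFun hs c
    obtain ⟨y, hy1, hy2⟩ := ih (Function.update s.1 (ctr t₀) (s.1 (ctr t₀) + BitVec.ofNat w m),
      s.2 ++ [(arr c, false), (ctr t₀, false), (ctr t₀, true)]) (by
        rw [← hs]
        funext c'
        exact Function.update_of_ne (arr_ne_ctr c' t₀) (s.1 (ctr t₀) + BitVec.ofNat w m) s.1)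
    refine ⟨y, ?_, fun t => ?_⟩
    · rw [List.map_cons, Prog.seqList, Prog.den_seq]
      have : (scanProg (n := n) (R := R) (m := m) cd c).den μ s = PMF.pure
          (Function.update s.1 (ctr t₀) (s.1 (ctr t₀) + BitVec.ofNat w m),
            s.2 ++ [(arr c, false), (ctr t₀, false), (ctr t₀, true)]) := by
        simp [scanProg, Prog.den, hc, ht₀]
      rw [this, PMF.pure_bind, hy1]
      simp [scanTrace, ht₀]
    · rw [hy2, List.countP_cons]
      by_cases ht : t₀ = t
      · subst ht
        simp [← ht₀, BitVec.ofNat_add, mul_add]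
        ring
      · have : (ctr t : Fin n ⊕ Work k L B Z) ≠ ctr t₀ := fun h => ht (ctr_injective h).symm
        simp [← ht₀, ht, this]

/-- The bound on `z` ensures that `2 * R` dummies per type suffice for `z i / m` active ones. -/
theorem card_elemType_eq (D : Database n k) (z : Fin k → ℕ)
    (hz : ∀ i, z i ≤ 2 * (R * m)) (i : Fin k) :
    (Finset.univ.filter fun x : Elem n k R => elemType m D z x = some i).card =
      histogram D i + z i / m := by
  rw [Finset.card_filter, Fintype.sum_sum_type, Fintype.sum_prod_type, histogram,
    Finset.card_filter]
  congr 1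
  · simp [elemType]
  · rw [Finset.sum_eq_single i]
    · have h1 : z i / m ≤ 2 * R := by
        rw [← Nat.mul_assoc] at hz
        exact Nat.div_le_of_le_mul (by rw [Nat.mul_comm]; exact hz i)
      have h2 : ∀ d : Fin (2 * R), (if elemType (n := n) m D z (.inr (i, d)) = some i then 1 else 0)
          = if d.val < z i / m then 1 else 0 := by
        intro d
        by_cases h : d.val < z i / m <;> simp [elemType, h]
      rw [Finset.sum_congr rfl fun d _ => h2 d, ← Finset.card_filter]
      simp [Fin.card_filter_val_lt, h1]
    · intro j _ hj
      refine Finset.sum_eq_zero fun d _ => if_neg ?_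
      rw [elemType]
      split_ifs
      · simpa using hj
      · simp
    · simp

/-- All levels preserve multiplicities, with or without overflow, so the types can be counted in the
initial array, where empty cells have none. -/
theorem countP_finalArr (hslot : Function.Injective slot) (D : Database n k)
    (ω : Fin k ⊕ Elem n k R → Seed L B R m) (i : Fin k) :
    ((Finset.univ : Finset ((Fin L → Fin B) × Fin Z)).toList.countP fun c =>
      cd.typ (finalArr cd slot D ω c) = some i) = histogram D i + noiseOf ω i / m := by
  rw [← card_elemType_eq D (noiseOf ω) (fun i => shifted_le _) i]
  have h1 : ((Finset.univ : Finset ((Fin L → Fin B) × Fin Z)).toList.countP fun c =>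
      cd.typ (finalArr cd slot D ω c) = some i) =
      (Finset.univ.filter fun c => cd.typ (finalArr cd slot D ω c) = some i).card := by
    rw [← Multiset.coe_countP, Finset.coe_toList, Multiset.countP_eq_card_filter]
    rfl
  rw [h1, card_filter_congr_of_cnt_eq (x := finalArr cd slot D ω) (y := initArr cd slot D ω) (fun u => cd.typ u = some i)
    fun u _ => congrFun (cnt_levels 0 cd.lab _ _) u]
  refine (Finset.card_bij (fun x _ => slot x) (fun x hx => ?_) (fun x _ y _ h => hslot h)
    fun c hc => ?_).symm
  · simp only [Finset.mem_filter, Finset.mem_univ, true_and] at hx ⊢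
    rw [initArr, hslot.extend_apply, elemWord, cd.typ_word, hx]
  · simp only [Finset.mem_filter, Finset.mem_univ, true_and] at hc
    by_cases h : ∃ x, slot x = c
    · obtain ⟨x, rfl⟩ := h
      rw [initArr, hslot.extend_apply, elemWord, cd.typ_word] at hc
      exact ⟨x, by simpa using hc, rfl⟩
    · rw [initArr, Function.extend_apply' _ _ _ h, cd.typ_zero] at hc
      simp at hc

/-- The result of the algorithm as a function of the seeds. -/
theorem den_mainProg (hslot : Function.Injective slot) (hk : k ≤ 2 ^ w)
    (hw : 2 * (R * m) < 2 ^ w) (p : Seed L B R m → ℝ) (hp : ∀ x, 0 ≤ p x)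
    (h1 : ∑ x, p x = 1) :
    ∃ (tr : List ((Fin n ⊕ Work k L B Z) × Bool))
      (F : Database n k → (Fin k ⊕ Elem n k R → Seed L B R m) →
        Store (Fin n ⊕ Work k L B Z) (BitVec w)), ∀ D : Database n k,
      (mainProg cd slot).den (weightPMF p hp h1) (inputStore w (Work k L B Z) D, []) =
        (seedsPMF p hp h1 _).map (F D) ∧
      ∀ ω, (F D ω).2 = tr ++ scanTrace cd (finalArr cd slot D ω) Finset.univ.toList ∧
        ∀ i, (F D ω).1 (ctr (some i)) =
          BitVec.ofInt w (m * histogram D i + noiseOf ω i - (R * m : ℕ)) := by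
  obtain ⟨tr₁, hinit⟩ := den_initProgs (n := n) (Z := Z) (w := w) (k := k) (weightPMF p hp h1)
  obtain ⟨tr₂, hlev⟩ := den_levels (weightPMF p hp h1) n k Z cd (List.range L)
  have key : ∀ (D : Database n k) (ω : Fin k ⊕ Elem n k R → Seed L B R m),
      ∃ s' : Store (Fin n ⊕ Work k L B Z) (BitVec w),
      ((Prog.seqList ((List.finRange k).map initProg)).seq
        ((Prog.seqList ((List.range L).map (levelProg cd))).seq
          (Prog.seqList (Finset.univ.toList.map (scanProg cd))))).den (weightPMF p hp h1)
        ((seedList n k R).foldl (fun s i => seedStep cd slot i (ω i) s)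
          (inputStore w (Work k L B Z) D, [])) = PMF.pure s' ∧
      s'.2 = (seedTrace slot ++ tr₁ ++ tr₂) ++
        scanTrace cd (finalArr cd slot D ω) Finset.univ.toList ∧
      ∀ i, s'.1 (ctr (some i)) =
        BitVec.ofInt w (m * histogram D i + noiseOf ω i - (R * m : ℕ)) := by
    intro D ω
    obtain ⟨g1, g2, g3⟩ := foldl_seedStep (Z := Z) cd slot hslot hk hw D ω
    set s := (seedList n k R).foldl (fun s i => seedStep cd slot i (ω i) s)
      ((inputStore w (Work k L B Z) D, []) : Store (Fin n ⊕ Work k L B Z) (BitVec w))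
    obtain ⟨y, hy1, hy2, hy3⟩ := hinit s
    obtain ⟨y', hy1', hy2'⟩ := den_scanProgs cd (weightPMF p hp h1) (finalArr cd slot D ω)
      Finset.univ.toList (setArr y (finalArr cd slot D ω), s.2 ++ tr₁ ++ tr₂) (getArr_setArr _ _)
    refine ⟨(y', (seedTrace slot ++ tr₁ ++ tr₂) ++
      scanTrace cd (finalArr cd slot D ω) Finset.univ.toList), ?_, rfl, ?_⟩
    · rw [Prog.den_seq, hy1, PMF.pure_bind, Prog.den_seq, hlev, PMF.pure_bind]
      simp only [hy2, g2]
      rw [← g1]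
      exact hy1'
    · intro i
      have hlt : noiseOf ω i < 2 ^ w := (shifted_le _).trans_lt hw
      simp only [hy2', setArr_ctr, hy3, g3, BitVec.toNat_ofNat, Nat.mod_eq_of_lt hlt]
      rw [countP_finalArr cd slot hslot, ← BitVec.ofInt_natCast, ← BitVec.ofInt_add]
      congr 1
      -- The quotient of the noise by `m` was counted through dummies and the remainder was put into
      -- the counter; here they are reunited.
      have := Nat.div_add_mod (noiseOf ω i) m
      have h2 : (m : ℤ) * ((noiseOf ω i / m : ℕ) : ℤ) + ((noiseOf ω i % m : ℕ) : ℤ) =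
          noiseOf ω i := by exact_mod_cast this
      rw [Nat.cast_mul m, Nat.cast_add, ← h2]
      ring
  choose F hF1 hF2 using key
  refine ⟨seedTrace slot ++ tr₁ ++ tr₂, F, fun D => ⟨?_, hF2 D⟩⟩
  have hnodup : (seedList n k R).Nodup := by
    rw [seedList, List.nodup_append]
    refine ⟨(List.nodup_finRange k).map Sum.inl_injective,
      (Finset.nodup_toList _).map Sum.inr_injective, ?_⟩
    intro a ha b hb
    obtain ⟨i, -, rfl⟩ := List.mem_map.1 ha
    obtain ⟨x, -, rfl⟩ := List.mem_map.1 hb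
    simp
  rw [mainProg, Prog.den_seq, den_seqList_seeds p hp h1 _ _
    (fun i s => den_seedProg cd slot _ i s) _ hnodup, PMF.bind_map]
  simp only [Function.comp_def, hF1]
  exact PMF.bind_pure_comp _ _

end Main

/-! ### Truncated geometric noise -/

section Noise

/-- The truncated geometric distribution on `{0, …, N}`. -/
def geo (q : ℝ) (N s : ℕ) : ℝ := if s < N then q ^ s - q ^ (s + 1) else q ^ N

theorem geo_nonneg {q : ℝ} (hq : 0 ≤ q) (hq1 : q ≤ 1) (N s : ℕ) : 0 ≤ geo q N s := by
  rw [geo]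
  split_ifs
  · exact sub_nonneg.2 (pow_le_pow_of_le_one hq hq1 (Nat.le_succ s))
  · exact pow_nonneg hq N

/-- The sum telescopes. The point `N` carries the whole truncated tail `q ^ N`, so tails up to `N`
are those of the untruncated distribution. -/
theorem sum_geo (q : ℝ) {N u : ℕ} (hu : u ≤ N) :
    ∑ s : Fin (N + 1), (if u ≤ s.val then geo q N s else 0) = q ^ u := by
  rw [Fin.sum_univ_eq_sum_range (fun s => if u ≤ s then geo q N s else 0) (N + 1),
    Finset.sum_range_succ, if_pos hu, geo, if_neg (lt_irrefl N)]
  have h : ∀ M, u ≤ M → M ≤ N →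
      ∑ s ∈ Finset.range M, (if u ≤ s then geo q N s else 0) = q ^ u - q ^ M := by
    intro M hM
    induction M, hM using Nat.le_induction with
    | base =>
      intro _
      rw [sub_self]
      exact Finset.sum_eq_zero fun s hs => if_neg (by simpa using hs)
    | succ M hM ih =>
      intro hMN
      rw [Finset.sum_range_succ, ih (Nat.le_of_succ_le hMN), if_pos hM, geo,
        if_pos (Nat.lt_of_succ_le hMN)]
      ring
  rw [h N hu le_rfl]
  ring

variable {L B R m : ℕ}

/-- The weight of a noise value: the sign is uniform and the absolute value is geometric. -/
def noiseWeight (q : ℝ) (x : Bool × Fin (R * m + 1)) : ℝ := geo q (R * m) x.2 / 2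

/-- The weight of a seed: the label is uniform. -/
def seedWeight (L B : ℕ) (q : ℝ) (x : Seed L B R m) : ℝ := noiseWeight q x.1 / (B : ℝ) ^ L

variable {q : ℝ} (hq : 0 ≤ q) (hq1 : q ≤ 1)

include hq hq1 in
theorem seedWeight_nonneg (x : Seed L B R m) : 0 ≤ seedWeight L B q x :=
  div_nonneg (div_nonneg (geo_nonneg hq hq1 _ _) zero_le_two) (by positivity)

theorem mass_seedWeight_noise [NeZero B] (S : Set (Fin (R * m + 1))) :
    mass (seedWeight L B q) {x : Seed L B R m | x.1.2 ∈ S} =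
      ∑ s : Fin (R * m + 1), S.indicator (fun s => geo q (R * m) s.val) s := by
  have hB : ((B : ℝ) ^ L) ≠ 0 := pow_ne_zero _ (Nat.cast_ne_zero.2 (NeZero.ne B))
  rw [mass, Fintype.sum_prod_type, Fintype.sum_prod_type, Fintype.sum_bool, ← Finset.sum_add_distrib]
  refine Finset.sum_congr rfl fun s _ => ?_
  by_cases hs : s ∈ S
  · simp [hs, seedWeight, noiseWeight]
    field_simp
    ring
  · simp [hs]

theorem sum_seedWeight [NeZero B] : ∑ x : Seed L B R m, seedWeight L B q x = 1 := by
  have h1 := mass_seedWeight_noise (L := L) (B := B) (q := q) (R := R) (m := m) Set.univ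
  have h2 := sum_geo q (Nat.zero_le (R * m))
  simp only [Nat.zero_le, if_true, pow_zero] at h2
  simp only [Set.mem_univ, Set.ofPred_true, mass_univ, Set.indicator_univ] at h1
  rw [h1, h2]

include hq hq1 in
theorem mass_seedWeight_tail_le [NeZero B] (u : ℕ) :
    mass (seedWeight L B q) {x : Seed L B R m | u ≤ x.1.2.val} ≤ q ^ u := by
  have h1 := mass_seedWeight_noise (L := L) (B := B) (q := q) (R := R) (m := m)
    {s | u ≤ s.val}
  simp only [Set.mem_ofPred_eq] at h1
  rw [h1]
  rcases le_or_gt u (R * m) with hu | hu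
  · rw [← sum_geo q hu]
    exact le_of_eq (Finset.sum_congr rfl fun s _ => by simp [Set.indicator_apply])
  · refine le_trans (le_of_eq (Finset.sum_eq_zero fun s _ => ?_)) (pow_nonneg hq u)
    rw [Set.indicator_of_notMem]
    have := s.isLt
    simp only [Set.mem_ofPred_eq]
    omega

theorem mass_seedWeight_zero [NeZero B] (hN : 0 < R * m) :
    mass (seedWeight L B q) {x : Seed L B R m | x.1.2.val = 0} = 1 - q := by
  have h1 := mass_seedWeight_noise (L := L) (B := B) (q := q) (R := R) (m := m)
    {s | s.val = 0}
  simp only [Set.mem_ofPred_eq] at h1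
  rw [h1, Finset.sum_eq_single (0 : Fin (R * m + 1))]
  · simp [geo, hN]
  · intro s _ hs
    rw [Set.indicator_of_notMem]
    exact fun h => hs (Fin.ext h)
  · simp

theorem mass_seedWeight_label (T : Set (Fin L → Fin B)) [DecidablePred (· ∈ T)] :
    mass (seedWeight L B q) {x : Seed L B R m | x.2 ∈ T} =
      (Finset.univ.filter (· ∈ T)).card / (B : ℝ) ^ L := by
  have h2 := sum_geo q (Nat.zero_le (R * m))
  simp only [Nat.zero_le, if_true, pow_zero] at h2
  have h3 : ∑ x : Bool × Fin (R * m + 1), noiseWeight q x = 1 := by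
    rw [Fintype.sum_prod_type, Fintype.sum_bool, ← Finset.sum_add_distrib, ← h2]
    exact Finset.sum_congr rfl fun s _ => by simp only [noiseWeight]; ring
  rw [mass, Fintype.sum_prod_type]
  have h4 : ∀ x : Bool × Fin (R * m + 1), ∑ r : Fin L → Fin B,
      Set.indicator {x : Seed L B R m | x.2 ∈ T} (seedWeight L B q) (x, r) =
        noiseWeight q x * ((Finset.univ.filter (· ∈ T)).card / (B : ℝ) ^ L) := by
    intro x
    have h5 : ∀ r : Fin L → Fin B,
        Set.indicator {x : Seed L B R m | x.2 ∈ T} (seedWeight L B q) (x, r) =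
          if r ∈ T then noiseWeight q x / (B : ℝ) ^ L else 0 := by
      intro r
      by_cases hr : r ∈ T <;> simp [hr, seedWeight]
    rw [Finset.sum_congr rfl fun r _ => h5 r, ← Finset.sum_filter, Finset.sum_const, nsmul_eq_mul]
    ring
  rw [Finset.sum_congr rfl fun x _ => h4 x, ← Finset.sum_mul, h3, one_mul]

end Noise

/-! ### Overflow probability -/

section Overflow

variable {n k L B Z R m Z₀ : ℕ} {q : ℝ}

theorem card_cylinder (P : Fin L → Prop) [DecidablePred P] (b : Fin L → Fin B) :
    (Finset.univ.filter fun b' : Fin L → Fin B => ∀ j, P j → b' j = b j).card =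
      B ^ (Finset.univ.filter fun j => ¬ P j).card := by
  have h : (Finset.univ.filter fun b' : Fin L → Fin B => ∀ j, P j → b' j = b j) =
      Fintype.piFinset fun j => if P j then {b j} else Finset.univ := by
    ext b'
    simp only [Finset.mem_filter, Finset.mem_univ, true_and, Fintype.mem_piFinset]
    refine forall_congr' fun j => ?_
    by_cases hj : P j <;> simp [hj]
  rw [h, Fintype.card_piFinset]
  have h2 : ∀ j, (if P j then ({b j} : Finset (Fin B)) else Finset.univ).card =
      if P j then 1 else B := by
    intro j
    by_cases hj : P j <;> simp [hj]
  rw [Finset.prod_congr rfl fun j _ => h2 j, Finset.prod_ite]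
  simp

theorem card_ge_level {l : ℕ} (hl : l ≤ L) :
    (Finset.univ.filter fun j : Fin L => ¬ l ≤ j.val).card = l := by
  simp [Fin.card_filter_val_lt, hl]

theorem card_lt_level (l : ℕ) :
    (Finset.univ.filter fun j : Fin L => ¬ j.val < l).card = L - l := by
  have h := Finset.card_filter_add_card_filter_not (s := (Finset.univ : Finset (Fin L)))
    fun j : Fin L => j.val < l
  rw [Fin.card_filter_val_lt, Finset.card_univ, Fintype.card_fin] at h
  omega

open Classical in
/-- Some bucket receives more elements than it has cells. -/
def Overflow {E : Type} [Fintype E] (Z : ℕ) (pos : E → Fin L → Fin B) (r : E → Fin L → Fin B) :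
    Prop :=
  ∃ l ≤ L, ∃ b : Fin L → Fin B, Z < (Finset.univ.filter fun x =>
    (∀ j : Fin L, l ≤ j.val → pos x j = b j) ∧ ∀ j : Fin L, j.val < l → r x j = b j).card

open Classical in
-- After `l` levels only the elements from `B ^ l` initial buckets, at most `Z₀ * B ^ l` in number,
-- can be in a given bucket, and each is there with probability `B ^ (-l)`. A union bound over sets
-- of `Z + 1` such elements cancels the powers of `B`; a second one runs over levels and buckets.
theorem mass_overflow_le {E ι : Type} [Fintype E] [Fintype ι] [DecidableEq ι] [NeZero B]
    (hq : 0 ≤ q) (hq1 : q ≤ 1) (pos : E → Fin L → Fin B) (idx : E ↪ ι)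
    (hpos : ∀ b, (Finset.univ.filter fun x => pos x = b).card ≤ Z₀) :
    mass (prodWeight ι (seedWeight (R := R) (m := m) L B q))
      {ω | Overflow Z pos fun x => (ω (idx x)).2} ≤
      (L + 1) * (B ^ L : ℕ) * ((Z₀ : ℝ) ^ (Z + 1) / (Z + 1).factorial) := by
  have hp := seedWeight_nonneg (L := L) (B := B) (R := R) (m := m) hq hq1
  have hp' := prodWeight_nonneg (ι := ι) hp
  have hB : (0 : ℝ) < B := Nat.cast_pos.2 (NeZero.pos B)
  set Q := Z + 1 with hQ
  have key : ∀ l ≤ L, ∀ b : Fin L → Fin B,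
      mass (prodWeight ι (seedWeight (R := R) (m := m) L B q)) {ω | Q ≤ (Finset.univ.filter fun x =>
        (∀ j : Fin L, l ≤ j.val → pos x j = b j) ∧
          ∀ j : Fin L, j.val < l → (ω (idx x)).2 j = b j).card} ≤
        (Z₀ : ℝ) ^ Q / Q.factorial := by
    intro l hl b
    set cand : Finset E := Finset.univ.filter fun x => ∀ j : Fin L, l ≤ j.val → pos x j = b j
      with hcand
    set T : Set (Fin L → Fin B) := {r | ∀ j : Fin L, j.val < l → r j = b j} with hT
    have hcard : cand.card ≤ Z₀ * B ^ l := by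
      have h1 := Finset.card_le_mul_card_image_of_maps_to (f := pos) (s := cand)
        (t := Finset.univ.filter fun b' : Fin L → Fin B => ∀ j : Fin L, l ≤ j.val → b' j = b j)
        (fun x hx => by simpa [hcand] using hx) Z₀ fun b' _ =>
          (Finset.card_le_card fun x hx => by
            simpa using (Finset.mem_filter.1 hx).2).trans (hpos b')
      rwa [card_cylinder (fun j : Fin L => l ≤ j.val), card_ge_level hl] at h1
    have hTm : mass (seedWeight L B q) {x : Seed L B R m | x.2 ∈ T} = 1 / (B : ℝ) ^ l := by
      have h1 := card_cylinder (fun j : Fin L => j.val < l) b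
      rw [card_lt_level] at h1
      classical
      rw [mass_seedWeight_label]
      have h2 : (Finset.univ.filter (· ∈ T)).card = B ^ (L - l) := by
        convert h1
        exact Iff.rfl
      rw [h2, Nat.cast_pow, div_eq_div_iff (by positivity) (by positivity), one_mul, ← pow_add,
        Nat.sub_add_cancel hl]
    have hsub : {ω : ι → Seed L B R m | Q ≤ (Finset.univ.filter fun x =>
        (∀ j : Fin L, l ≤ j.val → pos x j = b j) ∧
          ∀ j : Fin L, j.val < l → (ω (idx x)).2 j = b j).card} ⊆
        {ω | ∃ S ∈ Finset.powersetCard Q cand,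
          ω ∈ {ω : ι → Seed L B R m | ∀ i ∈ S.map idx, ω i ∈ {x : Seed L B R m | x.2 ∈ T}}} := by
      intro ω hω
      obtain ⟨S, hS, hSQ⟩ := Finset.exists_subset_card_eq hω
      refine ⟨S, Finset.mem_powersetCard.2 ⟨fun x hx => ?_, hSQ⟩, fun i hi => ?_⟩
      · exact Finset.mem_filter.2 ⟨Finset.mem_univ _, (Finset.mem_filter.1 (hS hx)).2.1⟩
      · obtain ⟨x, hx, rfl⟩ := Finset.mem_map.1 hi
        exact (Finset.mem_filter.1 (hS hx)).2.2
    refine (mass_mono hp' hsub).trans ((mass_biUnion_le hp' _ _).trans ?_)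
    have h3 : ∀ S ∈ Finset.powersetCard Q cand,
        mass (prodWeight ι (seedWeight (R := R) (m := m) L B q))
          {ω : ι → Seed L B R m | ∀ i ∈ S.map idx, ω i ∈ {x : Seed L B R m | x.2 ∈ T}} =
          (1 / (B : ℝ) ^ l) ^ Q := by
      intro S hS
      rw [mass_prodWeight_forall sum_seedWeight, Finset.prod_const, hTm, Finset.card_map,
        (Finset.mem_powersetCard.1 hS).2]
    rw [Finset.sum_congr rfl h3, Finset.sum_const, Finset.card_powersetCard, nsmul_eq_mul]
    calc (cand.card.choose Q : ℝ) * (1 / (B : ℝ) ^ l) ^ Q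
        ≤ ((cand.card : ℝ) ^ Q / Q.factorial) * (1 / (B : ℝ) ^ l) ^ Q := by
          gcongr
          exact Nat.choose_le_pow_div Q cand.card
      _ ≤ (((Z₀ : ℝ) * (B : ℝ) ^ l) ^ Q / Q.factorial) * (1 / (B : ℝ) ^ l) ^ Q := by
          gcongr
          exact_mod_cast hcard
      _ = (Z₀ : ℝ) ^ Q / Q.factorial := by
          rw [mul_pow, one_div, inv_pow]
          field_simp
  have hsub : {ω : ι → Seed L B R m | Overflow Z pos fun x => (ω (idx x)).2} ⊆
      {ω | ∃ y ∈ Finset.range (L + 1) ×ˢ (Finset.univ : Finset (Fin L → Fin B)),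
        ω ∈ {ω : ι → Seed L B R m | Q ≤ (Finset.univ.filter fun x =>
          (∀ j : Fin L, y.1 ≤ j.val → pos x j = y.2 j) ∧
            ∀ j : Fin L, j.val < y.1 → (ω (idx x)).2 j = y.2 j).card}} := by
    rintro ω ⟨l, hl, b, hb⟩
    exact ⟨(l, b), by simpa using Nat.lt_succ_of_le hl, hb⟩
  refine (mass_mono hp' hsub).trans ((mass_biUnion_le hp' _ _).trans ?_)
  refine (Finset.sum_le_card_nsmul _ _ ((Z₀ : ℝ) ^ Q / Q.factorial) fun y hy => ?_).trans ?_
  · have := (Finset.mem_product.1 hy).1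
    exact key y.1 (Nat.lt_succ_iff.1 (Finset.mem_range.1 this)) y.2
  · rw [Finset.card_product, Finset.card_range, Finset.card_univ, Fintype.card_fun,
      Fintype.card_fin, Fintype.card_fin, nsmul_eq_mul]
    push_cast
    exact le_rfl

end Overflow

/-! ### Matching the seeds of neighboring databases -/

section Matching

variable {n k L B Z R m w : ℕ} [NeZero k] [NeZero B]

/-- Permutes the labels of the elements. -/
def relabel (π : (Fin k → ℕ) → Equiv.Perm (Elem n k R))
    (ω : Fin k ⊕ Elem n k R → Seed L B R m) : Fin k ⊕ Elem n k R → Seed L B R m :=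
  Sum.elim (fun i => ω (.inl i)) fun x => ((ω (.inr x)).1, (ω (.inr (π (noiseOf ω) x))).2)

/-- The permutation depends only on the noise, which relabeling preserves, so it can be read off the
result and undone. -/
theorem relabel_injective (π : (Fin k → ℕ) → Equiv.Perm (Elem n k R)) :
    Function.Injective (relabel (L := L) (B := B) (m := m) π) := by
  intro ω ω' h
  have h1 : ∀ i, ω (.inl i) = ω' (.inl i) := fun i => congrFun h (.inl i)
  have h2 : noiseOf ω = noiseOf ω' := funext fun i => by rw [noiseOf, noiseOf, h1]
  have h3 : ∀ x, relabel π ω (.inr x) = relabel π ω' (.inr x) := fun x => congrFun h (.inr x)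
  simp only [relabel, Sum.elim_inr, h2, Prod.mk.injEq] at h3
  funext i
  rcases i with i | x
  · exact h1 i
  · refine Prod.ext (h3 x).1 ?_
    have := (h3 ((π (noiseOf ω')).symm x)).2
    rwa [Equiv.apply_symm_apply] at this

/-- Labels are uniform: the weight of a seed depends only on its noise component, which stays in
place. -/
theorem prodWeight_relabel (q : ℝ) (π : (Fin k → ℕ) → Equiv.Perm (Elem n k R))
    (ω : Fin k ⊕ Elem n k R → Seed L B R m) :
    prodWeight _ (seedWeight L B q) (relabel π ω) = prodWeight _ (seedWeight L B q) ω := by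
  rw [prodWeight, prodWeight, Fintype.prod_sum_type,
    Fintype.prod_sum_type fun i => seedWeight L B q (ω i)]
  congr 1

/-- The noise with a given shifted value. -/
def ofShifted (R m z : ℕ) : Bool × Fin (R * m + 1) :=
  if R * m ≤ z then (true, ⟨min (z - R * m) (R * m), by omega⟩)
  else (false, ⟨R * m - z, by omega⟩)

theorem shifted_ofShifted {z : ℕ} (hz : z ≤ 2 * (R * m)) : shifted (ofShifted R m z) = z := by
  rw [ofShifted]
  split_ifs with h
  · simp only [shifted, if_true]
    omega
  · simp only [shifted]
    simp
    omega

/-- Zero is the only noise value with two representations, one for each sign. This is why zero noise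
has to be counted among the bad seeds. -/
theorem shifted_injOn {x y : Bool × Fin (R * m + 1)} (hx : 0 < x.2.val) (hy : 0 < y.2.val)
    (h : shifted x = shifted y) : x = y := by
  obtain ⟨b, s⟩ := x
  obtain ⟨c, t⟩ := y
  have hs := s.isLt
  have ht := t.isLt
  simp only [shifted] at *
  cases b <;> cases c <;> simp at h ⊢ <;> (try apply Fin.ext) <;> omega

theorem shifted_add_le {x : Bool × Fin (R * m + 1)} (hx : x.2.val + m < R * m) :
    shifted x + m ≤ 2 * (R * m) := by
  rw [shifted]
  split_ifs <;> omega

theorem le_shifted {x : Bool × Fin (R * m + 1)} (hx : x.2.val + m < R * m) : m ≤ shifted x := by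
  rw [shifted]
  split_ifs <;> omega

theorem ofShifted_add_le (x : Bool × Fin (R * m + 1)) :
    (ofShifted R m (shifted x + m)).2.val ≤ x.2.val + m := by
  rw [ofShifted, shifted]
  split_ifs <;> simp only <;> omega

theorem ofShifted_sub_le (x : Bool × Fin (R * m + 1)) :
    (ofShifted R m (shifted x - m)).2.val ≤ x.2.val + m := by
  rw [ofShifted, shifted]
  split_ifs <;> simp only <;> omega

/-- Below the truncation point the weights are proportional to `q ^ s`, so a change of the absolute
value by at most `m` costs at most `q ^ (-m) = c`. -/
theorem noiseWeight_le {q c : ℝ} (hq : 0 ≤ q) (hq1 : q ≤ 1) (hc : c * q ^ m = 1)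
    {x y : Bool × Fin (R * m + 1)} (hx : x.2.val + m < R * m)
    (hy : y.2.val ≤ x.2.val + m) : noiseWeight q x ≤ c * noiseWeight q y := by
  have h1 : ∀ s, s < R * m → geo q (R * m) s = q ^ s * (1 - q) := fun s hs => by
    rw [geo, if_pos hs, pow_succ]
    ring
  have hc0 : 0 ≤ c := by
    by_contra h
    have : c * q ^ m ≤ 0 := mul_nonpos_of_nonpos_of_nonneg (not_le.1 h).le (pow_nonneg hq m)
    linarith
  rw [noiseWeight, noiseWeight, h1 _ (by omega), h1 _ (by omega)]
  have h2 : q ^ (x.2.val + m) ≤ q ^ y.2.val := pow_le_pow_of_le_one hq hq1 hy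
  have h3 : q ^ x.2.val = c * q ^ (x.2.val + m) := by
    rw [pow_add, mul_left_comm, hc, mul_one]
  have h4 : q ^ x.2.val ≤ c * q ^ y.2.val := by
    rw [h3]
    exact mul_le_mul_of_nonneg_left h2 hc0
  nlinarith [mul_le_mul_of_nonneg_right h4 (sub_nonneg.2 hq1)]

/-- Moves one unit of noise from type `b` to type `a`. -/
def shiftNoise (a b : Fin k) (ω : Fin k ⊕ Elem n k R → Seed L B R m) :
    Fin k ⊕ Elem n k R → Seed L B R m :=
  Sum.elim (fun i => (if i = a then ofShifted R m (noiseOf ω a + m)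
      else if i = b then ofShifted R m (noiseOf ω b - m) else (ω (.inl i)).1, (ω (.inl i)).2))
    fun x => ω (.inr x)

/-- The noise for type `i` is not zero and not close to the truncation. -/
def Interior (ω : Fin k ⊕ Elem n k R → Seed L B R m) (i : Fin k) : Prop :=
  0 < (ω (.inl i)).1.2.val ∧ (ω (.inl i)).1.2.val + m < R * m

/-- The shifted noise after one unit has moved from type `b` to type `a`. -/
def moveUnit (m : ℕ) (a b : Fin k) (z : Fin k → ℕ) (i : Fin k) : ℕ :=
  if i = a then z a + m else if i = b then z b - m else z i

theorem noiseOf_shiftNoise {a b : Fin k} {ω : Fin k ⊕ Elem n k R → Seed L B R m}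
    (ha : Interior ω a) : noiseOf (shiftNoise a b ω) = moveUnit m a b (noiseOf ω) := by
  funext i
  rw [noiseOf, shiftNoise, Sum.elim_inl, moveUnit]
  dsimp only
  split_ifs
  · exact shifted_ofShifted (shifted_add_le ha.2)
  · exact shifted_ofShifted ((Nat.sub_le _ _).trans (shifted_le _))
  · rfl

/-- The moved values determine the old ones, since the subtraction of `m` at `b` is not truncated,
and nonzero values determine their signs. -/
theorem shiftNoise_injOn (a b : Fin k) :
    Set.InjOn (shiftNoise (n := n) (L := L) (B := B) (R := R) (m := m) a b)
      {ω | Interior ω a ∧ Interior ω b} := by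
  rintro ω ⟨ha, hb⟩ ω' ⟨ha', hb'⟩ h
  have h1 : moveUnit m a b (noiseOf ω) = moveUnit m a b (noiseOf ω') := by
    rw [← noiseOf_shiftNoise ha, ← noiseOf_shiftNoise ha', h]
  funext i
  rcases i with i | x
  · have h2 := congrFun h (.inl i)
    have h3 := congrFun h1 i
    simp only [shiftNoise, Sum.elim_inl, Prod.mk.injEq] at h2
    rw [moveUnit, moveUnit] at h3
    refine Prod.ext ?_ h2.2
    by_cases hia : i = a
    · subst hia
      rw [if_pos rfl, if_pos rfl] at h3
      exact shifted_injOn ha.1 ha'.1 (Nat.add_right_cancel h3)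
    · by_cases hib : i = b
      · subst hib
        rw [if_neg hia, if_neg hia, if_pos rfl, if_pos rfl] at h3
        refine shifted_injOn hb.1 hb'.1 ?_
        have h4 := le_shifted hb.2
        have h5 := le_shifted hb'.2
        rw [noiseOf, noiseOf] at h3
        omega
      · simpa [hia, hib] using h2.1
  · exact congrFun h (.inr x)

/-- Two coordinates change, and each contributes one factor `c`. -/
theorem prodWeight_shiftNoise_le {q c : ℝ} (hq : 0 ≤ q) (hq1 : q ≤ 1) (hc : c * q ^ m = 1)
    {a b : Fin k} (hab : a ≠ b) {ω : Fin k ⊕ Elem n k R → Seed L B R m} (ha : Interior ω a)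
    (hb : Interior ω b) :
    prodWeight _ (seedWeight L B q) ω ≤
      c * c * prodWeight _ (seedWeight L B q) (shiftNoise a b ω) := by
  have hw := seedWeight_nonneg (L := L) (B := B) (R := R) (m := m) hq hq1
  rw [prodWeight, prodWeight, Fintype.prod_sum_type,
    Fintype.prod_sum_type fun i => seedWeight L B q (shiftNoise a b ω i), ← mul_assoc]
  refine mul_le_mul_of_nonneg_right ?_ (Finset.prod_nonneg fun x _ => hw _)
  have h1 : c * c = ∏ i : Fin k, (if i = a then c else 1) * (if i = b then c else 1) := by
    rw [Finset.prod_mul_distrib, Finset.prod_ite_eq', Finset.prod_ite_eq']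
    simp
  rw [h1, ← Finset.prod_mul_distrib]
  refine Finset.prod_le_prod (fun i _ => hw _) fun i _ => ?_
  have h2 : ∀ (d : ℝ) (x y : Seed L B R m), noiseWeight q x.1 ≤ d * noiseWeight q y.1 →
      seedWeight L B q x ≤ d * seedWeight L B q y := by
    intro d x y h
    rw [seedWeight, seedWeight, ← mul_div_assoc]
    exact div_le_div_of_nonneg_right h (by positivity)
  refine h2 _ _ _ ?_
  rw [shiftNoise, Sum.elim_inl]
  dsimp only
  by_cases hia : i = a
  · subst hia
    rw [if_pos rfl, if_pos rfl, if_neg hab, mul_one]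
    exact noiseWeight_le hq hq1 hc ha.2 (ofShifted_add_le _)
  · by_cases hib : i = b
    · subst hib
      rw [if_neg hia, if_pos rfl, if_neg hia, if_pos rfl, one_mul]
      exact noiseWeight_le hq hq1 hc hb.2 (ofShifted_sub_le _)
    · rw [if_neg hia, if_neg hib, if_neg hia, if_neg hib, one_mul, one_mul]

/-- The change of one record is compensated by a permutation of the elements. -/
theorem exists_perm_elemType (hm : 0 < m) {D₁ D₂ : Database n k} {j : Fin n}
    (hj : D₁ j ≠ D₂ j) (hjs : ∀ j', j' ≠ j → D₁ j' = D₂ j') {z : Fin k → ℕ}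
    (ha : z (D₁ j) + m ≤ 2 * (R * m)) (hb : m ≤ z (D₂ j)) (hb' : z (D₂ j) ≤ 2 * (R * m)) :
    ∃ π : Equiv.Perm (Elem n k R), ∀ x,
      elemType m D₂ (moveUnit m (D₁ j) (D₂ j) z) x = elemType m D₁ z (π x) := by
  rw [← Nat.mul_assoc] at ha hb'
  obtain ⟨a, hDa⟩ : ∃ a, a = D₁ j := ⟨_, rfl⟩
  obtain ⟨b, hDb⟩ : ∃ b, b = D₂ j := ⟨_, rfl⟩
  rw [← hDa] at ha
  rw [← hDb] at hb hb'
  rw [← hDa, ← hDb] at hj ⊢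
  have ha1 : z a / m < 2 * R := by
    have h1 : (z a + m) / m ≤ 2 * R := Nat.div_le_of_le_mul (by rwa [Nat.mul_comm])
    rw [Nat.add_div_right _ hm] at h1
    omega
  have hb1 : 1 ≤ z b / m := (Nat.one_le_div_iff hm).2 hb
  have hb2 : z b / m ≤ 2 * R := Nat.div_le_of_le_mul (by rwa [Nat.mul_comm])
  set e : Elem n k R := .inl j with he
  set pa : Elem n k R := .inr (a, ⟨z a / m, ha1⟩) with hpa
  set pb : Elem n k R := .inr (b, ⟨z b / m - 1, by omega⟩) with hpb
  have h1 : e ≠ pa := by simp [he, hpa]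
  have h2 : e ≠ pb := by simp [he, hpb]
  have h3 : pa ≠ pb := by
    simp only [hpa, hpb, ne_eq, Sum.inr.injEq, Prod.mk.injEq, not_and]
    exact fun h => absurd h hj
  have hza : moveUnit m a b z a / m = z a / m + 1 := by
    rw [moveUnit, if_pos rfl, Nat.add_div_right _ hm]
  have hzb : moveUnit m a b z b / m = z b / m - 1 := by
    rw [moveUnit, if_neg hj.symm, if_pos rfl]
    have h4 := Nat.add_div_right (z b - m) hm
    rw [Nat.sub_add_cancel hb] at h4
    omega
  -- A three-cycle: the changed record `e`, now of type `b`, replaces the dummy `pb`, which becomes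
  -- inactive in place of `pa`, which in turn is activated with type `a` in place of `e`.
  refine ⟨Equiv.swap e pa * Equiv.swap e pb, fun x => ?_⟩
  rw [Equiv.Perm.mul_apply]
  by_cases hxe : x = e
  · rw [hxe, Equiv.swap_apply_left, Equiv.swap_apply_of_ne_of_ne h2.symm h3.symm]
    simp only [he, hpb, elemType, ← hDb]
    rw [if_pos (by omega)]
  by_cases hxb : x = pb
  · rw [hxb, Equiv.swap_apply_right, Equiv.swap_apply_left]
    simp only [hpa, hpb, elemType, hzb, lt_irrefl, if_false]
  by_cases hxa : x = pa
  · rw [hxa, Equiv.swap_apply_of_ne_of_ne h1.symm h3, Equiv.swap_apply_right]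
    simp only [hpa, he, elemType, hza, ← hDa, Nat.lt_succ_self, if_true]
  rw [Equiv.swap_apply_of_ne_of_ne hxe hxb, Equiv.swap_apply_of_ne_of_ne hxe hxa]
  rcases x with j' | ⟨i, d⟩
  · simp only [elemType]
    rw [hjs j' fun h => hxe (by rw [h])]
  · simp only [elemType]
    by_cases hia : i = a
    · subst hia
      have : d.val ≠ z i / m := fun h => hxa (by
        rw [hpa]
        congr 2
        exact Fin.ext h)
      rw [hza]
      by_cases hd : d.val < z i / m
      · rw [if_pos hd, if_pos (by omega)]
      · rw [if_neg hd, if_neg (by omega)]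
    · by_cases hib : i = b
      · subst hib
        have : d.val ≠ z i / m - 1 := fun h => hxb (by
          rw [hpb]
          congr 2
          exact Fin.ext h)
        rw [hzb]
        by_cases hd : d.val < z i / m
        · rw [if_pos hd, if_pos (by omega)]
        · rw [if_neg hd, if_neg (by omega)]
      · rw [moveUnit, if_neg hia, if_neg hib]

theorem histogram_of_neighboring {D₁ D₂ : Database n k} {j : Fin n}
    (hjs : ∀ j', j' ≠ j → D₁ j' = D₂ j') (i : Fin k) :
    histogram D₁ i + (if D₂ j = i then 1 else 0) =
      histogram D₂ i + if D₁ j = i then 1 else 0 := by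
  rw [histogram, histogram, Finset.card_filter, Finset.card_filter,
    ← Finset.add_sum_erase _ _ (Finset.mem_univ j),
    ← Finset.add_sum_erase _ (fun j => if D₂ j = i then 1 else 0) (Finset.mem_univ j)]
  have : ∑ x ∈ Finset.univ.erase j, (if D₁ x = i then 1 else 0) =
      ∑ x ∈ Finset.univ.erase j, if D₂ x = i then 1 else 0 :=
    Finset.sum_congr rfl fun x hx => by rw [hjs x (Finset.ne_of_mem_erase hx)]
  rw [this]
  ring

variable (cd : Coding k w (Fin L → Fin B)) (slot : Elem n k R → (Fin L → Fin B) × Fin Z)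

theorem routed_initArr (hslot : Function.Injective slot) (D : Database n k)
    (ω : Fin k ⊕ Elem n k R → Seed L B R m) :
    Routed 0 cd.lab (fun x => (slot x).1) (elemWord cd D ω) 0 (initArr cd slot D ω) := by
  classical
  intro b u hu
  symm
  refine Finset.card_bij (fun x _ => (slot x).2) (fun x hx => ?_) (fun x hx y hy h => ?_)
    fun c hc => ?_
  · simp only [Finset.mem_filter, Finset.mem_univ, true_and] at hx ⊢
    obtain ⟨rfl, h1, -⟩ := hx
    have h2 : (slot x).1 = b := funext fun j => h1 j (Nat.zero_le _)
    rw [← h2, Prod.mk.eta, initArr, hslot.extend_apply]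
  · simp only [Finset.mem_filter, Finset.mem_univ, true_and] at hx hy
    refine hslot (Prod.ext (funext fun j => ?_) h)
    exact (hx.2.1 j (Nat.zero_le _)).trans (hy.2.1 j (Nat.zero_le _)).symm
  · simp only [Finset.mem_filter, Finset.mem_univ, true_and] at hc
    by_cases h : ∃ x, slot x = (b, c)
    · obtain ⟨x, hx⟩ := h
      rw [← hx, initArr, hslot.extend_apply] at hc
      refine ⟨x, ?_, by rw [hx]⟩
      simp only [Finset.mem_filter, Finset.mem_univ, true_and]
      refine ⟨hc, fun j _ => by simp only [hx], fun j hj => absurd hj (Nat.not_lt_zero _)⟩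
    · rw [initArr, Function.extend_apply' _ _ _ h] at hc
      exact absurd hc.symm hu

theorem load_le_of_not_overflow (D : Database n k) (ω : Fin k ⊕ Elem n k R → Seed L B R m)
    (h : ¬ Overflow Z (fun x => (slot x).1) fun x => (ω (.inr x)).2) :
    ∀ l ≤ L, ∀ b, load cd.lab (fun x => (slot x).1) (elemWord cd D ω) l b ≤ Z := by
  intro l hl b
  by_contra hlt
  refine h ⟨l, hl, b, lt_of_lt_of_eq (not_le.1 hlt) ?_⟩
  rw [load]
  congr 1
  ext x
  simp only [Finset.mem_filter, Finset.mem_univ, true_and]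
  unfold inBucket
  simp only [elemWord, cd.lab_word]

variable {slot}

theorem finalArr_eq (hL : 0 < L) (hslot : Function.Injective slot) {D₁ D₂ : Database n k}
    {ω ω' : Fin k ⊕ Elem n k R → Seed L B R m} (π : Equiv.Perm (Elem n k R))
    (hπ : ∀ x, elemWord cd D₂ ω' x = elemWord cd D₁ ω (π x))
    (h : ¬ Overflow Z (fun x => (slot x).1) fun x => (ω (.inr x)).2)
    (h' : ¬ Overflow Z (fun x => (slot x).1) fun x => (ω' (.inr x)).2) :
    finalArr cd slot D₁ ω = finalArr cd slot D₂ ω' :=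
  levels_eq_of_perm 0 cd.lab hL π hπ (routed_initArr cd slot hslot D₁ ω)
    (routed_initArr cd slot hslot D₂ ω') (load_le_of_not_overflow cd slot D₁ ω h)
    (load_le_of_not_overflow cd slot D₂ ω' h')

theorem mass_not_interior_le {q : ℝ} (hq : 0 ≤ q) (hq1 : q ≤ 1) (hN : 0 < R * m) (i : Fin k) :
    mass (prodWeight (Fin k ⊕ Elem n k R) (seedWeight (R := R) (m := m) L B q))
      {ω | ¬ Interior ω i} ≤ (1 - q) + q ^ (R * m - m) := by
  have hw := seedWeight_nonneg (L := L) (B := B) (R := R) (m := m) hq hq1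
  have h1 := mass_prodWeight_apply (ι := Fin k ⊕ Elem n k R) (sum_seedWeight (L := L) (B := B)
    (R := R) (m := m) (q := q)) (.inl i) ({x | x.1.2.val = 0} ∪ {x | R * m - m ≤ x.1.2.val})
  refine le_trans (mass_mono (prodWeight_nonneg hw) ?_) (h1.le.trans
    ((mass_union_le hw _ _).trans (add_le_add (mass_seedWeight_zero hN).le
      (mass_seedWeight_tail_le hq hq1 _))))
  intro ω hω
  by_contra h
  simp only [Set.mem_ofPred_eq, Set.mem_union, not_or] at h
  exact hω ⟨by omega, by omega⟩

/-- The matching of seeds for neighboring databases. -/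
theorem exists_matching (hL : 0 < L) (hslot : Function.Injective slot) {q c : ℝ} (hq : 0 ≤ q)
    (hq1 : q ≤ 1) (hc : c * q ^ m = 1) (hN : 0 < R * m) {F : ℝ}
    (hF : mass (prodWeight (Fin k ⊕ Elem n k R) (seedWeight (R := R) (m := m) L B q))
      {ω | Overflow Z (fun x => (slot x).1) fun x => (ω (.inr x)).2} ≤ F)
    {D₁ D₂ : Database n k} (hD : Neighboring D₁ D₂) :
    ∃ (bad : Set (Fin k ⊕ Elem n k R → Seed L B R m))
      (φ : (Fin k ⊕ Elem n k R → Seed L B R m) → Fin k ⊕ Elem n k R → Seed L B R m),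
      mass (prodWeight _ (seedWeight L B q)) bad ≤ 2 * ((1 - q) + q ^ (R * m - m)) + 2 * F ∧
      (∀ ω ∉ bad, finalArr cd slot D₁ ω = finalArr cd slot D₂ (φ ω) ∧
        ∀ i, m * histogram D₁ i + noiseOf ω i = m * histogram D₂ i + noiseOf (φ ω) i) ∧
      Set.InjOn φ badᶜ ∧
      ∀ ω ∉ bad, prodWeight _ (seedWeight L B q) ω ≤
        c * c * prodWeight _ (seedWeight L B q) (φ ω) := by
  classical
  obtain ⟨j, hj, hjs⟩ := hD
  have hm : 0 < m := Nat.pos_of_mul_pos_left hN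
  have hw := prodWeight_nonneg (ι := Fin k ⊕ Elem n k R)
    (seedWeight_nonneg (L := L) (B := B) (R := R) (m := m) hq hq1)
  -- The permutation is a function of the noise vector alone, as `relabel` requires; outside the
  -- admissible range the identity serves as a default.
  have hex : ∀ z : Fin k → ℕ, ∃ π : Equiv.Perm (Elem n k R),
      z (D₁ j) + m ≤ 2 * (R * m) → m ≤ z (D₂ j) → z (D₂ j) ≤ 2 * (R * m) → ∀ x,
        elemType m D₂ (moveUnit m (D₁ j) (D₂ j) z) x = elemType m D₁ z (π x) := by
    intro z
    by_cases h : z (D₁ j) + m ≤ 2 * (R * m) ∧ m ≤ z (D₂ j) ∧ z (D₂ j) ≤ 2 * (R * m)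
    · obtain ⟨π, hπ⟩ := exists_perm_elemType hm hj hjs h.1 h.2.1 h.2.2
      exact ⟨π, fun _ _ _ => hπ⟩
    · exact ⟨1, fun h1 h2 h3 => absurd ⟨h1, h2, h3⟩ h⟩
  choose π hπ using hex
  set ovf : Set (Fin k ⊕ Elem n k R → Seed L B R m) :=
    {ω | Overflow Z (fun x => (slot x).1) fun x => (ω (.inr x)).2} with hovf
  -- Overflow has to be excluded for both runs. Moving noise does not touch labels, so for the
  -- second run it suffices to look at `relabel π ω`.
  set bad : Set (Fin k ⊕ Elem n k R → Seed L B R m) :=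
    ({ω | ¬ Interior ω (D₁ j)} ∪ {ω | ¬ Interior ω (D₂ j)}) ∪ (ovf ∪ relabel π ⁻¹' ovf)
    with hbad
  have hgood : ∀ ω ∉ bad, Interior ω (D₁ j) ∧ Interior ω (D₂ j) ∧ ω ∉ ovf ∧
      relabel π ω ∉ ovf := by
    intro ω hω
    simp only [hbad, Set.mem_union, Set.mem_ofPred_eq, Set.mem_preimage, not_or, not_not] at hω
    exact ⟨hω.1.1, hω.1.2, hω.2.1, hω.2.2⟩
  have hint : ∀ (ω : Fin k ⊕ Elem n k R → Seed L B R m) i, Interior (relabel π ω) i ↔ Interior ω i := fun ω i => Iff.rfl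
  have hnoise : ∀ ω : Fin k ⊕ Elem n k R → Seed L B R m, noiseOf (relabel π ω) = noiseOf ω := fun ω => rfl
  refine ⟨bad, fun ω => shiftNoise (D₁ j) (D₂ j) (relabel π ω), ?_, fun ω hω => ⟨?_, fun i => ?_⟩,
    ?_, fun ω hω => ?_⟩
  · have h1 := mass_not_interior_le (n := n) (L := L) (B := B) hq hq1 hN (D₁ j)
    have h2 := mass_not_interior_le (n := n) (L := L) (B := B) hq hq1 hN (D₂ j)
    -- `relabel π` is injective and preserves weights, so the preimage of the overflow event weighs
    -- no more than the event.
    have h3 : mass (prodWeight (Fin k ⊕ Elem n k R) (seedWeight (R := R) (m := m) L B q))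
        (relabel π ⁻¹' ovf) ≤ F := by
      have := mass_le_of_injOn (p := prodWeight (Fin k ⊕ Elem n k R)
        (seedWeight (R := R) (m := m) L B q)) hw zero_le_one (E := relabel π ⁻¹' ovf) (F := ovf)
        (relabel π) (fun ω hω => hω) (relabel_injective π).injOn fun ω _ => by
          rw [prodWeight_relabel, one_mul]
      rw [one_mul] at this
      exact this.trans hF
    have h4 := mass_union_le hw
      ({ω : Fin k ⊕ Elem n k R → Seed L B R m | ¬ Interior ω (D₁ j)} ∪
        {ω | ¬ Interior ω (D₂ j)}) (ovf ∪ relabel π ⁻¹' ovf)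
    have h5 := mass_union_le hw
      {ω : Fin k ⊕ Elem n k R → Seed L B R m | ¬ Interior ω (D₁ j)} {ω | ¬ Interior ω (D₂ j)}
    have h6 := mass_union_le hw ovf (relabel π ⁻¹' ovf)
    linarith
  · obtain ⟨ha, hb, h1, h2⟩ := hgood ω hω
    refine finalArr_eq cd hL hslot (π (noiseOf ω)) (fun x => ?_) h1 h2
    rw [elemWord, elemWord, noiseOf_shiftNoise ((hint _ _).2 ha), hnoise,
      hπ _ (shifted_add_le ha.2) (le_shifted hb.2) (shifted_le _)]
    rfl
  · obtain ⟨ha, hb, -, -⟩ := hgood ω hω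
    rw [noiseOf_shiftNoise ((hint _ _).2 ha), hnoise, moveUnit]
    have h1 := histogram_of_neighboring hjs i
    have h2 : m ≤ noiseOf ω (D₂ j) := le_shifted hb.2
    by_cases hia : i = D₁ j
    · subst hia
      rw [if_neg hj.symm, if_pos rfl] at h1
      rw [if_pos rfl, show histogram D₁ (D₁ j) = histogram D₂ (D₁ j) + 1 from h1]
      ring
    · by_cases hib : i = D₂ j
      · subst hib
        rw [if_pos rfl, if_neg hj] at h1
        rw [if_neg hia, if_pos rfl, ← show histogram D₁ (D₂ j) + 1 = histogram D₂ (D₂ j) from h1,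
          mul_add, mul_one]
        omega
      · rw [if_neg (Ne.symm hib), if_neg (Ne.symm hia)] at h1
        rw [if_neg hia, if_neg hib, show histogram D₁ i = histogram D₂ i from h1]
  · intro ω hω ω' hω' h
    obtain ⟨ha, hb, -, -⟩ := hgood ω hω
    obtain ⟨ha', hb', -, -⟩ := hgood ω' hω'
    exact relabel_injective π (shiftNoise_injOn (D₁ j) (D₂ j)
      (show relabel π ω ∈ {ω | Interior ω (D₁ j) ∧ Interior ω (D₂ j)} from ⟨ha, hb⟩)
      (show relabel π ω' ∈ {ω | Interior ω (D₁ j) ∧ Interior ω (D₂ j)} from ⟨ha', hb'⟩) h)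
  · obtain ⟨ha, hb, -, -⟩ := hgood ω hω
    rw [← prodWeight_relabel q π ω]
    exact prodWeight_shiftNoise_le hq hq1 hc hj ((hint _ _).2 ha) ((hint _ _).2 hb)

end Matching

/-! ### Running time and private memory -/

section Complexity

variable {α W Ω X : Type} [DecidableEq α] [DecidableEq X]

theorem bounded_readAll (addr : X → α) (l : List X) (acc : X → W) (K : (X → W) → Prog α W Ω)
    {T : ℕ} (hK : ∀ x, (K x).Bounded T) : (readAll addr l acc K).Bounded (l.length + T) := by
  induction l generalizing acc with
  | nil => simpa [readAll] using hK acc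
  | cons x l ih =>
    refine ⟨by simp only [List.length_cons]; omega, fun v => ?_⟩
    rw [List.length_cons, Nat.add_right_comm, Nat.add_sub_cancel]
    exact ih _

theorem bounded_writeAll (addr : X → α) (l : List X) (y : X → W) :
    (writeAll addr l y : Prog α W Ω).Bounded l.length := by
  induction l with
  | nil => trivial
  | cons x l ih => exact ⟨Nat.succ_pos _, ih⟩

theorem cost_writeAll [Fintype W] [Fintype Ω] (addr : X → α) (l : List X) (y : X → W) :
    (writeAll addr l y : Prog α W Ω).cost = l.length := by
  induction l with
  | nil => rfl
  | cons x l ih => rw [writeAll, Prog.cost, ih, List.length_cons, Nat.add_comm]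

/-- Every word read multiplies the continuations by the number of words, as all of them are
remembered. The summand `2` makes the recursion `x ↦ 1 + N * x` submultiplicative for `N ≥ 2`. -/
theorem cost_readAll_le [Fintype W] [Fintype Ω] (hW : 2 ≤ Fintype.card W) (addr : X → α)
    (l : List X) (acc : X → W) (K : (X → W) → Prog α W Ω) {c : ℕ} (hK : ∀ x, (K x).cost ≤ c) :
    (readAll addr l acc K).cost + 2 ≤ Fintype.card W ^ l.length * (c + 2) := by
  induction l generalizing acc with
  | nil => simpa [readAll] using hK acc
  | cons x l ih =>
    rw [readAll, Prog.cost, List.length_cons, pow_succ']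
    have h1 : ∑ v : W, ((readAll addr l (Function.update acc x v) K).cost + 2) ≤
        ∑ _v : W, Fintype.card W ^ l.length * (c + 2) := Finset.sum_le_sum fun v _ => ih _
    rw [Finset.sum_add_distrib, Finset.sum_const, Finset.sum_const, Finset.card_univ,
      smul_eq_mul, smul_eq_mul, ← mul_assoc] at h1
    omega

end Complexity

theorem card_bitVec (w : ℕ) : Fintype.card (BitVec w) = 2 ^ w := by
  rw [Fintype.card_congr BitVec.equivFin.toEquiv, Fintype.card_fin]

section Network

variable {n k L B Z R m w : ℕ} [NeZero k] [NeZero B]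
  (cd : Coding k w (Fin L → Fin B)) (slot : Elem n k R → (Fin L → Fin B) × Fin Z)

theorem length_lineReps (l : Fin L) : B * (lineReps (B := B) l).length = B ^ L := by
  have h1 := card_cylinder (fun j : Fin L => j = l) (fun _ => (0 : Fin B))
  simp only [forall_eq] at h1
  have h2 : (Finset.univ.filter fun j : Fin L => ¬ j = l).card = L - 1 := by
    rw [show (Finset.univ.filter fun j : Fin L => ¬ j = l) = {l}ᶜ by ext; simp, Finset.card_compl, Finset.card_singleton,
      Fintype.card_fin]
  rw [lineReps, Finset.length_toList, h1, h2, ← pow_succ', Nat.sub_add_cancel l.pos]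

theorem bounded_lineProg (l : Fin L) (b : Fin L → Fin B) :
    (lineProg cd l b : Prog (Fin n ⊕ Work k L B Z) (BitVec w) (Seed L B R m)).Bounded
      (2 * (B * Z)) := by
  have h := bounded_readAll (Ω := Seed L B R m)
    (fun c : Fin B × Fin Z => (arr (Function.update b l c.1, c.2) : Fin n ⊕ Work k L B Z))
    Finset.univ.toList (fun _ => (0 : BitVec w)) _ fun x => bounded_writeAll
      (fun c : Fin B × Fin Z => (arr (Function.update b l c.1, c.2) : Fin n ⊕ Work k L B Z))
      Finset.univ.toList (arrange 0 cd.lab l x)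
  rw [Finset.length_toList, Finset.card_univ, Fintype.card_prod, Fintype.card_fin,
    Fintype.card_fin, ← two_mul] at h
  exact h

theorem cost_lineProg_le (hw : 0 < w) (l : Fin L) (b : Fin L → Fin B) :
    (lineProg cd l b : Prog (Fin n ⊕ Work k L B Z) (BitVec w) (Seed L B R m)).cost ≤
      (2 ^ w) ^ (B * Z) * (B * Z + 2) := by
  have h := cost_readAll_le (Ω := Seed L B R m)
    (by rw [card_bitVec]; exact Nat.le_self_pow hw.ne' 2)
    (fun c : Fin B × Fin Z => (arr (Function.update b l c.1, c.2) : Fin n ⊕ Work k L B Z))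
    Finset.univ.toList (fun _ => (0 : BitVec w)) _ fun x => (cost_writeAll
      (fun c : Fin B × Fin Z => (arr (Function.update b l c.1, c.2) : Fin n ⊕ Work k L B Z))
      Finset.univ.toList (arrange 0 cd.lab l x)).le
  rw [Finset.length_toList, Finset.card_univ, Fintype.card_prod, Fintype.card_fin,
    Fintype.card_fin, card_bitVec] at h
  exact (Nat.le_add_right _ 2).trans h

theorem bounded_levelProg (l : ℕ) :
    (levelProg cd l : Prog (Fin n ⊕ Work k L B Z) (BitVec w) (Seed L B R m)).Bounded
      (2 * (B ^ L * Z)) := by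
  rw [levelProg]
  split_ifs with h
  · refine (Prog.bounded_seqList _ _ (bounded_lineProg cd ⟨l, h⟩)).mono (le_of_eq ?_)
    rw [← length_lineReps ⟨l, h⟩]
    ring
  · trivial

theorem ncard_reach_levelProg_le (hw : 0 < w) (l : ℕ) :
    (levelProg cd l : Prog (Fin n ⊕ Work k L B Z) (BitVec w) (Seed L B R m)).reach.ncard ≤
      B ^ L * ((2 ^ w) ^ (B * Z) * (B * Z + 2)) := by
  rw [levelProg]
  split_ifs with h
  · refine (Prog.ncard_reach_seqList_le _ _ fun b =>
      (Prog.ncard_reach_le_cost _).trans (cost_lineProg_le cd hw ⟨l, h⟩ b)).trans ?_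
    refine Nat.mul_le_mul_right _ ?_
    rw [← length_lineReps ⟨l, h⟩]
    exact Nat.le_mul_of_pos_left _ (NeZero.pos B)
  · simp [Prog.reach]

theorem length_seedList : (seedList n k R).length = k + (n + k * (2 * R)) := by
  simp [seedList]

theorem bounded_mainProg :
    (mainProg cd slot : Prog (Fin n ⊕ Work k L B Z) (BitVec w) (Seed L B R m)).Bounded
      ((k + (n + k * (2 * R))) * 2 + (k * 2 + (L * (2 * (B ^ L * Z)) + B ^ L * Z * 3))) := by
  have h1 := Prog.bounded_seqList (seedList n k R) (seedProg (m := m) cd slot) (T := 2) (by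
    rintro (i | x)
    · exact fun r => ⟨by norm_num, trivial⟩
    · exact fun r => ⟨by norm_num, fun v => ⟨by norm_num, trivial⟩⟩)
  have h2 := Prog.bounded_seqList (List.finRange k)
    (initProg (n := n) (L := L) (B := B) (Z := Z) (R := R) (m := m) (w := w)) (T := 2)
    fun i => ⟨by norm_num, fun v => ⟨by norm_num, trivial⟩⟩
  have h3 := Prog.bounded_seqList (List.range L) _
    (bounded_levelProg (n := n) (Z := Z) (R := R) (m := m) cd)
  have h4 := Prog.bounded_seqList Finset.univ.toList
    (scanProg (n := n) (Z := Z) (R := R) (m := m) cd) (T := 3)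
    fun i => ⟨by norm_num, fun v => ⟨by norm_num, fun y => ⟨by norm_num, trivial⟩⟩⟩
  rw [length_seedList] at h1
  rw [List.length_finRange] at h2
  rw [List.length_range] at h3
  rw [Finset.length_toList, Finset.card_univ, Fintype.card_prod, Fintype.card_fun,
    Fintype.card_fin, Fintype.card_fin, Fintype.card_fin] at h4
  exact h1.seq (h2.seq (h3.seq h4))

theorem ncard_reach_mainProg_le (hw : 0 < w) :
    (mainProg cd slot : Prog (Fin n ⊕ Work k L B Z) (BitVec w) (Seed L B R m)).reach.ncard ≤
      (k + (n + k * (2 * R))) * (Fintype.card (Seed L B R m) * (1 + 2 ^ w)) +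
        (k * (1 + 2 ^ w) + (L * (B ^ L * ((2 ^ w) ^ (B * Z) * (B * Z + 2))) +
          B ^ L * Z * (1 + 2 ^ w * (1 + 2 ^ w)))) := by
  have h1 := Prog.ncard_reach_seqList_le (seedList n k R) (seedProg (m := m) cd slot)
    (c := Fintype.card (Seed L B R m) * (1 + 2 ^ w)) (by
    rintro (i | x)
    · refine (Prog.ncard_reach_le_cost _).trans ?_
      simp only [seedProg, Sum.elim_inl, noiseProg, Prog.cost, Finset.sum_const, Finset.card_univ,
        smul_eq_mul]
      exact Nat.mul_le_mul_left _ (Nat.le_add_right _ _)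
    · refine (Prog.ncard_reach_le_cost _).trans (le_of_eq ?_)
      simp only [seedProg, Sum.elim_inr, elemProg, Prog.cost, Finset.sum_const, Finset.card_univ,
        smul_eq_mul, card_bitVec, Nat.add_zero, mul_one])
  have h2 := Prog.ncard_reach_seqList_le (List.finRange k)
    (initProg (n := n) (L := L) (B := B) (Z := Z) (R := R) (m := m) (w := w))
    (c := 1 + 2 ^ w) fun i => (Prog.ncard_reach_le_cost _).trans (le_of_eq (by
      simp [initProg, Prog.cost, card_bitVec]))
  have h3 := Prog.ncard_reach_seqList_le (List.range L) _
    (ncard_reach_levelProg_le (n := n) (Z := Z) (R := R) (m := m) cd hw)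
  have h4 := Prog.ncard_reach_seqList_le Finset.univ.toList
    (scanProg (n := n) (Z := Z) (R := R) (m := m) cd) (c := 1 + 2 ^ w * (1 + 2 ^ w))
    fun i => (Prog.ncard_reach_le_cost _).trans (le_of_eq (by
      simp [scanProg, Prog.cost, card_bitVec]))
  rw [length_seedList] at h1
  rw [List.length_finRange] at h2
  rw [List.length_range] at h3
  rw [Finset.length_toList, Finset.card_univ, Fintype.card_prod, Fintype.card_fun,
    Fintype.card_fin, Fintype.card_fin, Fintype.card_fin] at h4
  exact (Prog.ncard_reach_seq_le _ _).trans (Nat.add_le_add h1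
    ((Prog.ncard_reach_seq_le _ _).trans (Nat.add_le_add h2
      ((Prog.ncard_reach_seq_le _ _).trans (Nat.add_le_add h3 h4)))))

/-- With `N = 2 ^ w`, the dominant factor `N ^ (B * Z)` is the content of a line held in private
memory. All other factors are at most `9 * N ^ 3 ≤ N ^ 5`, hence five further words. -/
theorem ncard_reach_mainProg_lt (hw : 4 ≤ 2 ^ w) (hS : Fintype.card (Seed L B R m) ≤ 2 ^ w)
    (hE : k + (n + k * (2 * R)) ≤ 2 ^ w) (hLB : L * B ^ L ≤ 2 ^ w) (hBL : B ^ L * Z ≤ 2 ^ w)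
    (hBZ : B * Z + 2 ≤ 2 ^ w) :
    (mainProg cd slot : Prog (Fin n ⊕ Work k L B Z) (BitVec w) (Seed L B R m)).reach.ncard + 1 ≤
      2 ^ (w * (B * Z + 5)) := by
  have hw0 : 0 < w := by
    by_contra h
    rw [Nat.eq_zero_of_not_pos h] at hw
    norm_num at hw
  refine (Nat.add_le_add_right (ncard_reach_mainProg_le cd slot hw0) 1).trans ?_
  rw [pow_mul 2 w]
  generalize 2 ^ w = N at *
  generalize Fintype.card (Seed L B R m) = S at *
  have hk : k ≤ N := (Nat.le_add_right _ _).trans hE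
  generalize k + (n + k * (2 * R)) = E at *
  rw [show L * (B ^ L * (N ^ (B * Z) * (B * Z + 2))) = (L * B ^ L) * (N ^ (B * Z) * (B * Z + 2))
    by ring]
  generalize L * B ^ L = G at *
  generalize B ^ L * Z = H at *
  generalize B * Z = U at *
  have h1 : 1 + N ≤ 2 * N := by omega
  have hNN : 1 ≤ N * N := by nlinarith
  have h2 : 1 + N * (1 + N) ≤ 3 * (N * N) := by nlinarith
  have hU : 1 ≤ N ^ U := Nat.one_le_pow _ _ (by omega)
  have a1 : E * (S * (1 + N)) ≤ N * (N * (2 * N)) :=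
    Nat.mul_le_mul hE (Nat.mul_le_mul hS h1)
  have a2 : k * (1 + N) ≤ N * (2 * N) := Nat.mul_le_mul hk h1
  have a3 : G * (N ^ U * (U + 2)) ≤ N * (N ^ U * N) :=
    Nat.mul_le_mul hLB (Nat.mul_le_mul_left _ hBZ)
  have a4 : H * (1 + N * (1 + N)) ≤ N * (3 * (N * N)) := Nat.mul_le_mul hBL h2
  have h3 : N ^ (U + 5) = N ^ U * (N * N * (N * N * N)) := by ring
  have h4 : N * (N * (2 * N)) + (N * (2 * N) + (N * (N ^ U * N) + N * (3 * (N * N)))) + 1 ≤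
      N ^ U * (9 * (N * N * N)) := by
    have h5 : N * (N * (2 * N)) + (N * (2 * N) + (N * N + N * (3 * (N * N)))) + 1 ≤
        9 * (N * N * N) := by
      have : 4 * (N * N) ≤ N * N * N := by nlinarith
      nlinarith
    calc _ ≤ N ^ U * (N * (N * (2 * N)) + (N * (2 * N) + (N * N + N * (3 * (N * N)))) + 1) := by
          nlinarith [Nat.zero_le (N * (N * (2 * N)) + N * (2 * N) + N * (3 * (N * N)) + 1)]
      _ ≤ _ := Nat.mul_le_mul_left _ h5
  rw [h3]
  have h6 : N ^ U * (9 * (N * N * N)) ≤ N ^ U * (N * N * (N * N * N)) := by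
    refine Nat.mul_le_mul_left _ (Nat.mul_le_mul_right _ ?_)
    nlinarith
  omega

theorem abs_shifted_sub (x : Bool × Fin (R * m + 1)) :
    |(shifted x : ℝ) - (R * m : ℕ)| = (x.2.val : ℝ) := by
  have h := x.2.isLt
  rw [shifted]
  split_ifs
  · push_cast
    rw [add_sub_cancel_left, abs_of_nonneg (Nat.cast_nonneg _)]
  · rw [Nat.cast_sub (by omega), sub_sub_cancel_left, abs_neg, abs_of_nonneg (Nat.cast_nonneg _)]

theorem histogram_le (D : Database n k) (i : Fin k) : histogram D i ≤ n := by
  rw [histogram]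
  exact (Finset.card_le_univ _).trans (Fintype.card_fin n).le

end Network

/-! ### Assembly of the network algorithm -/

/-- The oblivious histogram algorithm for given parameters. -/
theorem exists_network_algorithm {n k L B Z Z₀ R f w : ℕ} [NeZero k] [NeZero B]
    (cd : Coding k w (Fin L → Fin B)) (slot : Elem n k R → (Fin L → Fin B) × Fin Z)
    (hslot : Function.Injective slot)
    (hpos : ∀ b, (Finset.univ.filter fun x => (slot x).1 = b).card ≤ Z₀) (hL : 0 < L)
    (hR : 0 < R) (hS : Fintype.card (Seed L B R (2 ^ f)) ≤ 2 ^ w)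
    (hE : k + (n + k * (2 * R)) ≤ 2 ^ w) (hLB : L * B ^ L ≤ 2 ^ w) (hBL : B ^ L * Z ≤ 2 ^ w)
    (hBZ : B * Z + 2 ≤ 2 ^ w) (hout : 4 * (2 ^ f * (n + R)) ≤ 2 ^ w) {ε δ : ℝ} (hε : 0 < ε)
    (hδ : 2 * ((1 - Real.exp (-(ε / (2 * 2 ^ f)))) +
        Real.exp (-(ε / (2 * 2 ^ f))) ^ (R * 2 ^ f - 2 ^ f)) +
      2 * ((L + 1) * (B ^ L : ℕ) * ((Z₀ : ℝ) ^ (Z + 1) / (Z + 1).factorial)) ≤ δ) :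
    ∃ (A : Algorithm n k) (t : ℕ), A.wordBits = w ∧ A.privWords = B * Z + 6 ∧
      t = (k + (n + k * (2 * R))) * 2 + (k * 2 + (L * (2 * (B ^ L * Z)) + B ^ L * Z * 3)) + 1 ∧
      A.RunsInTime t ∧ A.IsObliviouslyDP t ε δ ∧
      ∀ (θ : ℝ) (D : Database n k), 0 < θ → θ < 1 →
        ENNReal.ofReal (1 - θ) ≤ (A.view D t).toOuterMeasure
          {v | ∀ i, |v.1 i - (histogram D i : ℝ)| ≤ Real.log (k / θ) * (2 / ε)} := by
  set m := 2 ^ f with hm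
  have hm0 : 0 < m := by positivity
  have hmR : ((m : ℕ) : ℝ) = 2 ^ f := by rw [hm]; push_cast; rfl
  rw [← hmR] at hδ
  have hm0' : (0 : ℝ) < m := Nat.cast_pos.2 hm0
  set q := Real.exp (-(ε / (2 * m))) with hq
  have hq0 : 0 ≤ q := (Real.exp_pos _).le
  have hq1 : q ≤ 1 := Real.exp_le_one_iff.2 (neg_nonpos.2 (by positivity))
  -- One unit of noise costs `exp (ε / 2)`; two types change, which adds up to `exp ε`.
  have hqc : Real.exp (ε / 2) * q ^ m = 1 := by
    rw [hq, ← Real.exp_nat_mul, ← Real.exp_add]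
    convert Real.exp_zero using 2
    field_simp
    ring
  have hN : 0 < R * m := Nat.mul_pos hR hm0
  have hp := seedWeight_nonneg (L := L) (B := B) (R := R) (m := m) hq0 hq1
  have hp1 := sum_seedWeight (L := L) (B := B) (R := R) (m := m) (q := q)
  have hk1 : 1 ≤ k := NeZero.one_le
  have hw4 : 4 * (m * (n + R)) ≤ 2 ^ w := hout
  have hmR1 : R * m ≤ m * (n + R) := by nlinarith
  have hF := mass_overflow_le (R := R) (m := m) hq0 hq1 (fun x : Elem n k R => (slot x).1)
    (Function.Embedding.inr : Elem n k R ↪ Fin k ⊕ Elem n k R) (Z := Z) hpos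
  have hreach := ncard_reach_mainProg_lt (n := n) (m := m) cd slot
    (le_trans (by nlinarith) hw4) hS hE hLB hBL hBZ
  obtain ⟨A, hA1, hA2, hA3, g, hA4⟩ := exists_algorithm
    (weightPMF (seedWeight L B q) hp hp1) (mainProg cd slot) (bounded_mainProg cd slot) hreach
    ((Nat.le_add_right _ _).trans hE) (fun i => Sum.inl (some i)) f
  obtain ⟨tr, F, hden⟩ := den_mainProg cd slot hslot ((Nat.le_add_right _ _).trans hE)
    (by omega) (seedWeight L B q) hp hp1
  set t := (k + (n + k * (2 * R))) * 2 +
    (k * 2 + (L * (2 * (B ^ L * Z)) + B ^ L * Z * 3)) + 1 with ht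
  set V : Database n k → (Fin k ⊕ Elem n k R → Seed L B R m) →
      (Fin k → ℝ) × List (Access A.extCells) := fun D ω =>
    (fun i => ((m * histogram D i + noiseOf ω i : ℕ) - (R * m : ℕ)) / m,
      g (tr ++ scanTrace cd (finalArr cd slot D ω) Finset.univ.toList)) with hV
  have hview : ∀ D, A.view D t = (weightPMF (prodWeight (Fin k ⊕ Elem n k R) (seedWeight L B q))
      (prodWeight_nonneg hp) (sum_prodWeight hp1)).map (V D) := by
    intro D
    rw [hA4, (hden D).1, PMF.map_comp, seedsPMF]
    refine congrArg (fun h => PMF.map h _) (funext fun ω => ?_)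
    obtain ⟨h1, h2⟩ := (hden D).2 ω
    refine Prod.ext (funext fun i => ?_) (congrArg g h1)
    simp only [Function.comp, storeOutput, hV]
    have h3 : (F D ω).1 (Sum.inr (Sum.inl (some i))) =
      BitVec.ofInt w (m * histogram D i + noiseOf ω i - (R * m : ℕ)) := h2 i
    have h4 : m * histogram D i ≤ m * n := Nat.mul_le_mul_left _ (histogram_le D i)
    have h5 : noiseOf ω i ≤ 2 * (R * m) := shifted_le _
    have hw0 : 0 < w := by
      by_contra h
      rw [Nat.eq_zero_of_not_pos h] at hw4
      omega
    have h6 : 2 ^ w = 2 * 2 ^ (w - 1) := by rw [← pow_succ', Nat.sub_add_cancel hw0]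
    have h7 : m * (n + R) = m * n + R * m := by ring
    have h8 : ((m * histogram D i : ℕ) : ℤ) = (m : ℤ) * histogram D i := by push_cast; rfl
    have h9 : ((2 ^ (w - 1) : ℕ) : ℤ) = (2 : ℤ) ^ (w - 1) := by push_cast; rfl
    -- The counter lies between `-R * m` and `m * n + R * m`, inside the signed range by `hout`.
    rw [h3, BitVec.toInt_ofInt_eq_self hw0 (by rw [← h8, ← h9]; omega)
      (by rw [← h8, ← h9]; omega), ← hmR]
    push_cast
    rfl
  refine ⟨A, t, hA1, hA2, ht, hA3, ?_, fun θ D hθ hθ' => ?_⟩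
  · refine isObliviouslyDP_of_seeds A t _ (prodWeight_nonneg hp) (sum_prodWeight hp1) V hview
      (le_trans ?_ hδ) fun D₁ D₂ hD => ?_
    · have h1 : 0 ≤ q ^ (R * m - m) := pow_nonneg hq0 _
      have h2 : (0 : ℝ) ≤ (L + 1) * (B ^ L : ℕ) * ((Z₀ : ℝ) ^ (Z + 1) / (Z + 1).factorial) := by
        positivity
      linarith
    · obtain ⟨bad, φ, h1, h2, h3, h4⟩ := exists_matching cd hL hslot hq0 hq1 hqc hN hF hD
      refine ⟨bad, φ, h1.trans hδ, fun ω hω => ?_, h3, fun ω hω => ?_⟩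
      · obtain ⟨h5, h6⟩ := h2 ω hω
        simp only [hV, h5, h6]
      · rw [show Real.exp ε = Real.exp (ε / 2) * Real.exp (ε / 2) by
          rw [← Real.exp_add, add_halves]]
        exact h4 ω hω
  · set s := Real.log (k / θ) * (2 / ε) with hs
    have hk1' : (1 : ℝ) ≤ k := by exact_mod_cast hk1
    have hkθ : 1 ≤ k / θ := by rw [le_div_iff₀ hθ]; linarith
    have hs0 : 0 ≤ s := mul_nonneg (Real.log_nonneg hkθ) (by positivity)
    -- `u` is the allowed error in multiples of `1 / m`. Each type exceeds it with probability at
    -- most `θ / k`, and the union bound over the types gives `θ`.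
    set u := ⌊s * m⌋₊ with hu
    have htail : q ^ (u + 1) ≤ θ / k := by
      calc q ^ (u + 1) = Real.exp ((u + 1 : ℕ) * (-(ε / (2 * m)))) := by
            rw [hq, Real.exp_nat_mul]
        _ ≤ Real.exp (-Real.log (k / θ)) := by
            refine Real.exp_le_exp.2 ?_
            have h2 : s * m * (ε / (2 * m)) = Real.log (k / θ) := by
              rw [hs]
              field_simp
            have h3 := (Nat.lt_floor_add_one (s * m)).le
            have h4 : 0 ≤ ε / (2 * m) := by positivity
            push_cast
            nlinarith [mul_le_mul_of_nonneg_right h3 h4]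
        _ = θ / k := by rw [Real.exp_neg, Real.exp_log (by linarith), inv_div]
    refine le_toOuterMeasure_view A _ _ (prodWeight_nonneg hp) (sum_prodWeight hp1) _ D (hview D) _
      {ω | ∃ i ∈ (Finset.univ : Finset (Fin k)), ω ∈ {ω : Fin k ⊕ Elem n k R → Seed L B R m |
        ω (.inl i) ∈ {x : Seed L B R m | u + 1 ≤ x.1.2.val}}} ?_ fun ω hω i => ?_
    · refine (mass_biUnion_le (prodWeight_nonneg hp) _ _).trans ?_
      refine (Finset.sum_le_card_nsmul _ _ (θ / k) fun i _ => ?_).trans (le_of_eq ?_)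
      · rw [mass_prodWeight_apply hp1]
        exact (mass_seedWeight_tail_le hq0 hq1 _).trans htail
      · rw [Finset.card_univ, Fintype.card_fin, nsmul_eq_mul]
        field_simp
    · have h1 : (ω (.inl i)).1.2.val ≤ u := by
        by_contra h
        exact hω ⟨i, Finset.mem_univ i, not_le.1 h⟩
      have h2 : ((m * histogram D i + noiseOf ω i : ℕ) - (R * m : ℕ) : ℝ) / m - histogram D i =
          (noiseOf ω i - (R * m : ℕ)) / m := by
        push_cast
        field_simp
        ring
      simp only [hV]
      rw [h2, noiseOf, abs_div, abs_shifted_sub, Nat.abs_cast, div_le_iff₀ hm0']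
      exact (Nat.cast_le.2 h1).trans (Nat.floor_le (by positivity))

/-! ### Choice of the parameters -/

/-- The dimensions of the network. -/
theorem exists_dimensions {X : ℕ} (hX : 2 ≤ X) :
    ∃ L B : ℕ, 0 < L ∧ 0 < B ∧ (L + 1) ^ L ≤ X ∧ X ≤ B ^ L ∧ B ^ L ≤ 3 * X ∧
      B ≤ (L + 2) ^ 2 := by
  set P : ℕ → Prop := fun L => (L + 1) ^ L ≤ X with hP
  -- `L` is the greatest depth with `(L + 1) ^ L ≤ X`, and `B` below the least base with `X ≤ B ^
  -- L`; then `L + 1 ≤ B`.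
  set L := Nat.findGreatest P X with hLdef
  have h1 : P 1 := by simpa [hP] using hX
  have hL : 0 < L := Nat.le_findGreatest (by omega) h1
  have hLX : (L + 1) ^ L ≤ X := Nat.findGreatest_spec (P := P) (by omega) h1
  have hL1 : L + 1 ≤ X := (Nat.le_self_pow hL.ne' _).trans hLX
  have hLX' : X < (L + 2) ^ (L + 1) := not_le.1
    (Nat.findGreatest_is_greatest (P := P) (Nat.lt_succ_self L) hL1)
  have hex : ∃ B, X ≤ B ^ L := ⟨X, Nat.le_self_pow hL.ne' X⟩
  set B := Nat.find hex with hBdef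
  have hB : X ≤ B ^ L := Nat.find_spec hex
  have hLB : L + 1 ≤ B := by
    by_contra h
    have h2 : B ^ L < (L + 1) ^ L := Nat.pow_lt_pow_left (by omega) hL.ne'
    omega
  obtain ⟨b, hb⟩ : ∃ b, B = b + 1 := ⟨B - 1, by omega⟩
  have hbX : b ^ L < X := not_le.1 (Nat.find_min hex (m := b) (by omega))
  refine ⟨L, B, hL, by omega, hLX, hB, ?_, ?_⟩
  · have hb0 : (0 : ℝ) < b := Nat.cast_pos.2 (by omega)
    have hLb : (L : ℝ) ≤ b := by exact_mod_cast (by omega : L ≤ b)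
    -- As `L ≤ b`, increasing the base from `b` to `b + 1` costs at most a factor `e`.
    have h2 : (1 + 1 / (b : ℝ)) ^ L ≤ 3 := by
      calc (1 + 1 / (b : ℝ)) ^ L ≤ Real.exp (1 / b) ^ L := by
            refine pow_le_pow_left₀ (by positivity) ?_ L
            rw [add_comm]
            exact Real.add_one_le_exp _
        _ = Real.exp (L * (1 / b)) := (Real.exp_nat_mul _ _).symm
        _ ≤ Real.exp 1 := Real.exp_le_exp.2 (by
            rw [mul_one_div, div_le_one hb0]
            exact hLb)
        _ ≤ 3 := Real.exp_one_lt_three.le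
    have h3 : ((B ^ L : ℕ) : ℝ) ≤ (3 * X : ℕ) := by
      have h4 : (B : ℝ) = b * (1 + 1 / b) := by
        rw [hb]
        push_cast
        field_simp
      have h5 : (b : ℝ) ^ L ≤ X := by exact_mod_cast hbX.le
      push_cast
      rw [h4, mul_pow, mul_comm (3 : ℝ)]
      exact mul_le_mul h5 h2 (by positivity) (Nat.cast_nonneg _)
    exact_mod_cast h3
  -- By maximality of `L`, `X < (L + 2) ^ (L + 1)`, and `L + 1 ≤ 2 * L`.
  · have h2 : b ^ L < ((L + 2) ^ 2) ^ L := by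
      rw [← pow_mul]
      exact hbX.trans (hLX'.trans_le (Nat.pow_le_pow_right (by omega) (by omega)))
    have := lt_of_pow_lt_pow_left₀ L (Nat.zero_le _) h2
    omega

theorem exists_coding {k w : ℕ} {Λ : Type} [Fintype Λ] [Inhabited Λ]
    (h : (k + 1) * Fintype.card Λ + 1 ≤ 2 ^ w) : Nonempty (Coding k w Λ) := by
  classical
  obtain ⟨g⟩ : Nonempty (Option (Option (Fin k) × Λ) ↪ BitVec w) :=
    Function.Embedding.nonempty_of_card_le (by
      rw [card_bitVec, Fintype.card_option, Fintype.card_prod, Fintype.card_option,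
        Fintype.card_fin]
      exact h)
  -- The extra value `none` stands for an empty cell; the swap gives it the code `0`, the initial
  -- content of external memory.
  set e : Option (Option (Fin k) × Λ) ↪ BitVec w :=
    g.trans (Equiv.swap (g none) 0).toEmbedding with he
  have he0 : e none = 0 := by simp [he]
  have hinv : ∀ x, Function.invFun e (e x) = x := Function.leftInverse_invFun e.injective
  exact ⟨{
    word := fun t r => e (some (t, r))
    typ := fun v => (Function.invFun e v).elim none Prod.fst
    lab := fun v => (Function.invFun e v).elim default Prod.snd
    typ_word := fun t r => by rw [hinv]; rfl
    lab_word := fun t r => by rw [hinv]; rfl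
    typ_zero := by
      rw [← he0, hinv]
      rfl }⟩

theorem exists_slot {E Λ : Type} [Fintype E] [Fintype Λ] [DecidableEq Λ] {Z₀ Z : ℕ}
    (h : Fintype.card E ≤ Fintype.card Λ * Z₀) (hZ : Z₀ ≤ Z) :
    ∃ slot : E → Λ × Fin Z, Function.Injective slot ∧
      ∀ b, (Finset.univ.filter fun x => (slot x).1 = b).card ≤ Z₀ := by
  obtain ⟨g⟩ : Nonempty (E ↪ Λ × Fin Z₀) := Function.Embedding.nonempty_of_card_le (by
    rwa [Fintype.card_prod, Fintype.card_fin])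
  refine ⟨fun x => ((g x).1, Fin.castLE hZ (g x).2), fun x y hxy => ?_, fun b => ?_⟩
  · obtain ⟨h1, h2⟩ := Prod.mk.inj hxy
    exact g.injective (Prod.ext h1 (Fin.castLE_injective hZ h2))
  · refine (Finset.card_le_card_of_injOn (t := (Finset.univ : Finset (Fin Z₀)))
      (fun x => (g x).2) (fun _ _ => Finset.mem_univ _) fun x hx y hy hxy => ?_).trans
      (by rw [Finset.card_univ, Fintype.card_fin])
    have hx' : (g x).1 = b := by simpa using hx
    have hy' : (g y).1 = b := by simpa using hy
    exact g.injective (Prod.ext (hx'.trans hy'.symm) hxy)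

/-- From `(e * Z₀) ^ Q / Q! ≤ exp (e * Z₀)` with `Q = 8 * Z₀ + 1` and `e < 3`, the exponent is at
most `3 * Z₀ - 8 * Z₀`. -/
theorem pow_div_factorial_le (Z₀ : ℕ) :
    (Z₀ : ℝ) ^ (8 * Z₀ + 1) / (8 * Z₀ + 1).factorial ≤ Real.exp (-(5 * Z₀)) := by
  set Q := 8 * Z₀ + 1 with hQ
  have h1 := Real.pow_div_factorial_le_exp (Real.exp 1 * Z₀) (by positivity) Q
  rw [mul_pow, ← Real.exp_nat_mul, mul_one, mul_div_assoc] at h1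
  have h2 : (Z₀ : ℝ) ^ Q / Q.factorial ≤ Real.exp (-Q) * Real.exp (Real.exp 1 * Z₀) := by
    rw [Real.exp_neg, ← div_eq_inv_mul, le_div_iff₀' (Real.exp_pos _)]
    exact h1
  refine h2.trans ?_
  rw [← Real.exp_add]
  refine Real.exp_le_exp.2 ?_
  have h3 : Real.exp 1 * Z₀ ≤ 3 * Z₀ :=
    mul_le_mul_of_nonneg_right Real.exp_one_lt_three.le (Nat.cast_nonneg _)
  have h4 : (Q : ℝ) = 8 * Z₀ + 1 := by rw [hQ]; push_cast; rfl
  linarith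

/-- The fine resolution `m ≥ 16 * n ^ 4` makes zero noise rare, and the range `R` makes noise near
the truncation rare, with probability at most `n ^ (-5)`. Half of the budget `1 / n ^ 2` is left for
overflow. -/
theorem noise_error_le {n m R : ℕ} (hn : 2 ≤ n) {ε : ℝ} (hε : 0 < ε) (hε' : ε < 4 * Real.log n)
    (hm : 16 * n ^ 4 ≤ m) (hR : 10 * Real.log n / ε + 1 ≤ R) :
    2 * ((1 - Real.exp (-(ε / (2 * m)))) + Real.exp (-(ε / (2 * m))) ^ (R * m - m)) ≤
      1 / (2 * (n : ℝ) ^ 2) := by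
  have hn' : (2 : ℝ) ≤ n := by exact_mod_cast hn
  have hn0 : (0 : ℝ) < n := by linarith
  have hm' : 16 * (n : ℝ) ^ 4 ≤ m := by exact_mod_cast hm
  have hm0 : (0 : ℝ) < m := lt_of_lt_of_le (by positivity) hm'
  have hlog : Real.log n ≤ n := (Real.log_le_sub_one_of_pos hn0).trans (by linarith)
  have h1 : 1 - Real.exp (-(ε / (2 * m))) ≤ 1 / (16 * (n : ℝ) ^ 2) := by
    have h2 := Real.add_one_le_exp (-(ε / (2 * m)))
    have h3 : ε / (2 * m) ≤ 1 / (16 * (n : ℝ) ^ 2) := by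
      rw [div_le_div_iff₀ (by positivity) (by positivity)]
      have h4 : ε ≤ 4 * n := by linarith
      have h5 : (n : ℝ) ^ 4 = n ^ 2 * n * n := by ring
      have h6 : 0 ≤ (n : ℝ) ^ 2 * n := by positivity
      nlinarith [mul_le_mul_of_nonneg_left h4 (by positivity : (0 : ℝ) ≤ 16 * n ^ 2),
        mul_le_mul_of_nonneg_left hn' h6]
    linarith
  have h2 : Real.exp (-(ε / (2 * m))) ^ (R * m - m) ≤ 1 / (8 * (n : ℝ) ^ 2) := by
    have hR1 : (1 : ℝ) ≤ R := le_trans (le_add_of_nonneg_left (by positivity)) hR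
    have hR1' : 1 ≤ R := by exact_mod_cast hR1
    rw [← Real.exp_nat_mul, Nat.cast_sub (Nat.le_mul_of_pos_left m hR1'), Nat.cast_mul]
    have h3 : ((R : ℝ) * m - m) * -(ε / (2 * m)) ≤ -(5 * Real.log n) := by
      have h4 : ((R : ℝ) * m - m) * -(ε / (2 * m)) = -((R - 1) * ε / 2) := by
        field_simp
      have h5 : 10 * Real.log n ≤ (R - 1) * ε := by
        rw [← div_le_iff₀ hε]
        linarith
      rw [h4]
      linarith
    refine (Real.exp_le_exp.2 h3).trans ?_
    have h4 : Real.exp (5 * Real.log n) = (n : ℝ) ^ 5 := by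
      rw [show (5 : ℝ) * Real.log n = ((5 : ℕ) : ℝ) * Real.log n by norm_num, Real.exp_nat_mul,
        Real.exp_log hn0]
    rw [Real.exp_neg, h4, ← one_div]
    refine one_div_le_one_div_of_le (by positivity) ?_
    have h5 : (2 : ℝ) ^ 3 ≤ (n : ℝ) ^ 3 := pow_le_pow_left₀ (by norm_num) hn' 3
    calc 8 * (n : ℝ) ^ 2 = 2 ^ 3 * (n : ℝ) ^ 2 := by norm_num
      _ ≤ (n : ℝ) ^ 3 * (n : ℝ) ^ 2 := by gcongr
      _ = (n : ℝ) ^ 5 := by ring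
  have h3 : 2 * (1 / (16 * (n : ℝ) ^ 2) + 1 / (8 * (n : ℝ) ^ 2)) ≤ 1 / (2 * (n : ℝ) ^ 2) := by
    rw [show 2 * (1 / (16 * (n : ℝ) ^ 2) + 1 / (8 * (n : ℝ) ^ 2)) =
      3 / (8 * (n : ℝ) ^ 2) by field_simp; ring,
      div_le_div_iff₀ (by positivity) (by positivity)]
    nlinarith [sq_nonneg (n : ℝ)]
  linarith

/-- Writing `u = log x`, a number `L` with `(L + 1) ^ L ≤ 27 x` is `O(u / log u)`. -/
theorem depth_le {x : ℝ} (hx : 3 ≤ x) {L : ℕ} (hL : ((L : ℝ) + 1) ^ L ≤ 27 * x) :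
    (L : ℝ) ≤ 8 * (Real.log x / Real.log (Real.log x)) := by
  set u := Real.log x with hu
  have h3u : Real.log 3 ≤ u := Real.log_le_log (by norm_num) hx
  have hu1 : 1 < u := by
    refine lt_of_lt_of_le ?_ h3u
    rw [Real.lt_log_iff_exp_lt (by norm_num)]
    exact Real.exp_one_lt_three
  have hlu : 0 < Real.log u := Real.log_pos hu1
  have h1 : L * Real.log (L + 1) ≤ 4 * u := by
    have h2 := Real.log_le_log (by positivity) hL
    rw [Real.log_pow, Real.log_mul (by norm_num) (by linarith),
      show (27 : ℝ) = 3 ^ 3 by norm_num, Real.log_pow] at h2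
    push_cast at h2
    linarith
  rw [← mul_div_assoc, le_div_iff₀ hlu]
  have hs := Real.sqrt_nonneg u
  have hs2 : √u * √u = u := Real.mul_self_sqrt (by linarith)
  have hlogs : Real.log u = 2 * Real.log √u := by
    rw [Real.log_sqrt (by linarith)]
    ring
  have hs0 : 0 < √u := Real.sqrt_pos.2 (by linarith)
  -- Either `L + 1 ≥ √u`, and then `log u ≤ 2 * log (L + 1)`, or `L ≤ √u`, and then `log u ≤ 2 * √u`
  -- is enough.
  rcases le_or_gt (√u) (L + 1) with h | h
  · have h2 : Real.log u ≤ 2 * Real.log (L + 1) := by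
      rw [hlogs]
      linarith [Real.log_le_log hs0 h]
    nlinarith [mul_le_mul_of_nonneg_left h2 (Nat.cast_nonneg L : (0 : ℝ) ≤ L)]
  · have h2 : Real.log u ≤ 2 * √u := by
      rw [hlogs]
      linarith [Real.log_le_sub_one_of_pos hs0]
    have h3 : (L : ℝ) ≤ √u := by linarith
    nlinarith [mul_le_mul h3 h2 hlu.le hs]

theorem one_le_log_div_log_log {x : ℝ} (hx : 3 ≤ x) :
    1 ≤ Real.log x / Real.log (Real.log x) := by
  have hu1 : 1 < Real.log x := by
    rw [Real.lt_log_iff_exp_lt (by linarith)]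
    exact Real.exp_one_lt_three.trans_le hx
  rw [one_le_div (Real.log_pos hu1)]
  linarith [Real.log_le_sub_one_of_pos (by linarith : 0 < Real.log x)]

theorem time_le {x : ℝ} (hx : 3 ≤ x) {k N L G : ℕ} (hL : 0 < L) (hk : (k : ℝ) ≤ x)
    (hN : (N : ℝ) ≤ 25 * x) (hG : (G : ℝ) ≤ 1080 * x)
    (hdepth : (L : ℝ) ≤ 8 * (Real.log x / Real.log (Real.log x))) :
    (((k + N) * 2 + (k * 2 + (L * (2 * G) + G * 3)) + 1 : ℕ) : ℝ) ≤
      100000 * (x * Real.log x / Real.log (Real.log x)) := by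
  have hL1 : (1 : ℝ) ≤ L := by exact_mod_cast hL
  have hx0 : 0 ≤ x := by linarith
  have h1 : (L : ℝ) * G ≤ L * (1080 * x) := mul_le_mul_of_nonneg_left hG (Nat.cast_nonneg _)
  have h2 : x ≤ L * x := le_mul_of_one_le_left hx0 hL1
  have h3 := mul_le_mul_of_nonneg_right hdepth hx0
  have h4 : x * Real.log x / Real.log (Real.log x) =
    Real.log x / Real.log (Real.log x) * x := by ring
  have h5 : 0 ≤ Real.log x / Real.log (Real.log x) * x :=
    mul_nonneg (zero_le_one.trans (one_le_log_div_log_log hx)) hx0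
  rw [h4]
  push_cast
  linarith

-- Since `ε * n > 1`, all parameters are polynomial in `n`. Hence words of `O(log n)` bits suffice,
-- and the private memory is polylogarithmic in `n` rather than in `ñ`.
set_option maxHeartbeats 1000000 in
theorem exists_algorithm_of_moderate {n k : ℕ} (hk : 2 ≤ k) (hkn : k ≤ n) {ε : ℝ} (hε : 0 < ε)
    (hεn : 1 < ε * n) (hε' : ε < 4 * Real.log n) :
    ∃ (A : Algorithm n k) (t : ℕ),
      (A.privWords : ℝ) ≤ 100000 * (1 + Real.log n) ^ 3 ∧
      (A.wordBits : ℝ) ≤ 80 * (1 + Real.log n) ∧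
      A.RunsInTime t ∧
      (3 ≤ nTilde n k ε → (t : ℝ) ≤ 100000 * (nTilde n k ε * Real.log (nTilde n k ε) /
        Real.log (Real.log (nTilde n k ε)))) ∧
      A.IsObliviouslyDP t ε (1 / (n : ℝ) ^ 2) ∧
      ∀ (θ : ℝ) (D : Database n k), 0 < θ → θ < 1 →
        ENNReal.ofReal (1 - θ) ≤ (A.view D t).toOuterMeasure
          {v | ∀ i, |v.1 i - (histogram D i : ℝ)| ≤ Real.log (k / θ) * (2 / ε)} := by
  have hn2 : 2 ≤ n := hk.trans hkn
  have hn2' : (2 : ℝ) ≤ n := by exact_mod_cast hn2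
  have hn0 : (0 : ℝ) < n := by linarith
  have : NeZero k := ⟨by omega⟩
  set ℓ := Real.log n with hℓ
  have hℓn : ℓ ≤ n - 1 := Real.log_le_sub_one_of_pos hn0
  have hℓ2 : (1 : ℝ) / 2 < ℓ := by
    have := Real.log_le_log (by norm_num) hn2'
    linarith [Real.log_two_gt_d9]
  set c := Nat.clog 2 n with hc
  -- All sizes are compared with powers of this power of two between `n` and `2 * n`; the word
  -- length `40 * c` makes `2 ^ w = P ^ 40`.
  set P := 2 ^ c with hP
  have hnP : n ≤ P := Nat.le_pow_clog (by norm_num) n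
  have hPn : P ≤ 2 * n := by
    have h1 : 2 ^ (c - 1) < n := Nat.pow_pred_clog_lt_self (by norm_num) (by omega)
    have h2 : 0 < c := Nat.clog_pos (by norm_num) hn2
    have h3 : P = 2 * 2 ^ (c - 1) := by rw [hP, ← pow_succ', Nat.sub_add_cancel h2]
    omega
  have hP2 : 2 ≤ P := hn2.trans hnP
  set R := ⌈10 * ℓ / ε⌉₊ + 1 with hR
  have hR1 : 10 * ℓ / ε + 1 ≤ R := by
    rw [hR]
    push_cast
    linarith [Nat.le_ceil (10 * ℓ / ε)]
  have hR2 : (R : ℝ) ≤ 10 * ℓ / ε + 2 := by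
    rw [hR]
    push_cast
    linarith [Nat.ceil_lt_add_one (show 0 ≤ 10 * ℓ / ε by positivity)]
  have hRn : R ≤ 10 * n ^ 2 := by
    have h1 : 10 * ℓ / ε ≤ 10 * ℓ * n := by
      rw [div_le_iff₀ hε]
      nlinarith
    have h2 : (R : ℝ) ≤ (10 * n ^ 2 : ℕ) := by
      push_cast
      nlinarith
    exact_mod_cast h2
  set Z₀ := ⌈10 * ℓ⌉₊ with hZ₀
  have hZ₀1 : 10 * ℓ ≤ Z₀ := Nat.le_ceil _
  have hZ₀2 : (Z₀ : ℝ) ≤ 10 * ℓ + 1 := (Nat.ceil_lt_add_one (by linarith)).le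
  have hZ₀n : Z₀ ≤ 10 * n := by
    have h2 : (Z₀ : ℝ) ≤ (10 * n : ℕ) := by
      push_cast
      linarith
    exact_mod_cast h2
  have hZ₀0 : 0 < Z₀ := Nat.ceil_pos.2 (by linarith)
  set N := n + k * (2 * R) with hN
  -- Enough buckets for all `N` elements with `Z₀` in each; the summand `2` covers rounding and
  -- ensures `2 ≤ X`.
  set X := N / Z₀ + 2 with hX
  obtain ⟨L, B, hL, hB, hLX, hXB, hBX, hBL⟩ := exists_dimensions (X := X) (Nat.le_add_left 2 _)
  have : NeZero B := ⟨hB.ne'⟩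
  have pw : ∀ {a b}, a ≤ b → P ^ a ≤ P ^ b := fun h => Nat.pow_le_pow_right (by omega) h
  have two_pow : ∀ a, 2 ^ a ≤ P ^ a := fun a => Nat.pow_le_pow_left hP2 a
  have hadd : ∀ {a x y}, x ≤ P ^ a → y ≤ P ^ a → x + y ≤ P ^ (a + 1) := by
    intro a x y hx hy
    rw [pow_succ]
    nlinarith [Nat.mul_le_mul_left (P ^ a) hP2]
  have hmul : ∀ {a b x y}, x ≤ P ^ a → y ≤ P ^ b → x * y ≤ P ^ (a + b) := by
    intro a b x y hx hy
    rw [pow_add]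
    exact Nat.mul_le_mul hx hy
  have hn1 : n ≤ P ^ 1 := by rwa [pow_one]
  have hk1 : k ≤ P ^ 1 := hkn.trans hn1
  have hRP : R ≤ P ^ 6 :=
    hRn.trans (hmul (a := 4) (b := 2) ((by norm_num : 10 ≤ 2 ^ 4).trans (two_pow 4))
      (Nat.pow_le_pow_left hnP 2))
  have hNP : N ≤ P ^ 9 := hadd (hn1.trans (pw (by norm_num)))
    (hmul hk1 (hmul (a := 1) (by rwa [pow_one]) hRP))
  have hXP : X ≤ P ^ 10 :=
    hadd ((Nat.div_le_self N Z₀).trans hNP) ((two_pow 1).trans (pw (by norm_num)))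
  have hBLP : B ^ L ≤ P ^ 12 :=
    hBX.trans (hmul (a := 2) ((by norm_num : 3 ≤ 2 ^ 2).trans (two_pow 2)) hXP)
  have hLX1 : L + 1 ≤ X := (Nat.le_self_pow hL.ne' _).trans hLX
  have hLP : L ≤ P ^ 10 := (Nat.le_succ L).trans (hLX1.trans hXP)
  have hBP : B ≤ P ^ 12 := (Nat.le_self_pow hL.ne' B).trans hBLP
  have hZP : 8 * Z₀ ≤ P ^ 8 := by
    refine (Nat.mul_le_mul_left 8 hZ₀n).trans ?_
    rw [← mul_assoc]
    exact hmul (a := 7) ((by norm_num : 8 * 10 ≤ 2 ^ 7).trans (two_pow 7)) hn1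
  have hw : 2 ^ (40 * c) = P ^ 40 := by rw [hP, ← pow_mul, mul_comm]
  have hm : 2 ^ (4 * c + 4) = 16 * P ^ 4 := by
    rw [hP, ← pow_mul, pow_add, mul_comm c 4]
    ring
  have hmP : 2 ^ (4 * c + 4) ≤ P ^ 8 := by
    rw [hm]
    exact hmul (two_pow 4) le_rfl
  obtain ⟨cd⟩ := exists_coding (k := k) (w := 40 * c) (Λ := Fin L → Fin B) (by
    rw [Fintype.card_fun, Fintype.card_fin, Fintype.card_fin, hw]
    exact (hadd (hmul (hadd hk1 (Nat.one_le_pow _ _ (by omega))) hBLP)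
      (Nat.one_le_pow _ _ (by omega))).trans (pw (by norm_num)))
  obtain ⟨slot, hslot, hpos⟩ := exists_slot (E := Elem n k R) (Λ := Fin L → Fin B) (Z₀ := Z₀)
    (Z := 8 * Z₀) (by
      rw [Fintype.card_sum, Fintype.card_prod, Fintype.card_fin, Fintype.card_fin,
        Fintype.card_fin, Fintype.card_fun, Fintype.card_fin, Fintype.card_fin]
      refine le_trans ?_ (Nat.mul_le_mul_right Z₀ hXB)
      have h1 := Nat.div_add_mod N Z₀
      have h2 := Nat.mod_lt N hZ₀0
      calc N ≤ Z₀ * (N / Z₀) + 2 * Z₀ := by omega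
        _ = X * Z₀ := by rw [hX]; ring) (by omega)
  obtain ⟨A, t, hA1, hA2, hA3, hA4, hA5, hA6⟩ := exists_network_algorithm cd slot hslot hpos hL
    (R := R) (f := 4 * c + 4) (δ := 1 / (n : ℝ) ^ 2) (by omega) (by
      rw [Fintype.card_prod, Fintype.card_prod, Fintype.card_bool, Fintype.card_fin,
        Fintype.card_fun, Fintype.card_fin, Fintype.card_fin, hw]
      exact (hmul (hmul (two_pow 1) (hadd (hmul hRP hmP) (Nat.one_le_pow _ _ (by omega))))
        hBLP).trans (pw (by norm_num))) (by
      rw [hw]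
      exact (hadd (hk1.trans (pw (by norm_num))) hNP).trans (pw (by norm_num))) (by
      rw [hw]
      exact (hmul hLP hBLP).trans (pw (by norm_num))) (by
      rw [hw]
      exact (hmul hBLP hZP).trans (pw (by norm_num))) (by
      rw [hw]
      exact (hadd (hmul hBP hZP) ((two_pow 1).trans (pw (by norm_num)))).trans
        (pw (by norm_num))) (by
      rw [hw]
      exact (hmul (two_pow 2) (hmul hmP (hadd (hn1.trans (pw (by norm_num))) hRP))).trans
        (pw (by norm_num))) hε (by
      have h1 := noise_error_le (m := 2 ^ (4 * c + 4)) hn2 hε hε' (by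
        rw [hm]
        exact Nat.mul_le_mul_left _ (Nat.pow_le_pow_left hnP 4)) hR1
      -- `n ^ 46` buckets and levels against the tail `n ^ (-50)` leave `2 / n ^ 4`, at most half of
      -- `1 / n ^ 2` because `n ≥ 2`.
      have h2 : ((L + 1 : ℕ) : ℝ) * (B ^ L : ℕ) ≤ (n : ℝ) ^ 46 := by
        have h3 : (L + 1) * B ^ L ≤ n ^ 46 :=
          calc (L + 1) * B ^ L ≤ P ^ (10 + 12) := hmul (hLX1.trans hXP) hBLP
            _ ≤ (n * n) ^ 22 := Nat.pow_le_pow_left (hPn.trans (Nat.mul_le_mul_right n hn2)) 22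
            _ = n ^ 44 := by ring
            _ ≤ n ^ 46 := Nat.pow_le_pow_right (by omega) (by norm_num)
        exact_mod_cast h3
      have h3 : Real.exp (-(5 * Z₀)) ≤ 1 / (n : ℝ) ^ 50 := by
        have h4 : Real.exp (((50 : ℕ) : ℝ) * ℓ) = (n : ℝ) ^ 50 := by
          rw [Real.exp_nat_mul, Real.exp_log hn0]
        rw [Real.exp_neg, ← one_div, ← h4]
        refine one_div_le_one_div_of_le (Real.exp_pos _) (Real.exp_le_exp.2 ?_)
        push_cast
        linarith
      have h4 := mul_le_mul h2 ((pow_div_factorial_le Z₀).trans h3) (by positivity)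
        (by positivity)
      have h5 : (n : ℝ) ^ 46 * (1 / (n : ℝ) ^ 50) = 1 / (n : ℝ) ^ 2 * (1 / (n : ℝ) ^ 2) := by
        field_simp
      have h6 : 1 / (n : ℝ) ^ 2 ≤ 1 / 4 := by
        refine one_div_le_one_div_of_le (by norm_num) ?_
        nlinarith
      have h7 : 1 / (2 * (n : ℝ) ^ 2) = 1 / (n : ℝ) ^ 2 / 2 := by field_simp
      have h8 : 0 ≤ 1 / (n : ℝ) ^ 2 := by positivity
      rw [h5] at h4
      rw [h7] at h1
      push_cast at h1 h4 ⊢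
      nlinarith [mul_le_mul_of_nonneg_left h6 h8])
  have hcℓ : (c : ℝ) ≤ 2 * ℓ + 1 := clog_le_log (by omega)
  have hLc : (L : ℝ) ≤ 20 * ℓ + 10 := by
    -- A cruder depth bound in terms of `n`, used for the private memory only.
    have h1 : 2 ^ L ≤ 2 ^ (10 * c) := by
      calc 2 ^ L ≤ (L + 1) ^ L := Nat.pow_le_pow_left (by omega) L
        _ ≤ P ^ 10 := hLX.trans hXP
        _ = 2 ^ (10 * c) := by rw [hP, ← pow_mul, mul_comm]
    have h2 : L ≤ 10 * c := (Nat.pow_le_pow_iff_right (by norm_num)).1 h1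
    have h3 : (L : ℝ) ≤ 10 * c := by exact_mod_cast h2
    linarith
  refine ⟨A, t, ?_, ?_, hA4, fun h3 => ?_, hA5, hA6⟩
  · rw [hA2]
    have h1 : (B : ℝ) ≤ (L + 2) ^ 2 := by exact_mod_cast hBL
    have h2 : (B : ℝ) ≤ 400 * (1 + ℓ) ^ 2 := by
      refine h1.trans ((pow_le_pow_left₀ (by positivity)
        (by linarith : (L : ℝ) + 2 ≤ 20 * (1 + ℓ)) 2).trans (le_of_eq (by ring)))
    have h4 : (8 * Z₀ : ℝ) ≤ 80 * (1 + ℓ) := by linarith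
    have h5 := mul_le_mul h2 h4 (by positivity) (by positivity)
    have h6 : (1 : ℝ) ≤ (1 + ℓ) ^ 3 := one_le_pow₀ (by linarith)
    have h7 : 400 * (1 + ℓ) ^ 2 * (80 * (1 + ℓ)) = 32000 * (1 + ℓ) ^ 3 := by ring
    push_cast
    linarith
  · rw [hA1]
    push_cast
    linarith
  · set x := nTilde n k ε with hx
    have hnx : (n : ℝ) ≤ x := le_max_left _ _
    have hkx : k * ℓ / ε ≤ x := le_max_right _ _
    have hkn' : (k : ℝ) ≤ n := by exact_mod_cast hkn
    have hN' : (N : ℝ) ≤ 25 * x := by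
      have h1 : (k : ℝ) * R ≤ k * (10 * ℓ / ε + 2) :=
        mul_le_mul_of_nonneg_left hR2 (Nat.cast_nonneg _)
      have h2 : (k : ℝ) * (10 * ℓ / ε + 2) = 10 * (k * ℓ / ε) + 2 * k := by ring
      rw [hN]
      push_cast
      linarith
    have hZ' : (Z₀ : ℝ) ≤ 10 * x := by
      have : (Z₀ : ℝ) ≤ 10 * n := by exact_mod_cast hZ₀n
      linarith
    have hG : ((B ^ L * (8 * Z₀) : ℕ) : ℝ) ≤ 1080 * x := by
      have h1 : B ^ L * (8 * Z₀) ≤ 24 * (N + 2 * Z₀) := by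
        calc B ^ L * (8 * Z₀) ≤ 3 * X * (8 * Z₀) := Nat.mul_le_mul_right _ hBX
          _ = 24 * (N / Z₀ * Z₀ + 2 * Z₀) := by rw [hX]; ring
          _ ≤ _ := by
            have := Nat.div_mul_le_self N Z₀
            omega
      have h2 : ((B ^ L * (8 * Z₀) : ℕ) : ℝ) ≤ 24 * (N + 2 * Z₀) := by exact_mod_cast h1
      linarith
    have hXx : (X : ℝ) ≤ 27 * x := by
      have h1 : X ≤ N + 2 := Nat.add_le_add_right (Nat.div_le_self N Z₀) 2
      have h2 : (X : ℝ) ≤ N + 2 := by exact_mod_cast h1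
      linarith
    have hdepth := depth_le h3 (L := L) (le_trans (by exact_mod_cast hLX) hXx)
    rw [hA3, ← hN]
    exact time_le h3 hL (hkn'.trans hnx) hN' hG hdepth

theorem bitsFor_le_log {N : ℕ} (hN : 1 ≤ N) : (bitsFor N : ℝ) ≤ 4 * (1 + Real.log N) := by
  have h1 := clog_le_log (N := N + 1) (Nat.le_add_left 1 N)
  have hN' : (1 : ℝ) ≤ N := by exact_mod_cast hN
  have h2 : Real.log ((N + 1 : ℕ) : ℝ) ≤ Real.log (2 * N) := by
    refine Real.log_le_log (by positivity) ?_
    push_cast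
    linarith
  rw [Real.log_mul (by norm_num) (by linarith)] at h2
  have h3 := Real.log_nonneg hN'
  have h4 := Real.log_two_lt_d9
  rw [bitsFor]
  push_cast at h1 h2 ⊢
  linarith

theorem le_runtime {n k t : ℕ} {ε : ℝ} (ht : t ≤ 3 * n + 1) (hx : 3 ≤ nTilde n k ε) :
    (t : ℝ) ≤ 100000 * (nTilde n k ε * Real.log (nTilde n k ε) /
      Real.log (Real.log (nTilde n k ε))) := by
  have h1 : (n : ℝ) ≤ nTilde n k ε := le_max_left _ _
  have h2 := mul_le_mul_of_nonneg_left (one_le_log_div_log_log hx)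
    (by linarith : 0 ≤ nTilde n k ε)
  rw [← mul_div_assoc] at h2
  have h3 : (t : ℝ) ≤ 3 * n + 1 := by exact_mod_cast ht
  linarith

end ODP

end

/-! ### The case distinction -/

theorem mainTheorem1 :
    ∃ (C : ℝ) (c : ℕ), 0 < C ∧ ∀ ε : ℝ, 0 < ε → ∀ n k : ℕ, 1 ≤ k → k ≤ n →
      ∃ (A : ODP.Algorithm n k) (t : ℕ),
        -- small private memory: polylogarithmically many words of logarithmic length
        (A.privWords : ℝ) ≤ C * (1 + Real.log n) ^ c ∧
        (A.wordBits : ℝ) ≤ C * (1 + Real.log (ODP.nTilde n k ε)) ∧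
        -- running time
        A.RunsInTime t ∧
        (3 ≤ ODP.nTilde n k ε →
          (t : ℝ) ≤ C * (ODP.nTilde n k ε * Real.log (ODP.nTilde n k ε) /
            Real.log (Real.log (ODP.nTilde n k ε)))) ∧
        -- privacy of the output together with the access pattern
        A.IsObliviouslyDP t ε (1 / (n : ℝ) ^ 2) ∧
        -- accuracy
        ∀ θ : ℝ, 0 < θ → θ < 1 → ∀ D : ODP.Database n k,
          ENNReal.ofReal (1 - θ) ≤
            (A.view D t).toOuterMeasure
              {v | ∀ i, |v.1 i - (ODP.histogram D i : ℝ)| ≤ Real.log (k / θ) * (2 / ε)} := by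
  refine ⟨100000, 3, by norm_num, fun ε hε n k hk hkn => ?_⟩
  have : NeZero k := ⟨by omega⟩
  have hn1 : (1 : ℝ) ≤ n := by exact_mod_cast hk.trans hkn
  have hℓ : 0 ≤ Real.log n := Real.log_nonneg hn1
  have hlog : Real.log n ≤ Real.log (ODP.nTilde n k ε) :=
    Real.log_le_log (by linarith) (le_max_left _ _)
  have hwords : ∀ a : ℝ, a ≤ 100000 → a ≤ 100000 * (1 + Real.log n) ^ 3 := fun a ha =>
    ha.trans (le_mul_of_one_le_right (by norm_num) (one_le_pow₀ (by linarith)))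
  have hbits := ODP.bitsFor_le_log (hk.trans hkn)
  have hδ : 0 ≤ 1 / (n : ℝ) ^ 2 := by positivity
  have hconst : ∀ c : ℕ, c ≤ n → (∀ (θ : ℝ) (D : ODP.Database n k) (i : Fin k), 0 < θ → θ < 1 →
      |(c : ℝ) - ODP.histogram D i| ≤ Real.log (k / θ) * (2 / ε)) →
      ∃ (A : ODP.Algorithm n k) (t : ℕ),
        (A.privWords : ℝ) ≤ 100000 * (1 + Real.log n) ^ 3 ∧
        (A.wordBits : ℝ) ≤ 100000 * (1 + Real.log (ODP.nTilde n k ε)) ∧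
        A.RunsInTime t ∧
        (3 ≤ ODP.nTilde n k ε →
          (t : ℝ) ≤ 100000 * (ODP.nTilde n k ε * Real.log (ODP.nTilde n k ε) /
            Real.log (Real.log (ODP.nTilde n k ε)))) ∧
        A.IsObliviouslyDP t ε (1 / (n : ℝ) ^ 2) ∧
        ∀ θ : ℝ, 0 < θ → θ < 1 → ∀ D : ODP.Database n k,
          ENNReal.ofReal (1 - θ) ≤ (A.view D t).toOuterMeasure
            {v | ∀ i, |v.1 i - (ODP.histogram D i : ℝ)| ≤ Real.log (k / θ) * (2 / ε)} := by
    intro c hc h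
    obtain ⟨A, hA1, hA2, hA3, hA4, hA5⟩ := ODP.exists_const_algorithm hkn c hc
    refine ⟨A, k + 1, ?_, ?_, hA3, fun h3 => ODP.le_runtime (by omega) h3, hA4 _ _ hε.le hδ,
      fun θ hθ hθ' D => hA5 θ D _ hθ fun v hv i => ?_⟩
    · rw [hA2]
      exact hwords _ (by norm_num)
    · rw [hA1]
      linarith
    · rw [hv]
      exact h θ D i hθ hθ'
  rcases hk.eq_or_lt with rfl | hk2
  · refine hconst n le_rfl fun θ D i hθ hθ' => ?_
    have h1 : ODP.histogram D i = n := by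
      rw [ODP.histogram, Finset.filter_true_of_mem fun j _ => Subsingleton.elim _ _,
        Finset.card_univ, Fintype.card_fin]
    rw [h1, sub_self, abs_zero]
    refine mul_nonneg (Real.log_nonneg ?_) (by positivity)
    rw [le_div_iff₀ hθ]
    push_cast
    linarith
  have hk2' : (2 : ℝ) ≤ k := by exact_mod_cast hk2
  have hn2 : (2 : ℝ) ≤ n := hk2'.trans (by exact_mod_cast hkn)
  -- Here the output `0` has error at most `n ≤ 1 / ε`, which is allowed because `log (k / θ) ≥ log
  -- 2 > 1 / 2`.
  rcases le_or_gt (ε * n) 1 with h1 | h1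
  · refine hconst 0 (Nat.zero_le n) fun θ D i hθ hθ' => ?_
    have h2 : (ODP.histogram D i : ℝ) ≤ n := by exact_mod_cast ODP.histogram_le D i
    have h3 : Real.log 2 ≤ Real.log (k / θ) := by
      refine Real.log_le_log (by norm_num) ?_
      rw [le_div_iff₀ hθ]
      linarith
    have h4 := Real.log_two_gt_d9
    have h5 : (n : ℝ) ≤ 1 / ε := by rw [le_div_iff₀ hε]; linarith
    rw [Nat.cast_zero, zero_sub, abs_neg, abs_of_nonneg (Nat.cast_nonneg _)]
    calc (ODP.histogram D i : ℝ) ≤ 1 / ε := h2.trans h5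
      _ = 1 / 2 * (2 / ε) := by ring
      _ ≤ Real.log (k / θ) * (2 / ε) :=
        mul_le_mul_of_nonneg_right (by linarith) (by positivity)
  -- The threshold is what makes `n * k * exp (-ε) ≤ n ^ 2 * exp (-ε) ≤ exp (-ε / 2)`.
  rcases le_or_gt (4 * Real.log n) ε with h2 | h2
  · obtain ⟨A, hA1, hA2, hA3, hA4, hA5⟩ := ODP.exists_respond_algorithm hkn hε (by
      have h3 : (n : ℝ) * (k * Real.exp (-ε)) ≤ n * (n * Real.exp (-ε)) := by gcongr
      refine h3.trans ?_
      have h4 : (n : ℝ) * (n * Real.exp (-ε)) = Real.exp (2 * Real.log n - ε) := by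
        rw [two_mul, sub_eq_add_neg, Real.exp_add, Real.exp_add, Real.exp_log (by linarith)]
        ring
      rw [h4]
      exact Real.exp_le_exp.2 (by linarith))
    refine ⟨A, n * 3 + 1, ?_, ?_, hA3, fun h3 => ODP.le_runtime (by omega) h3, hA4 _ hδ,
      fun θ hθ hθ' D => hA5 θ D hθ hθ'⟩
    · rw [hA2]
      exact hwords _ (by norm_num)
    · rw [hA1]
      linarith
  · obtain ⟨A, t, hA1, hA2, hA3, hA4, hA5, hA6⟩ :=
      ODP.exists_algorithm_of_moderate hk2 hkn hε h1 h2
    exact ⟨A, t, hA1, by linarith, hA3, hA4, hA5, fun θ hθ hθ' D => hA6 θ D hθ hθ'⟩
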